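/- Let $A\in\mathbb R^{n\times d}$ ($d\ge 1$) have rows $a_1,\dots,a_n$, let $\psi_1,\dots,\psi_n:\mathbb R\to\mathbb R$ be twice differentiable with $\frac1M\le\psi_i''(t)\le M$ for all $t$, and put $F(x)=\sum_{i=1}^n\psi_i(a_i^\top x)$ for $x\in\mathbb R^d$. Suppose that, for given numbers $0<\mu_i\le L_i$ and $\lambda>0$, one has $\psi_i''(t)\in[\mu_i,L_i]$ for all $t\in\mathbb R$ and all $i$, and $\nabla^2F(x)\succeq\lambda I$ for all $x\in\mathbb R^d$. Let $s(A)$ be the maximum number of non-zero entries in a row of $A$ and $\kappa=\lambda_{\max}(A^\top A)/\lambda_{\min}(A^\top A)$. For every constant $c\in\mathbb N$ there are a randomized algorithm and constants $C,k$ (depending only on $c$) such that for all such data, every $x_0\in\mathbb R^d$ and every $\epsilon\in(0,\frac12]$, the algorithm, with probability at least $1-n^{-c}$, halts with an output $x'$ satisfying $$F(x')-\min_xF(x)\le\epsilon\,\bigl(F(x_0)-\min_xF(x)\bigr)$$ within time $$C\,\bigl(1+\log(n\,d\,\kappa\,M)\bigr)^k\left(\sum_{i=1}^n\sqrt{\frac{L_i}{\mu_i}}+\sum_{i=1}^n\|a_i\|_2\sqrt{\frac{L_i}{\lambda}}\right)s(A)\,\log(1/\epsilon).$$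 Here an algorithm is one fixed program (independent of $n$, $d$ and the data) for a real RAM with exact real arithmetic (including $\sqrt{\cdot}$), uniformly random integers, and an oracle returning $\psi_i(t)$ and $\psi_i'(t)$ at unit cost; its input consists of $n,d$, the sparse rows of $A$, and $M,(\mu_i),(L_i),\lambda,x_0,\epsilon$, and time is the number of executed steps. -/

import Mathlib

/-! ## Empirical risk minimization -/

namespace ERM

noncomputable section

/-- The objective `F(x) = ∑ i, ψ i (a i ⬝ x)`, where `a i` is the `i`-th row of `A`. -/
def objective {n d : ℕ} (A : Matrix (Fin n) (Fin d) ℝ) (ψ : Fin n → ℝ → ℝ)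
    (x : Fin d → ℝ) : ℝ :=
  ∑ i, ψ i (A i ⬝ᵥ x)

/-- `f` is twice differentiable on `ℝ` and its second derivative takes values in `[lo, hi]`. -/
def SecondDerivIn (f : ℝ → ℝ) (lo hi : ℝ) : Prop :=
  Differentiable ℝ f ∧ Differentiable ℝ (deriv f) ∧ ∀ t, deriv (deriv f) t ∈ Set.Icc lo hi

/-- `∇² F(x) ⪰ lam • I` for all `x`: the second derivative of `F` at `x`, as a bilinear form,
is bounded below by `lam` times the squared Euclidean norm. -/
def HessianGE {d : ℕ} (F : (Fin d → ℝ) → ℝ) (lam : ℝ) : Prop :=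
  ∀ x v : Fin d → ℝ, lam * (v ⬝ᵥ v) ≤ fderiv ℝ (fderiv ℝ F) x v v

/-- `s(A)`, the maximal number of non-zero entries in a row of `A`. -/
def rowSparsity {n d : ℕ} (A : Matrix (Fin n) (Fin d) ℝ) : ℕ :=
  Finset.univ.sup fun i => (Finset.univ.filter fun j => A i j ≠ 0).card

/-- The Euclidean norm of the `i`-th row of `A`. -/
def rowNorm {n d : ℕ} (A : Matrix (Fin n) (Fin d) ℝ) (i : Fin n) : ℝ :=
  ‖WithLp.toLp 2 (A i)‖

/-- The eigenvalues of the symmetric matrix `Aᵀ A` (for a real matrix, `Aᴴ = Aᵀ`). -/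
def gramEigenvalues {n d : ℕ} (A : Matrix (Fin n) (Fin d) ℝ) : Fin d → ℝ :=
  (Matrix.isHermitian_conjTranspose_mul_self A).eigenvalues

/-- The condition number `κ = λ_max(Aᵀ A) / λ_min(Aᵀ A)`. -/
def condNumber {n d : ℕ} (A : Matrix (Fin n) (Fin d) ℝ) : ℝ :=
  (⨆ j, gramEigenvalues A j) / (⨅ j, gramEigenvalues A j)

end

end ERM

/-! ## A randomized real RAM with a first-order oracle

Memory consists of arrays of natural numbers and arrays of real numbers; every array has a name
(a natural number) and is indexed by pairs of natural numbers. A program is a fixed finite piece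
of syntax; one step of execution performs one assignment, one random draw or one test of the
program, hence a number of arithmetic operations, memory accesses and oracle calls that is bounded
by a constant of the program. Real arithmetic is exact; reals cannot be rounded to
integers. -/

namespace RealRAM

noncomputable section

/-- Memory contents: `N a i j` and `R a i j` are the cells `(i, j)` of the natural-number array
and of the real array with name `a`. -/
structure Mem where
  N : ℕ → ℕ → ℕ → ℕ
  R : ℕ → ℕ → ℕ → ℝ

/-- Oracle access to functions `ψ_0, ψ_1, …`: `val i t` is `ψ_i(t)` and `der i t` is `ψ_i'(t)`. -/
structure Oracle where
  val : ℕ → ℝ → ℝ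
  der : ℕ → ℝ → ℝ

/-- Expressions with values in the natural numbers (`sub` is truncated). -/
inductive NExpr where
  | const (k : ℕ)
  | get (a : ℕ) (i j : NExpr)
  | add (e f : NExpr)
  | sub (e f : NExpr)
  | mul (e f : NExpr)

/-- Expressions with values in the real numbers. -/
inductive RExpr where
  | ofNat (e : NExpr)
  | get (a : ℕ) (i j : NExpr)
  | add (e f : RExpr)
  | sub (e f : RExpr)
  | mul (e f : RExpr)
  | div (e f : RExpr)
  | sqrt (e : RExpr)
  | val (i : NExpr) (t : RExpr)
  | der (i : NExpr) (t : RExpr)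

/-- Tests. -/
inductive BExpr where
  | ltN (e f : NExpr)
  | ltR (e f : RExpr)
  | not (b : BExpr)
  | and (b c : BExpr)

/-- Programs. `setN a i j e` and `setR a i j e` are assignments to a cell, and `rand a i j e`
stores in a cell a fresh uniformly random element of `{0, …, e}`. -/
inductive Cmd where
  | skip
  | setN (a : ℕ) (i j : NExpr) (e : NExpr)
  | setR (a : ℕ) (i j : NExpr) (e : RExpr)
  | rand (a : ℕ) (i j : NExpr) (e : NExpr)
  | seq (c d : Cmd)
  | cond (b : BExpr) (c d : Cmd)
  | loop (b : BExpr) (c : Cmd)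

def NExpr.eval (m : Mem) : NExpr → ℕ
  | const k => k
  | get a i j => m.N a (i.eval m) (j.eval m)
  | add e f => e.eval m + f.eval m
  | sub e f => e.eval m - f.eval m
  | mul e f => e.eval m * f.eval m

def RExpr.eval (O : Oracle) (m : Mem) : RExpr → ℝ
  | ofNat e => (e.eval m : ℝ)
  | get a i j => m.R a (i.eval m) (j.eval m)
  | add e f => e.eval O m + f.eval O m
  | sub e f => e.eval O m - f.eval O m
  | mul e f => e.eval O m * f.eval O m
  | div e f => e.eval O m / f.eval O m
  | sqrt e => Real.sqrt (e.eval O m)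
  | val i t => O.val (i.eval m) (t.eval O m)
  | der i t => O.der (i.eval m) (t.eval O m)

def BExpr.eval (O : Oracle) (m : Mem) : BExpr → Bool
  | ltN e f => decide (e.eval m < f.eval m)
  | ltR e f => decide (e.eval O m < f.eval O m)
  | not b => !(b.eval O m)
  | and b c => b.eval O m && c.eval O m

def Mem.setN (m : Mem) (a i j v : ℕ) : Mem :=
  { m with N := fun a' i' j' => if a' = a ∧ i' = i ∧ j' = j then v else m.N a' i' j' }

def Mem.setR (m : Mem) (a i j : ℕ) (v : ℝ) : Mem :=
  { m with R := fun a' i' j' => if a' = a ∧ i' = i ∧ j' = j then v else m.R a' i' j' }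

/-- A configuration: the commands that remain to be executed, and the memory. The execution has
halted when no command remains. -/
abbrev Config := List Cmd × Mem

/-- One step of execution, as a probability distribution on the next configuration. -/
def step (O : Oracle) : Config → PMF Config
  | ([], m) => PMF.pure ([], m)
  | (.skip :: K, m) => PMF.pure (K, m)
  | (.setN a i j e :: K, m) => PMF.pure (K, m.setN a (i.eval m) (j.eval m) (e.eval m))
  | (.setR a i j e :: K, m) => PMF.pure (K, m.setR a (i.eval m) (j.eval m) (e.eval O m))
  | (.rand a i j e :: K, m) =>
      (PMF.uniformOfFintype (Fin (e.eval m + 1))).map fun r =>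
        (K, m.setN a (i.eval m) (j.eval m) r)
  | (.seq c d :: K, m) => PMF.pure (c :: d :: K, m)
  | (.cond b c d :: K, m) => PMF.pure ((if b.eval O m then c else d) :: K, m)
  | (.loop b c :: K, m) => PMF.pure (if b.eval O m then c :: .loop b c :: K else K, m)

/-- The distribution of the configuration after `T` steps. -/
def run (O : Oracle) : ℕ → Config → PMF Config
  | 0, cfg => PMF.pure cfg
  | T + 1, cfg => (step O cfg).bind (run O T)

/-- The probability that `P`, started on memory `m`, halts within `T` steps with final memory
satisfying `good`. -/
def probHaltsWith (O : Oracle) (P : Cmd) (m : Mem) (T : ℕ) (good : Mem → Prop) : ENNReal :=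
  (run O T ([P], m)).toOuterMeasure {cfg | cfg.1 = [] ∧ good cfg.2}

end

end RealRAM

/-! ## Input and output of an ERM solver -/

namespace ERM

noncomputable section

/-- The increasing list of the columns of the non-zero entries of row `i`. -/
def rowSupport {n d : ℕ} (A : Matrix (Fin n) (Fin d) ℝ) (i : Fin n) : List (Fin d) :=
  (List.finRange d).filter fun j => decide (A i j ≠ 0)

/-- A finite vector as a one-dimensional array (stored in the cells `(i, 0)`). -/
def vecArray {n : ℕ} {α : Type} [Zero α] (v : Fin n → α) (i j : ℕ) : α :=
  if h : i < n ∧ j = 0 then v ⟨i, h.1⟩ else 0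

/-- The single value `v`, stored in the cell `(0, 0)`. -/
def scalarArray {α : Type} [Zero α] (v : α) (i j : ℕ) : α :=
  if i = 0 ∧ j = 0 then v else 0

/-- Cell `(i, k)` holds the column index of the `k`-th non-zero entry of row `i`. -/
def colArray {n d : ℕ} (A : Matrix (Fin n) (Fin d) ℝ) (i k : ℕ) : ℕ :=
  if h : i < n then ((rowSupport A ⟨i, h⟩)[k]?.map fun j => (j : ℕ)).getD 0 else 0

/-- Cell `(i, k)` holds the value of the `k`-th non-zero entry of row `i`. -/
def valArray {n d : ℕ} (A : Matrix (Fin n) (Fin d) ℝ) (i k : ℕ) : ℝ :=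
  if h : i < n then ((rowSupport A ⟨i, h⟩)[k]?.map fun j => A ⟨i, h⟩ j).getD 0 else 0

/-- The initial memory: the matrix as sparse rows, the initial point, and the parameters. The
functions `ψ i` are not part of it; they are accessible through the oracle only. -/
def inputMem {n d : ℕ} (A : Matrix (Fin n) (Fin d) ℝ) (M : ℝ) (μ L : Fin n → ℝ) (lam : ℝ)
    (x₀ : Fin d → ℝ) (ε : ℝ) : RealRAM.Mem where
  N := fun
    | 0 => scalarArray n
    | 1 => scalarArray d
    | 2 => vecArray fun i => (rowSupport A i).length
    | 3 => colArray A
    | _ => fun _ _ => 0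
  R := fun
    | 0 => valArray A
    | 1 => vecArray x₀
    | 2 => vecArray μ
    | 3 => vecArray L
    | 4 => scalarArray M
    | 5 => scalarArray lam
    | 6 => scalarArray ε
    | _ => fun _ _ => 0

/-- The output vector is read off the real array with name `7`. -/
def output (d : ℕ) (m : RealRAM.Mem) : Fin d → ℝ := fun j => m.R 7 j 0

/-- The first-order oracle of `ψ`. -/
def oracle {n : ℕ} (ψ : Fin n → ℝ → ℝ) : RealRAM.Oracle where
  val := fun i t => if h : i < n then ψ ⟨i, h⟩ t else 0
  der := fun i t => if h : i < n then deriv (ψ ⟨i, h⟩) t else 0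

end

end ERM

open scoped BigOperators ENNReal

namespace ERM

/-! ### Functions of one variable with bounded second derivative -/

/-! The algorithm is an inexact proximal point method. For a center `c`, let `x` minimize `F + lam /
2 ‖· - c‖²`. Comparing `x` with the midpoint of `c` and the minimizer of `F`, strong convexity
cancels the penalty, so the proximal value at `x` already halves the suboptimality of `c`
(`proxObj_min_le`). It remains to approximate `x` cheaply.

This is done by a randomized primal-dual iteration. It keeps one number `z i` per summand, with
`deriv (ψ i) (z i)` in the role of the dual variable, and a point `w`. With `k i = ⌈1 + √(L i ‖a i‖²
/ lam)⌉` and `K = ∑ k i`, index `i` is drawn with probability `k i / K`. A step contracts the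
expectation of the Lyapunov function `potential` by `1 - 1 / K` (`sum_mul_potential_step_le`): the
variance caused by the draw is paid for by cocoercivity, precisely because `L i ‖a i‖² / lam ≤ (k i
- 1) k i`. After `K ℓ` steps with `2 ^ ℓ ≥ 4 K²` the error is a quarter of the old gap, so a stage
multiplies the expected gap by `3 / 4` (`spec_stageCmd`). Writing `w = c - g / lam + b v` with `g =
∑ i, deriv (ψ i) (z i) • a i`, the dense part of a step only rescales `b` (`primalPoint_eq`), hence
a step costs `O(s(A))`. Taking `S` stages with `(3 / 4) ^ S ≤ ε / n ^ c` and applying Markov's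
inequality gives failure probability `n ^ (-c)`. Finally `K` is at most twice the sum in the time
bound.

One difficulty remains: `ℓ` is of order `log K`, and a pessimistic `lam` can make `K` arbitrarily
large compared with `n d κ M`. Therefore about `S K / n` steps of gradient descent come first; they
cost only `O(S K s(A))`. The true strong convexity is at least `lam' = λ_min / M`, and with the caps
`min (L i) M` the condition number is at most `Q = d κ M²`. If `K ≥ 36 n² Q²`, these steps already
suffice, and this is detected by a test on gradient norms (`gradient_test_of_large`) that certifies
the accuracy whenever it passes (`gap_le_of_gradient_test`). If the test fails, then `K < 36 n² Q²`,
so `log K` is `O(1 + log (n d κ M))` and the randomized stages fit into the budget.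

Programs are analyzed in a small probabilistic Hoare logic (`Exec`, `Spec`, `Ensures`) that tracks a
step bound, an invariant, the arrays written, and the expectation of a potential. -/

lemma tangent_le {f : ℝ → ℝ} (hf : Differentiable ℝ f) (hf' : Differentiable ℝ (deriv f))
    (h : ∀ t, 0 ≤ deriv (deriv f) t) (w z : ℝ) : f w + deriv f w * (z - w) ≤ f z := by
  have hc : ConvexOn ℝ Set.univ f :=
    convexOn_univ_of_deriv2_nonneg hf hf' (fun x => by simpa using h x)
  have hd : HasDerivAt f (deriv f w) w := (hf w).hasDerivAt
  rcases lt_trichotomy w z with hwz | rfl | hwz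
  · have := hc.le_slope_of_hasDerivAt (Set.mem_univ _) (Set.mem_univ _) hwz hd
    rw [slope_def_field, le_div_iff₀ (by linarith)] at this
    linarith
  · simp
  · have := hc.slope_le_of_hasDerivAt (Set.mem_univ _) (Set.mem_univ _) hwz hd
    rw [slope_def_field, div_le_iff₀ (by linarith)] at this
    linarith

lemma hasDerivAt_half_sq (c w : ℝ) : HasDerivAt (fun t : ℝ => c / 2 * t ^ 2) (c * w) w := by
  refine ((hasDerivAt_pow 2 w).const_mul (c / 2)).congr_deriv ?_
  norm_num
  ring

lemma SecondDerivIn.lower {f : ℝ → ℝ} {lo hi : ℝ} (h : SecondDerivIn f lo hi) (w z : ℝ) :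
    f w + deriv f w * (z - w) + lo / 2 * (z - w) ^ 2 ≤ f z := by
  obtain ⟨h1, h2, h3⟩ := h
  have hd : ∀ t, HasDerivAt (fun t => f t - lo / 2 * t ^ 2) (deriv f t - lo * t) t := fun t =>
    (h1 t).hasDerivAt.sub (hasDerivAt_half_sq lo t)
  have hd1 : deriv (fun t => f t - lo / 2 * t ^ 2) = fun t => deriv f t - lo * t :=
    funext fun t => (hd t).deriv
  have hd2 : ∀ t, HasDerivAt (fun t => deriv f t - lo * t) (deriv (deriv f) t - lo) t := fun t =>
    (h2 t).hasDerivAt.sub (by simpa using (hasDerivAt_id t).const_mul lo)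
  have := tangent_le (f := fun t => f t - lo / 2 * t ^ 2) (fun t => (hd t).differentiableAt)
    (by rw [hd1]; exact fun t => (hd2 t).differentiableAt)
    (fun t => by rw [hd1, (hd2 t).deriv]; linarith [(h3 t).1]) w z
  rw [hd1] at this
  dsimp only at this
  nlinarith

lemma SecondDerivIn.upper {f : ℝ → ℝ} {lo hi : ℝ} (h : SecondDerivIn f lo hi) (w z : ℝ) :
    f z ≤ f w + deriv f w * (z - w) + hi / 2 * (z - w) ^ 2 := by
  obtain ⟨h1, h2, h3⟩ := h
  have hd : ∀ t, HasDerivAt (fun t => hi / 2 * t ^ 2 - f t) (hi * t - deriv f t) t := fun t =>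
    (hasDerivAt_half_sq hi t).sub (h1 t).hasDerivAt
  have hd1 : deriv (fun t => hi / 2 * t ^ 2 - f t) = fun t => hi * t - deriv f t :=
    funext fun t => (hd t).deriv
  have hd2 : ∀ t, HasDerivAt (fun t => hi * t - deriv f t) (hi - deriv (deriv f) t) t := fun t =>
    HasDerivAt.sub (by simpa using (hasDerivAt_id t).const_mul hi) (h2 t).hasDerivAt
  have := tangent_le (f := fun t => hi / 2 * t ^ 2 - f t) (fun t => (hd t).differentiableAt)
    (by rw [hd1]; exact fun t => (hd2 t).differentiableAt)
    (fun t => by rw [hd1, (hd2 t).deriv]; linarith [(h3 t).2]) w z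
  rw [hd1] at this
  dsimp only at this
  nlinarith

/-- Evaluate the lower bound based at `w` and the upper bound based at `z` at the same point, the
gradient step `z - (f' z - f' w) / hi`. The resulting squared derivative difference is what later
absorbs the variance of a random step. -/
lemma SecondDerivIn.cocoercive {f : ℝ → ℝ} {lo hi : ℝ} (h : SecondDerivIn f lo hi) (hlo : 0 ≤ lo)
    (hhi : 0 < hi) (w z : ℝ) :
    f w + deriv f w * (z - w) + (deriv f z - deriv f w) ^ 2 / (2 * hi) ≤ f z := by
  have e1 := h.lower w (z - (deriv f z - deriv f w) / hi)
  have e2 := h.upper z (z - (deriv f z - deriv f w) / hi)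
  have e3 : 0 ≤ lo / 2 * (z - (deriv f z - deriv f w) / hi - w) ^ 2 := by positivity
  have e4 : hi / 2 * (z - (deriv f z - deriv f w) / hi - z) ^ 2
      = (deriv f z - deriv f w) ^ 2 / (2 * hi) := by
    field_simp
    ring
  have e5 : (deriv f z - deriv f w) ^ 2 / (2 * hi) * 2
      = (deriv f z - deriv f w) * ((deriv f z - deriv f w) / hi) := by
    field_simp
  rw [e4] at e2
  nlinarith

/-- Used to cap `L i` by `M`: the smoothness constant is then controlled by `M` and the spectrum of
`Aᵀ A`, however large the given `L i` are. -/
lemma SecondDerivIn.min_right {f : ℝ → ℝ} {lo hi lo' hi' : ℝ} (h : SecondDerivIn f lo hi)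
    (h' : SecondDerivIn f lo' hi') : SecondDerivIn f lo (min hi hi') :=
  ⟨h.1, h.2.1, fun t => ⟨(h.2.2 t).1, le_min (h.2.2 t).2 (h'.2.2 t).2⟩⟩

/-! ### The objective: gradient, Hessian, strong convexity -/

variable {n d : ℕ}

/-- The gradient of `objective A ψ`. -/
noncomputable def gradient (A : Matrix (Fin n) (Fin d) ℝ) (ψ : Fin n → ℝ → ℝ) (x : Fin d → ℝ) :
    Fin d → ℝ :=
  ∑ i, deriv (ψ i) (A i ⬝ᵥ x) • A i

lemma gradient_dotProduct (A : Matrix (Fin n) (Fin d) ℝ) (ψ : Fin n → ℝ → ℝ) (x v : Fin d → ℝ) :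
    gradient A ψ x ⬝ᵥ v = ∑ i, deriv (ψ i) (A i ⬝ᵥ x) * (A i ⬝ᵥ v) := by
  simp [gradient, sum_dotProduct, smul_dotProduct]

/-- The quadratic form of the Hessian of the objective is at least `lam` times the identity. -/
def HessianForm (A : Matrix (Fin n) (Fin d) ℝ) (ψ : Fin n → ℝ → ℝ) (lam : ℝ) : Prop :=
  ∀ x v : Fin d → ℝ, lam * (v ⬝ᵥ v) ≤ ∑ i, deriv (deriv (ψ i)) (A i ⬝ᵥ x) * (A i ⬝ᵥ v) ^ 2

/-- First-order strong convexity of the objective. -/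
def StronglyCvx (A : Matrix (Fin n) (Fin d) ℝ) (ψ : Fin n → ℝ → ℝ) (lam : ℝ) : Prop :=
  ∀ x y : Fin d → ℝ, objective A ψ x + gradient A ψ x ⬝ᵥ (y - x)
    + lam / 2 * ((y - x) ⬝ᵥ (y - x)) ≤ objective A ψ y

/-- The functional `v ↦ a ⬝ᵥ v` as a continuous linear map. -/
noncomputable def dotCLM (a : Fin d → ℝ) : (Fin d → ℝ) →L[ℝ] ℝ :=
  ∑ j, a j • ContinuousLinearMap.proj (R := ℝ) (φ := fun _ : Fin d => ℝ) j

@[simp] lemma dotCLM_apply (a v : Fin d → ℝ) : dotCLM a v = a ⬝ᵥ v := by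
  simp [dotCLM, dotProduct]

lemma hessianForm_of_hessianGE {A : Matrix (Fin n) (Fin d) ℝ} {ψ : Fin n → ℝ → ℝ} {lam : ℝ}
    (h1 : ∀ i, Differentiable ℝ (ψ i)) (h2 : ∀ i, Differentiable ℝ (deriv (ψ i)))
    (h : HessianGE (objective A ψ) lam) : HessianForm A ψ lam := by
  have hl : ∀ i (x : Fin d → ℝ), HasFDerivAt (fun x => A i ⬝ᵥ x) (dotCLM (A i)) x := fun i x =>
    ((dotCLM (A i)).hasFDerivAt (x := x)).congr_of_eventuallyEq
      (Filter.Eventually.of_forall fun y => (dotCLM_apply _ y).symm)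
  have hF : ∀ x, HasFDerivAt (objective A ψ)
      (∑ i, deriv (ψ i) (A i ⬝ᵥ x) • dotCLM (A i)) x := fun x => by
    have := HasFDerivAt.fun_sum (u := Finset.univ) (fun i _ =>
      ((h1 i (A i ⬝ᵥ x)).hasDerivAt.comp_hasFDerivAt x (hl i x)))
    exact this
  have hF' : fderiv ℝ (objective A ψ) = fun x => ∑ i, deriv (ψ i) (A i ⬝ᵥ x) • dotCLM (A i) :=
    funext fun x => (hF x).fderiv
  intro x v
  have hG : HasFDerivAt (fderiv ℝ (objective A ψ))
      (∑ i, (deriv (deriv (ψ i)) (A i ⬝ᵥ x) • dotCLM (A i)).smulRight (dotCLM (A i))) x := by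
    rw [hF']
    exact HasFDerivAt.fun_sum (u := Finset.univ) (fun i _ =>
      (((h2 i (A i ⬝ᵥ x)).hasDerivAt.comp_hasFDerivAt x (hl i x)).smul_const (dotCLM (A i))))
  have := h x v
  rw [hG.fderiv] at this
  refine this.trans_eq ?_
  simp [pow_two, mul_assoc]

/-- Restrict to the segment from `x` to `y`, subtract the quadratic `lam ‖v‖² t² / 2`, and use the
tangent inequality between `0` and `1`. It serves both for the given `lam` and for the spectral
constant `λ_min / M`. -/
lemma HessianForm.stronglyCvx {A : Matrix (Fin n) (Fin d) ℝ} {ψ : Fin n → ℝ → ℝ} {lam : ℝ}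
    (h1 : ∀ i, Differentiable ℝ (ψ i)) (h2 : ∀ i, Differentiable ℝ (deriv (ψ i)))
    (h : HessianForm A ψ lam) : StronglyCvx A ψ lam := by
  intro x y
  set v := y - x with hv
  have hl : ∀ i (t : ℝ), HasDerivAt (fun t : ℝ => A i ⬝ᵥ x + t * (A i ⬝ᵥ v)) (A i ⬝ᵥ v) t :=
    fun i t => by simpa using ((hasDerivAt_id t).mul_const (A i ⬝ᵥ v)).const_add (A i ⬝ᵥ x)
  have hd : ∀ t, HasDerivAt (fun t => ∑ i, ψ i (A i ⬝ᵥ x + t * (A i ⬝ᵥ v)))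
      (∑ i, deriv (ψ i) (A i ⬝ᵥ x + t * (A i ⬝ᵥ v)) * (A i ⬝ᵥ v)) t := fun t =>
    HasDerivAt.fun_sum (u := Finset.univ) (fun i _ =>
      ((h1 i _).hasDerivAt.comp t (hl i t)))
  have hd2 : ∀ t, HasDerivAt (fun t => ∑ i, deriv (ψ i) (A i ⬝ᵥ x + t * (A i ⬝ᵥ v)) * (A i ⬝ᵥ v))
      (∑ i, deriv (deriv (ψ i)) (A i ⬝ᵥ x + t * (A i ⬝ᵥ v)) * (A i ⬝ᵥ v) * (A i ⬝ᵥ v)) t := fun t =>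
    HasDerivAt.fun_sum (u := Finset.univ) (fun i _ =>
      (((h2 i _).hasDerivAt.comp t (hl i t)).mul_const _))
  have hd1 : deriv (fun t => ∑ i, ψ i (A i ⬝ᵥ x + t * (A i ⬝ᵥ v))) = _ :=
    funext fun t => (hd t).deriv
  obtain ⟨C, hC⟩ : ∃ C, C = lam * (v ⬝ᵥ v) := ⟨_, rfl⟩
  have hg : ∀ t, HasDerivAt (fun t => ∑ i, ψ i (A i ⬝ᵥ x + t * (A i ⬝ᵥ v)) - C / 2 * t ^ 2)
      (∑ i, deriv (ψ i) (A i ⬝ᵥ x + t * (A i ⬝ᵥ v)) * (A i ⬝ᵥ v) - C * t) t := fun t =>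
    (hd t).sub (hasDerivAt_half_sq C t)
  have hg' := funext fun t => (hg t).deriv
  have hg2 : ∀ t, HasDerivAt
      (fun t => ∑ i, deriv (ψ i) (A i ⬝ᵥ x + t * (A i ⬝ᵥ v)) * (A i ⬝ᵥ v) - C * t)
      (∑ i, deriv (deriv (ψ i)) (A i ⬝ᵥ x + t * (A i ⬝ᵥ v)) * (A i ⬝ᵥ v) * (A i ⬝ᵥ v) - C) t :=
    fun t => (hd2 t).sub (by simpa using (hasDerivAt_id t).const_mul C)
  have := tangent_le (fun t => (hg t).differentiableAt)
    (by rw [hg']; exact fun t => (hg2 t).differentiableAt)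
    (fun t => by
      rw [hg', (hg2 t).deriv, sub_nonneg, hC]
      refine (h (x + t • v) v).trans_eq ?_
      simp [dotProduct_add, dotProduct_smul, pow_two, mul_assoc]) 0 1
  rw [(hg 0).deriv] at this
  simp only [zero_mul, add_zero, one_mul] at this
  have e : ∀ i, A i ⬝ᵥ x + A i ⬝ᵥ v = A i ⬝ᵥ y := fun i => by rw [← dotProduct_add]; simp [hv]
  simp only [e] at this
  rw [gradient_dotProduct]
  unfold objective
  nlinarith

lemma dotProduct_self_nonneg' (v : Fin d → ℝ) : 0 ≤ v ⬝ᵥ v :=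
  Finset.sum_nonneg fun _ _ => mul_self_nonneg _

lemma dotProduct_sq_le (a v : Fin d → ℝ) : (a ⬝ᵥ v) ^ 2 ≤ (a ⬝ᵥ a) * (v ⬝ᵥ v) := by
  have := Finset.sum_mul_sq_le_sq_mul_sq Finset.univ a v
  simpa [dotProduct, pow_two] using this

/-- The smoothness constant `∑ i, L i ‖a i‖²`. -/
def smoothness (A : Matrix (Fin n) (Fin d) ℝ) (L : Fin n → ℝ) : ℝ :=
  ∑ i, L i * (A i ⬝ᵥ A i)

lemma objective_upper {A : Matrix (Fin n) (Fin d) ℝ} {ψ : Fin n → ℝ → ℝ} {μ L : Fin n → ℝ}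
    (h : ∀ i, SecondDerivIn (ψ i) (μ i) (L i)) (hL : ∀ i, 0 ≤ L i) (x y : Fin d → ℝ) :
    objective A ψ y ≤ objective A ψ x + gradient A ψ x ⬝ᵥ (y - x)
      + smoothness A L / 2 * ((y - x) ⬝ᵥ (y - x)) := by
  rw [gradient_dotProduct]
  unfold objective smoothness
  rw [← Finset.sum_add_distrib, Finset.sum_div, Finset.sum_mul, ← Finset.sum_add_distrib]
  refine Finset.sum_le_sum fun i _ => ?_
  have h1 := (h i).upper (A i ⬝ᵥ x) (A i ⬝ᵥ y)
  rw [← dotProduct_sub] at h1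
  have h2 := mul_le_mul_of_nonneg_left (dotProduct_sq_le (A i) (y - x)) (hL i)
  linarith

lemma continuous_objective {A : Matrix (Fin n) (Fin d) ℝ} {ψ : Fin n → ℝ → ℝ}
    (h1 : ∀ i, Differentiable ℝ (ψ i)) : Continuous (objective A ψ) := by
  unfold objective
  refine continuous_finsetSum _ fun i _ => (h1 i).continuous.comp ?_
  exact Continuous.dotProduct continuous_const continuous_id

/-- By Cauchy–Schwarz the quadratic minorant exceeds `f x₀` once `y - x₀` is longer than `2 ‖g‖ /
lam`, so a minimizer over a compact ball is global. -/
lemma exists_forall_le_of_quadratic_lower {f : (Fin d → ℝ) → ℝ} (hf : Continuous f) {lam : ℝ}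
    (hlam : 0 < lam) (x₀ g : Fin d → ℝ)
    (h : ∀ y, f x₀ + g ⬝ᵥ (y - x₀) + lam / 2 * ((y - x₀) ⬝ᵥ (y - x₀)) ≤ f y) :
    ∃ x, ∀ y, f x ≤ f y := by
  have hK : IsCompact (Metric.closedBall x₀ (2 / lam * √(g ⬝ᵥ g))) := isCompact_closedBall _ _
  have hr : 0 ≤ 2 / lam * √(g ⬝ᵥ g) := by positivity
  obtain ⟨x, hx, hmin⟩ := hK.exists_isMinOn ⟨x₀, Metric.mem_closedBall_self hr⟩ hf.continuousOn
  refine ⟨x, fun y => ?_⟩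
  by_cases hy : y ∈ Metric.closedBall x₀ (2 / lam * √(g ⬝ᵥ g))
  · exact hmin hy
  · refine (hmin (Metric.mem_closedBall_self hr)).trans ?_
    have h1 := h y
    set v := y - x₀
    have h2 := dotProduct_sq_le g v
    have hgg := Real.sq_sqrt (dotProduct_self_nonneg' g)
    have hvv := Real.sq_sqrt (dotProduct_self_nonneg' v)
    -- The ball is one of the sup norm, which is at most the Euclidean norm.
    have hlt : 2 / lam * √(g ⬝ᵥ g) < √(v ⬝ᵥ v) := by
      rw [Metric.mem_closedBall, not_le, dist_eq_norm] at hy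
      refine hy.trans_le ?_
      rw [pi_norm_le_iff_of_nonneg (Real.sqrt_nonneg _)]
      intro j
      refine Real.abs_le_sqrt ?_
      rw [pow_two]
      exact Finset.single_le_sum (f := fun j => v j * v j) (fun _ _ => mul_self_nonneg _)
        (Finset.mem_univ j)
    rw [div_mul_eq_mul_div, div_lt_iff₀ hlam] at hlt
    have h3 : |g ⬝ᵥ v| ≤ √(g ⬝ᵥ g) * √(v ⬝ᵥ v) := by
      refine abs_le_of_sq_le_sq ?_ (by positivity)
      rw [mul_pow, hgg, hvv]
      exact h2
    have h4 := neg_abs_le (g ⬝ᵥ v)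
    have h5 := Real.sqrt_nonneg (v ⬝ᵥ v)
    rw [← hvv] at h1
    nlinarith

/-- `f` is minimal at `x` and dominated by a quadratic with linear part `g`, so `g = 0`. -/
lemma eq_zero_of_forall_le_quadratic {g : Fin d → ℝ} {K : ℝ} 
    (h : ∀ v : Fin d → ℝ, 0 ≤ g ⬝ᵥ v + K / 2 * (v ⬝ᵥ v)) : g = 0 := by
  by_contra hg
  have hpos : 0 < g ⬝ᵥ g := (dotProduct_self_nonneg' g).lt_of_ne' (by simpa using hg)
  have h1 := h (-(1 / (|K| + 1)) • g)
  simp only [dotProduct_smul, smul_dotProduct, smul_eq_mul] at h1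
  have hK : 0 < |K| + 1 := by positivity
  have e : -(1 / (|K| + 1)) * (g ⬝ᵥ g) + K / 2 * (-(1 / (|K| + 1)) * (-(1 / (|K| + 1)) * (g ⬝ᵥ g)))
      = (g ⬝ᵥ g) / (|K| + 1) ^ 2 * (K / 2 - (|K| + 1)) := by
    field_simp
    ring
  rw [e] at h1
  have h2 : 0 < g ⬝ᵥ g / (|K| + 1) ^ 2 := by positivity
  have h3 : K / 2 - (|K| + 1) < 0 := by
    have := le_abs_self K
    have := abs_nonneg K
    linarith
  nlinarith

lemma StronglyCvx.exists_min {A : Matrix (Fin n) (Fin d) ℝ} {ψ : Fin n → ℝ → ℝ} {lam : ℝ}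
    (h1 : ∀ i, Differentiable ℝ (ψ i)) (hlam : 0 < lam) (hs : StronglyCvx A ψ lam) :
    ∃ x, ∀ y, objective A ψ x ≤ objective A ψ y :=
  exists_forall_le_of_quadratic_lower (continuous_objective h1) hlam 0 _ (hs 0)

lemma iInf_eq_of_forall_le {α : Type*} {f : α → ℝ} {x : α} (h : ∀ y, f x ≤ f y) :
    ⨅ y, f y = f x :=
  le_antisymm (ciInf_le ⟨f x, by rintro _ ⟨y, rfl⟩; exact h y⟩ x)
    (haveI : Nonempty α := ⟨x⟩; le_ciInf h)

/-- The suboptimality of `x`. -/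
noncomputable def gap (A : Matrix (Fin n) (Fin d) ℝ) (ψ : Fin n → ℝ → ℝ) (x : Fin d → ℝ) : ℝ :=
  objective A ψ x - ⨅ y, objective A ψ y

/-! ### Suboptimality, gradient descent and the gradient-norm certificate. -/

section gap

variable {A : Matrix (Fin n) (Fin d) ℝ} {ψ : Fin n → ℝ → ℝ} {lam : ℝ} {μ L : Fin n → ℝ}

lemma gap_nonneg (h1 : ∀ i, Differentiable ℝ (ψ i)) (hlam : 0 < lam) (hs : StronglyCvx A ψ lam)
    (x : Fin d → ℝ) : 0 ≤ gap A ψ x := by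
  obtain ⟨y, hy⟩ := hs.exists_min h1 hlam
  rw [gap, iInf_eq_of_forall_le hy]
  linarith [hy x]

/-- The Polyak–Łojasiewicz inequality: complete the square `‖∇F(x) + lam (y - x)‖² ≥ 0` in the
strong convexity bound at the minimizer `y`. -/
lemma gap_le_sq_gradient (h1 : ∀ i, Differentiable ℝ (ψ i)) (hlam : 0 < lam)
    (hs : StronglyCvx A ψ lam) (x : Fin d → ℝ) :
    2 * lam * gap A ψ x ≤ gradient A ψ x ⬝ᵥ gradient A ψ x := by
  obtain ⟨y, hy⟩ := hs.exists_min h1 hlam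
  rw [gap, iInf_eq_of_forall_le hy]
  have h := hs x y
  have h2 := dotProduct_self_nonneg' (gradient A ψ x + lam • (y - x))
  simp only [add_dotProduct, dotProduct_add, smul_dotProduct, dotProduct_smul, smul_eq_mul] at h2
  rw [dotProduct_comm (y - x) (gradient A ψ x)] at h2
  nlinarith

/-- One step of gradient descent. -/
noncomputable def gdStep (A : Matrix (Fin n) (Fin d) ℝ) (ψ : Fin n → ℝ → ℝ) (K : ℝ)
    (x : Fin d → ℝ) : Fin d → ℝ :=
  x - (1 / K) • gradient A ψ x

lemma objective_gdStep_le (h : ∀ i, SecondDerivIn (ψ i) (μ i) (L i)) (hL : ∀ i, 0 ≤ L i)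
    (hK : 0 < smoothness A L) (x : Fin d → ℝ) :
    objective A ψ (gdStep A ψ (smoothness A L) x) + (gradient A ψ x ⬝ᵥ gradient A ψ x)
      / (2 * smoothness A L) ≤ objective A ψ x := by
  have h := objective_upper (A := A) h hL x (gdStep A ψ (smoothness A L) x)
  have e : gdStep A ψ (smoothness A L) x - x = -((1 / smoothness A L) • gradient A ψ x) := by
    simp [gdStep]
  rw [e] at h
  simp only [dotProduct_neg, neg_dotProduct, dotProduct_smul, smul_dotProduct, smul_eq_mul,
    mul_neg, neg_neg] at h
  have e2 : smoothness A L / 2 * (1 / smoothness A L * (1 / smoothness A L *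
      (gradient A ψ x ⬝ᵥ gradient A ψ x))) =
      (gradient A ψ x ⬝ᵥ gradient A ψ x) / (2 * smoothness A L) := by
    field_simp
  have e3 : 1 / smoothness A L * (gradient A ψ x ⬝ᵥ gradient A ψ x) =
      2 * ((gradient A ψ x ⬝ᵥ gradient A ψ x) / (2 * smoothness A L)) := by
    field_simp
  rw [e2, e3] at h
  linarith

/-- A gradient step decreases `F` by `‖∇F(x)‖² / (2 R)`, where `R` is the smoothness constant, and
cannot go below the minimum. -/
lemma sq_gradient_le_gap (h : ∀ i, SecondDerivIn (ψ i) (μ i) (L i)) (hL : ∀ i, 0 ≤ L i)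
    (hK : 0 < smoothness A L) (hlam : 0 < lam) (hs : StronglyCvx A ψ lam) (x : Fin d → ℝ) :
    gradient A ψ x ⬝ᵥ gradient A ψ x ≤ 2 * smoothness A L * gap A ψ x := by
  obtain ⟨y, hy⟩ := hs.exists_min (fun i => (h i).1) hlam
  rw [gap, iInf_eq_of_forall_le hy]
  have h1 := objective_gdStep_le h hL hK x
  have h2 := hy (gdStep A ψ (smoothness A L) x)
  have : (gradient A ψ x ⬝ᵥ gradient A ψ x) / (2 * smoothness A L)
    ≤ objective A ψ x - objective A ψ y := by linarith
  rwa [div_le_iff₀ (by positivity), mul_comm] at this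

lemma gap_gdStep_le (h : ∀ i, SecondDerivIn (ψ i) (μ i) (L i)) (hL : ∀ i, 0 ≤ L i)
    (hK : 0 < smoothness A L) (hlam : 0 < lam) (hs : StronglyCvx A ψ lam) (x : Fin d → ℝ) :
    gap A ψ (gdStep A ψ (smoothness A L) x) ≤ (1 - lam / smoothness A L) * gap A ψ x := by
  have h1 := objective_gdStep_le h hL hK x
  have h2 := gap_le_sq_gradient (fun i => (h i).1) hlam hs x
  have h3 : lam / smoothness A L * gap A ψ x
      ≤ (gradient A ψ x ⬝ᵥ gradient A ψ x) / (2 * smoothness A L) := by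
    rw [div_mul_eq_mul_div, div_le_div_iff₀ hK (by positivity)]
    nlinarith
  unfold gap at *
  linarith

/-- The quadratic lower and upper bounds of `F` around `0` are compared at the all-ones vector,
which is nonzero because `d` is. -/
lemma StronglyCvx.le_smoothness [NeZero d] (h : ∀ i, SecondDerivIn (ψ i) (μ i) (L i))
    (hL : ∀ i, 0 ≤ L i) (hs : StronglyCvx A ψ lam) : lam ≤ smoothness A L := by
  have h1 := hs 0 (fun _ => 1)
  have h2 := objective_upper (A := A) h hL 0 (fun _ => (1 : ℝ))
  have h3 : 0 < ((fun _ => 1 : Fin d → ℝ) - 0) ⬝ᵥ ((fun _ => 1 : Fin d → ℝ) - 0) := by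
    simp [dotProduct, Nat.pos_of_neZero]
  nlinarith

lemma gap_gdStep_iterate_le [NeZero d] (h : ∀ i, SecondDerivIn (ψ i) (μ i) (L i))
    (hL : ∀ i, 0 ≤ L i) (hK : 0 < smoothness A L) (hlam : 0 < lam) (hs : StronglyCvx A ψ lam)
    (x : Fin d → ℝ) (G : ℕ) :
    gap A ψ ((gdStep A ψ (smoothness A L))^[G] x) ≤ (1 - lam / smoothness A L) ^ G * gap A ψ x := by
  induction G with
  | zero => simp
  | succ G ih =>
    rw [Function.iterate_succ_apply', pow_succ']
    refine (gap_gdStep_le h hL hK hlam hs _).trans ?_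
    rw [mul_assoc]
    refine mul_le_mul_of_nonneg_left ih ?_
    have := hs.le_smoothness h hL
    rw [sub_nonneg, div_le_one hK]
    exact this

/-- The test on the gradient norm certifies the accuracy. -/
lemma gap_le_of_gradient_test (h : ∀ i, SecondDerivIn (ψ i) (μ i) (L i)) (hL : ∀ i, 0 ≤ L i)
    (hK : 0 < smoothness A L) (hlam : 0 < lam) (hs : StronglyCvx A ψ lam) {ε : ℝ} (hε : 0 < ε)
    (x₀ x : Fin d → ℝ)
    (ht : smoothness A L / lam * (gradient A ψ x ⬝ᵥ gradient A ψ x)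
      ≤ ε * (gradient A ψ x₀ ⬝ᵥ gradient A ψ x₀)) :
    gap A ψ x ≤ ε * gap A ψ x₀ := by
  have h1 := gap_le_sq_gradient (fun i => (h i).1) hlam hs x
  have h2 := sq_gradient_le_gap h hL hK hlam hs x₀
  have h3 := mul_le_mul_of_nonneg_left h1 (div_pos hK hlam).le
  have h4 := mul_le_mul_of_nonneg_left h2 hε.le
  have e : smoothness A L / lam * (2 * lam * gap A ψ x) = 2 * smoothness A L * gap A ψ x := by
    field_simp
  rw [e] at h3
  have h5 : 2 * smoothness A L * gap A ψ x ≤ 2 * smoothness A L * (ε * gap A ψ x₀) := by linarith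
  exact le_of_mul_le_mul_left h5 (by positivity)

/-! ### The proximal subproblem -/

/-- The value `F(x) + lam / 2 ‖x - c‖²`. -/
noncomputable def proxObj (A : Matrix (Fin n) (Fin d) ℝ) (ψ : Fin n → ℝ → ℝ) (lam : ℝ)
    (c x : Fin d → ℝ) : ℝ :=
  objective A ψ x + lam / 2 * ((x - c) ⬝ᵥ (x - c))

/-- Stationarity is obtained without differentiating: minimality together with the quadratic upper
bound on `F` makes the linear form `∇F(x) - lam (c - x)` plus a quadratic nonnegative everywhere, so
the form vanishes. -/
lemma StronglyCvx.exists_prox (h : ∀ i, SecondDerivIn (ψ i) (μ i) (L i)) (hL : ∀ i, 0 ≤ L i)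
    (hlam : 0 < lam) (hs : StronglyCvx A ψ lam) (c : Fin d → ℝ) :
    ∃ x, (∀ y, proxObj A ψ lam c x ≤ proxObj A ψ lam c y) ∧
      gradient A ψ x = lam • (c - x) := by
  have hcont : Continuous (proxObj A ψ lam c) := by
    unfold proxObj
    have := continuous_objective (A := A) (fun i => (h i).1)
    have h2 : Continuous fun x : Fin d → ℝ => (x - c) ⬝ᵥ (x - c) :=
      Continuous.dotProduct (by fun_prop) (by fun_prop)
    fun_prop
  obtain ⟨x, hx⟩ := exists_forall_le_of_quadratic_lower hcont hlam c (gradient A ψ c) (fun y => by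
    have h1 := hs c y
    have h2 := dotProduct_self_nonneg' (y - c)
    simp only [proxObj, sub_self, dotProduct_zero, mul_zero, add_zero]
    nlinarith)
  refine ⟨x, hx, ?_⟩
  have := eq_zero_of_forall_le_quadratic (g := gradient A ψ x - lam • (c - x))
    (K := smoothness A L + lam) (fun v => by
      have h1 := hx (x + v)
      have h2 := objective_upper (A := A) h hL x (x + v)
      unfold proxObj at h1
      have e : x + v - c = v - (c - x) := by abel
      have e' : x - c = -(c - x) := by abel
      rw [e, e'] at h1
      rw [add_sub_cancel_left] at h2
      simp only [dotProduct_sub, sub_dotProduct, neg_dotProduct, dotProduct_neg, smul_dotProduct,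
        smul_eq_mul] at h1 ⊢
      rw [dotProduct_comm v c, dotProduct_comm v x] at h1
      linarith)
  exact sub_eq_zero.mp this

/-- The Bregman distances of the `ψ i` at the points `z i`, with respect to `x`. -/
noncomputable def bregman (A : Matrix (Fin n) (Fin d) ℝ) (ψ : Fin n → ℝ → ℝ) (x : Fin d → ℝ)
    (z : Fin n → ℝ) : ℝ :=
  ∑ i, (ψ i (z i) - ψ i (A i ⬝ᵥ x) - deriv (ψ i) (A i ⬝ᵥ x) * (z i - A i ⬝ᵥ x))

lemma bregman_nonneg (h : ∀ i, SecondDerivIn (ψ i) (μ i) (L i)) (hμ : ∀ i, 0 ≤ μ i)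
    (x : Fin d → ℝ) (z : Fin n → ℝ) : 0 ≤ bregman A ψ x z :=
  Finset.sum_nonneg fun i _ => by
    have h1 := (h i).lower (A i ⬝ᵥ x) (z i)
    have h2 := mul_nonneg (hμ i) (sq_nonneg (z i - A i ⬝ᵥ x))
    linarith

lemma bregman_mulVec (x y : Fin d → ℝ) :
    bregman A ψ x (fun i => A i ⬝ᵥ y)
      = objective A ψ y - objective A ψ x - gradient A ψ x ⬝ᵥ (y - x) := by
  rw [gradient_dotProduct]
  simp [bregman, objective, Finset.sum_sub_distrib, dotProduct_sub]

/-- Stationarity turns the linear terms into the Bregman distance of `F`, so the growth of the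
proximal objective around its minimizer is known exactly. -/
lemma proxObj_eq {c x : Fin d → ℝ} (hg : gradient A ψ x = lam • (c - x)) (y : Fin d → ℝ) :
    proxObj A ψ lam c y = proxObj A ψ lam c x + bregman A ψ x (fun i => A i ⬝ᵥ y)
      + lam / 2 * ((y - x) ⬝ᵥ (y - x)) := by
  rw [bregman_mulVec, hg]
  unfold proxObj
  simp only [dotProduct_sub, sub_dotProduct, smul_dotProduct, smul_eq_mul]
  rw [dotProduct_comm c x, dotProduct_comm y c, dotProduct_comm y x]
  ring

/-- Minimizing the proximal objective halves the suboptimality. -/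
lemma proxObj_min_le (h1 : ∀ i, Differentiable ℝ (ψ i)) (hlam : 0 < lam)
    (hs : StronglyCvx A ψ lam) {c x : Fin d → ℝ}
    (hx : ∀ y, proxObj A ψ lam c x ≤ proxObj A ψ lam c y) :
    proxObj A ψ lam c x - ⨅ y, objective A ψ y ≤ gap A ψ c / 2 := by
  obtain ⟨y, hy⟩ := hs.exists_min h1 hlam
  rw [gap, iInf_eq_of_forall_le hy]
  -- Test the minimality of `x` at the midpoint of `c` and `y`. In the sum of the two strong
  -- convexity inequalities at the midpoint the gradient terms cancel, and the gain `lam / 2 ‖(c -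
  -- y) / 2‖²` equals the proximal penalty.
  have e0 := hx ((1 / 2 : ℝ) • (c + y))
  have e1 := hs ((1 / 2 : ℝ) • (c + y)) c
  have e2 := hs ((1 / 2 : ℝ) • (c + y)) y
  have f1 : c - (1 / 2 : ℝ) • (c + y) = (1 / 2 : ℝ) • (c - y) := by
    ext j; simp; ring
  have f2 : y - (1 / 2 : ℝ) • (c + y) = -((1 / 2 : ℝ) • (c - y)) := by
    ext j; simp; ring
  have f3 : (1 / 2 : ℝ) • (c + y) - c = -((1 / 2 : ℝ) • (c - y)) := by
    ext j; simp; ring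
  unfold proxObj at e0 ⊢
  rw [f1] at e1
  rw [f2] at e2
  rw [f3] at e0
  simp only [dotProduct_neg, neg_dotProduct, neg_neg] at e0 e1 e2
  linarith

/-- Near the proximal minimizer the proximal objective exceeds its minimum by at most a quadratic
with constant `R + lam`, where `R` is the smoothness constant; the halved gap of `c` bounds the
minimum itself. -/
lemma gap_le_of_prox (h : ∀ i, SecondDerivIn (ψ i) (μ i) (L i)) (hL : ∀ i, 0 ≤ L i)
    (hlam : 0 < lam) (hs : StronglyCvx A ψ lam) {c x : Fin d → ℝ}
    (hx : ∀ y, proxObj A ψ lam c x ≤ proxObj A ψ lam c y)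
    (hg : gradient A ψ x = lam • (c - x)) (w : Fin d → ℝ) :
    gap A ψ w ≤ gap A ψ c / 2 + (smoothness A L + lam) / 2 * ((w - x) ⬝ᵥ (w - x)) := by
  have h1 := proxObj_min_le (fun i => (h i).1) hlam hs hx
  have h2 := proxObj_eq hg w
  have h3 := objective_upper (A := A) h hL x w
  have h4 : objective A ψ w ≤ proxObj A ψ lam c w := by
    unfold proxObj
    have := dotProduct_self_nonneg' (w - c)
    nlinarith
  rw [bregman_mulVec] at h2
  unfold gap at h1 ⊢
  linarith

end gap

/-! ### One step of the randomized primal-dual method -/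

section step

variable {A : Matrix (Fin n) (Fin d) ℝ} {ψ : Fin n → ℝ → ℝ} {lam : ℝ} {μ L : Fin n → ℝ}

/-- Inequality for the averaging step `z ↦ (1 - 1 / k) z + u / k`, relative to `o`. -/
lemma bregman_average_le {f : ℝ → ℝ} {lo hi : ℝ} (h : SecondDerivIn f lo hi) (hlo : 0 ≤ lo)
    (hhi : 0 < hi) {k : ℝ} (hk : 1 ≤ k) (o z u z' : ℝ) (hz : z' = (1 - 1 / k) * z + 1 / k * u) :
    k * (f z' - f o - deriv f o * (z' - o)) + (k - 1) * (deriv f z' - deriv f z) ^ 2 / (2 * hi) ≤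
      (k - 1) * (f z - f o - deriv f o * (z - o)) + (deriv f z' - deriv f o) * (u - o) := by
  -- Since `k z' = (k - 1) z + u`, the claim is the tangent inequality from `z'` to `o` plus `k - 1`
  -- times the cocoercive inequality from `z'` to `z`.
  have h1 := h.lower z' o
  have h2 := h.cocoercive hlo hhi z' z
  have h3 : 0 ≤ lo / 2 * (o - z') ^ 2 := by positivity
  have h4 := mul_le_mul_of_nonneg_left h2 (sub_nonneg.mpr hk)
  have hkz : k * z' = (k - 1) * z + u := by
    rw [hz]; field_simp
  have e : (k - 1) * (deriv f z' - deriv f z) ^ 2 / (2 * hi)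
    = (k - 1) * ((deriv f z - deriv f z') ^ 2 / (2 * hi)) := by ring
  rw [e]
  have hu : u = k * z' - (k - 1) * z := by linarith
  rw [hu]
  nlinarith

/-- The primal point of a step. -/
noncomputable def primalPoint (A : Matrix (Fin n) (Fin d) ℝ) (ψ : Fin n → ℝ → ℝ) (lam m : ℝ)
    (c w : Fin d → ℝ) (z : Fin n → ℝ) : Fin d → ℝ :=
  (m / (m + 1)) • (w + (1 / m) • c - (1 / (m * lam)) • ∑ i, deriv (ψ i) (z i) • A i)

/-- The new value of `z i` if index `i` is drawn. -/
noncomputable def dualPoint (A : Matrix (Fin n) (Fin d) ℝ) (ψ : Fin n → ℝ → ℝ) (lam m : ℝ)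
    (k : Fin n → ℕ) (c w : Fin d → ℝ) (z : Fin n → ℝ) (i : Fin n) : ℝ :=
  (1 - 1 / (k i : ℝ)) * z i + 1 / (k i : ℝ) * (A i ⬝ᵥ primalPoint A ψ lam m c w z)

/-- The new value of `w` if index `i` is drawn. -/
noncomputable def shiftedPoint (A : Matrix (Fin n) (Fin d) ℝ) (ψ : Fin n → ℝ → ℝ) (lam m : ℝ)
    (k : Fin n → ℕ) (c w : Fin d → ℝ) (z : Fin n → ℝ) (i : Fin n) : Fin d → ℝ :=
  primalPoint A ψ lam m c w z - ((1 - 1 / m) / (lam * k i) *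
    (deriv (ψ i) (dualPoint A ψ lam m k c w z i) - deriv (ψ i) (z i))) • A i

/-- The Lyapunov function of the method. -/
noncomputable def potential (A : Matrix (Fin n) (Fin d) ℝ) (ψ : Fin n → ℝ → ℝ) (lam m : ℝ)
    (x w : Fin d → ℝ) (z : Fin n → ℝ) : ℝ :=
  (m - 1) * bregman A ψ x z + m * lam / 2 * ((w - x) ⬝ᵥ (w - x))

lemma bregman_update (x : Fin d → ℝ) (z : Fin n → ℝ) (i : Fin n) (t : ℝ) :
    bregman A ψ x (Function.update z i t) = bregman A ψ x z
      - (ψ i (z i) - ψ i (A i ⬝ᵥ x) - deriv (ψ i) (A i ⬝ᵥ x) * (z i - A i ⬝ᵥ x))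
      + (ψ i t - ψ i (A i ⬝ᵥ x) - deriv (ψ i) (A i ⬝ᵥ x) * (t - A i ⬝ᵥ x)) := by
  unfold bregman
  rw [← Finset.add_sum_erase _ _ (Finset.mem_univ i),
    ← Finset.add_sum_erase (a := i) (f := fun i => ψ i (z i) - ψ i (A i ⬝ᵥ x)
      - deriv (ψ i) (A i ⬝ᵥ x) * (z i - A i ⬝ᵥ x)) _ (Finset.mem_univ i)]
  rw [Finset.sum_congr rfl (g := fun i => ψ i (z i) - ψ i (A i ⬝ᵥ x)
      - deriv (ψ i) (A i ⬝ᵥ x) * (z i - A i ⬝ᵥ x))]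
  · simp
    ring
  · intro j hj
    rw [Function.update_of_ne (Finset.ne_of_mem_erase hj)]

lemma sum_mul_potential_step_le (h : ∀ i, SecondDerivIn (ψ i) (μ i) (L i)) (hμ : ∀ i, 0 ≤ μ i)
    (hL : ∀ i, 0 < L i) (hlam : 0 < lam) {c x : Fin d → ℝ}
    (hg : gradient A ψ x = lam • (c - x)) (k : Fin n → ℕ) (hk1 : ∀ i, 1 ≤ k i)
    (hk : ∀ i, L i * (A i ⬝ᵥ A i) / lam ≤ ((k i : ℝ) - 1) * k i)
    {m : ℝ} (hm : m = ∑ i, (k i : ℝ)) (hm2 : 2 ≤ m) (w : Fin d → ℝ) (z : Fin n → ℝ) :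
    ∑ i, (k i : ℝ) * potential A ψ lam m x (shiftedPoint A ψ lam m k c w z i)
        (Function.update z i (dualPoint A ψ lam m k c w z i))
      ≤ m * ((1 - 1 / m) * potential A ψ lam m x w z) := by
  have hm0 : 0 < m := by linarith
  set p := primalPoint A ψ lam m c w z with hp
  -- shifted quantities
  obtain ⟨X, hX⟩ : ∃ X, X = p - x := ⟨_, rfl⟩
  obtain ⟨W, hW⟩ : ∃ W, W = w - x := ⟨_, rfl⟩
  set z' := dualPoint A ψ lam m k c w z with hz'
  obtain ⟨e, he⟩ : ∃ e : Fin n → ℝ, e = fun i => deriv (ψ i) (z i) - deriv (ψ i) (A i ⬝ᵥ x) :=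
    ⟨_, rfl⟩
  obtain ⟨e', he'⟩ : ∃ e : Fin n → ℝ, e = fun i => deriv (ψ i) (z' i) - deriv (ψ i) (A i ⬝ᵥ x) :=
    ⟨_, rfl⟩
  obtain ⟨q, hq⟩ : ∃ q, q = ∑ i, e i • A i := ⟨_, rfl⟩
  obtain ⟨H, hH⟩ : ∃ H : Fin n → ℝ, H = fun i => ψ i (z i) - ψ i (A i ⬝ᵥ x)
    - deriv (ψ i) (A i ⬝ᵥ x) * (z i - A i ⬝ᵥ x) := ⟨_, rfl⟩
  obtain ⟨H', hH'⟩ : ∃ H : Fin n → ℝ, H = fun i => ψ i (z' i) - ψ i (A i ⬝ᵥ x)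
    - deriv (ψ i) (A i ⬝ᵥ x) * (z' i - A i ⬝ᵥ x) := ⟨_, rfl⟩
  obtain ⟨B, hB⟩ : ∃ B, B = bregman A ψ x z := ⟨_, rfl⟩
  have hBH : B = ∑ i, H i := by rw [hB, hH]; rfl
  -- primal recursion
  have hWX : W = X + (1 / m) • (X + (1 / lam) • q) := by
    have hgx : lam • (c - x) = ∑ i, deriv (ψ i) (A i ⬝ᵥ x) • A i := hg.symm
    have hqq : q = ∑ i, deriv (ψ i) (z i) • A i - lam • (c - x) := by
      rw [hq, hgx, he, ← Finset.sum_sub_distrib]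
      simp only [sub_smul]
    rw [hqq, hX, hW, hp, primalPoint]
    ext j
    simp only [Pi.sub_apply, Pi.add_apply, Pi.smul_apply, smul_eq_mul]
    field_simp
    ring
  have hdual : ∀ i, k i * H' i + ((k i : ℝ) - 1) * (e' i - e i) ^ 2 / (2 * L i) ≤
      (k i - 1) * H i + e' i * (A i ⬝ᵥ X) := by
    intro i
    have := bregman_average_le (h i) (hμ i) (hL i) (k := k i) (by exact_mod_cast hk1 i)
      (A i ⬝ᵥ x) (z i) (A i ⬝ᵥ p) (z' i) rfl
    rw [← dotProduct_sub, ← hX] at this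
    simpa only [hH, hH', he, he', sub_sub_sub_cancel_right] using this
  have hterm : ∀ i, (k i : ℝ) * potential A ψ lam m x (shiftedPoint A ψ lam m k c w z i)
        (Function.update z i (z' i)) ≤ (m - 1) * (k i * B - H i) + k i * (m * lam / 2 * (X ⬝ᵥ X))
        + (m - 1) * (e i * (A i ⬝ᵥ X)) := by
    intro i
    have hki : (1 : ℝ) ≤ k i := by exact_mod_cast hk1 i
    have hki0 : (0 : ℝ) < k i := by linarith
    have e1 : shiftedPoint A ψ lam m k c w z i - x
        = X - ((1 - 1 / m) / (lam * k i) * (e' i - e i)) • A i := by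
      rw [shiftedPoint, hX, he, he']
      simp only [sub_sub_sub_cancel_right]
      abel
    rw [potential, bregman_update, e1, ← hB]
    have hd := hdual i
    have hHi : H i = ψ i (z i) - ψ i (A i ⬝ᵥ x)
      - deriv (ψ i) (A i ⬝ᵥ x) * (z i - A i ⬝ᵥ x) := by rw [hH]
    have hHi' : H' i = ψ i (z' i) - ψ i (A i ⬝ᵥ x)
      - deriv (ψ i) (A i ⬝ᵥ x) * (z' i - A i ⬝ᵥ x) := by rw [hH']
    rw [← hHi, ← hHi']
    obtain ⟨δ, hδ⟩ : ∃ δ, δ = e' i - e i := ⟨_, rfl⟩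
    rw [← hδ] at hd ⊢
    have he'i : e' i = e i + δ := by linarith
    rw [he'i] at hd
    simp only [dotProduct_sub, sub_dotProduct, dotProduct_smul, smul_dotProduct, smul_eq_mul]
    rw [dotProduct_comm X (A i)]
    obtain ⟨u, hu⟩ : ∃ u, u = A i ⬝ᵥ X := ⟨_, rfl⟩
    obtain ⟨N, hN⟩ : ∃ N, N = A i ⬝ᵥ A i := ⟨_, rfl⟩
    obtain ⟨Y, hY⟩ : ∃ Y, Y = X ⬝ᵥ X := ⟨_, rfl⟩
    have hki2 := hk i
    rw [← hN] at hki2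
    rw [← hu] at hd
    rw [← hu, ← hN, ← hY]
    -- The coefficient `(1 - 1 / m) / (lam k i)` in `shiftedPoint` is the one that makes the cross
    -- term equal to `-(m - 1) δ u`; it cancels the `δ u` produced by the dual inequality `hd`.
    have hexp : (k i : ℝ) * (m * lam / 2 * (Y - (1 - 1 / m) / (lam * k i) * δ * u
        - (1 - 1 / m) / (lam * k i) * δ * (u - (1 - 1 / m) / (lam * k i) * δ * N)))
        = k i * (m * lam / 2 * Y) - (m - 1) * (δ * u)
          + (m - 1) * ((1 - 1 / m) * (N / (2 * lam * k i)) * δ ^ 2) := by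
      field_simp
      ring
    have hN0 : 0 ≤ N := hN ▸ dotProduct_self_nonneg' _
    -- This is where the multiplicities are calibrated: `L i ‖a i‖² / lam ≤ (k i - 1) k i` lets the
    -- cocoercivity surplus dominate the squared displacement of `w`.
    have hsmall : (1 - 1 / m) * (N / (2 * lam * k i)) * δ ^ 2
        ≤ ((k i : ℝ) - 1) * δ ^ 2 / (2 * L i) := by
      have hth : 1 - 1 / m ≤ 1 := by
        have : 0 < 1 / m := by positivity
        linarith
      have h1 : N / (2 * lam * k i) ≤ ((k i : ℝ) - 1) / (2 * L i) := by
        rw [div_le_iff₀ hlam] at hki2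
        have := hL i
        rw [div_le_div_iff₀ (by positivity) (by positivity)]
        nlinarith
      have h2 : 0 ≤ N / (2 * lam * k i) := by positivity
      calc (1 - 1 / m) * (N / (2 * lam * k i)) * δ ^ 2
          ≤ 1 * (N / (2 * lam * k i)) * δ ^ 2 := by gcongr
        _ ≤ ((k i : ℝ) - 1) / (2 * L i) * δ ^ 2 := by rw [one_mul]; gcongr
        _ = _ := by ring
    have hm1 : 0 ≤ m - 1 := by linarith
    have t1 := mul_le_mul_of_nonneg_left hd hm1
    have t2 := mul_le_mul_of_nonneg_left hsmall hm1
    rw [mul_add, hexp]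
    linarith
  refine (Finset.sum_le_sum fun i _ => hterm i).trans ?_
  have hqX : ∑ i, e i * (A i ⬝ᵥ X) = q ⬝ᵥ X := by
    rw [hq, sum_dotProduct]
    simp
  have hsum : ∑ i, ((m - 1) * (k i * B - H i) + k i * (m * lam / 2 * (X ⬝ᵥ X))
      + (m - 1) * (e i * (A i ⬝ᵥ X))) = (m - 1) * (m * B - B) + m * (m * lam / 2 * (X ⬝ᵥ X))
        + (m - 1) * (q ⬝ᵥ X) := by
    rw [Finset.sum_add_distrib, Finset.sum_add_distrib, ← Finset.mul_sum, ← Finset.mul_sum,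
      ← Finset.sum_mul, Finset.sum_sub_distrib, ← Finset.sum_mul, ← hm, ← hBH, hqX]
  rw [hsum, potential, ← hB, ← hW, hWX]
  have hR := dotProduct_self_nonneg' (X + (1 / lam) • q)
  obtain ⟨R, hRd⟩ : ∃ R, R = (X + (1 / lam) • q) ⬝ᵥ (X + (1 / lam) • q) := ⟨_, rfl⟩
  have hXR : X ⬝ᵥ (X + (1 / lam) • q) = X ⬝ᵥ X + 1 / lam * (q ⬝ᵥ X) := by
    rw [dotProduct_add, dotProduct_smul, dotProduct_comm X q, smul_eq_mul]
  have e2 : (X + (1 / m) • (X + (1 / lam) • q)) ⬝ᵥ (X + (1 / m) • (X + (1 / lam) • q))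
      = X ⬝ᵥ X + 2 / m * (X ⬝ᵥ X + 1 / lam * (q ⬝ᵥ X)) + 1 / m ^ 2 * R := by
    rw [add_dotProduct, dotProduct_add, dotProduct_add, smul_dotProduct, dotProduct_smul,
      smul_dotProduct, dotProduct_smul, dotProduct_comm (X + (1 / lam) • q) X, hXR, ← hRd]
    simp only [smul_eq_mul]
    ring
  rw [← hRd] at hR
  rw [e2]
  have hY := dotProduct_self_nonneg' X
  obtain ⟨Y, hYd⟩ : ∃ Y, Y = X ⬝ᵥ X := ⟨_, rfl⟩
  obtain ⟨Z, hZd⟩ : ∃ Z, Z = q ⬝ᵥ X := ⟨_, rfl⟩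
  rw [← hYd] at hY ⊢
  rw [← hZd]
  -- The cross term `(m - 1) Z` coming from `‖W‖²` matches the averaged dual terms. The two
  -- remaining summands are nonnegative, the first because `m ≥ 2`.
  have e3 : m * ((1 - 1 / m) * ((m - 1) * B + m * lam / 2 * (Y + 2 / m * (Y + 1 / lam * Z)
      + 1 / m ^ 2 * R))) = (m - 1) * ((m - 1) * B) + m * (m * lam / 2 * Y) + (m - 1) * Z
        + lam * (m / 2 - 1) * Y + (m - 1) * lam / (2 * m) * R := by
    field_simp
    ring
  rw [e3]
  have t1 : 0 ≤ lam * (m / 2 - 1) * Y := by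
    have : 0 ≤ m / 2 - 1 := by linarith
    positivity
  have t2 : 0 ≤ (m - 1) * lam / (2 * m) * R := by
    have : 0 ≤ m - 1 := by linarith
    positivity
  linarith

/-- The initial potential is bounded by the suboptimality of the center. -/
lemma potential_center_le (h : ∀ i, SecondDerivIn (ψ i) (μ i) (L i)) (hμ : ∀ i, 0 ≤ μ i)
    (hlam : 0 < lam) (hs : StronglyCvx A ψ lam) {c x : Fin d → ℝ}
    (hg : gradient A ψ x = lam • (c - x)) {m : ℝ} (hm : 1 ≤ m) :
    potential A ψ lam m x c (fun i => A i ⬝ᵥ c) ≤ m * gap A ψ c := by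
  obtain ⟨y, hy⟩ := hs.exists_min (fun i => (h i).1) hlam
  rw [gap, iInf_eq_of_forall_le hy]
  have h1 := proxObj_eq hg c
  have h2 := bregman_nonneg (A := A) h hμ x (fun i => A i ⬝ᵥ c)
  have h3 := hy x
  have h4 := dotProduct_self_nonneg' (x - c)
  have h5 : proxObj A ψ lam c c = objective A ψ c := by simp [proxObj]
  have h6 : objective A ψ y ≤ proxObj A ψ lam c x := by
    unfold proxObj
    nlinarith
  unfold potential
  nlinarith

/-- After the contraction of the potential, the point `w` has a smaller gap than the center. -/
lemma gap_le_of_potential (h : ∀ i, SecondDerivIn (ψ i) (μ i) (L i)) (hμ : ∀ i, 0 ≤ μ i)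
    (hL : ∀ i, 0 ≤ L i) (hlam : 0 < lam) (hs : StronglyCvx A ψ lam) {c x : Fin d → ℝ}
    (hx : ∀ y, proxObj A ψ lam c x ≤ proxObj A ψ lam c y)
    (hg : gradient A ψ x = lam • (c - x)) {m : ℝ} (hm : 1 ≤ m)
    (hRm : smoothness A L + lam ≤ m ^ 2 * lam) (w : Fin d → ℝ) (z : Fin n → ℝ) :
    gap A ψ w ≤ gap A ψ c / 2 + m * potential A ψ lam m x w z := by
  have h1 := gap_le_of_prox h hL hlam hs hx hg w
  have h2 := bregman_nonneg (A := A) h hμ x z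
  have h3 := dotProduct_self_nonneg' (w - x)
  have h4 : (smoothness A L + lam) / 2 * ((w - x) ⬝ᵥ (w - x))
      ≤ m * (m * lam / 2 * ((w - x) ⬝ᵥ (w - x))) := by nlinarith
  have h5 : 0 ≤ m * ((m - 1) * bregman A ψ x z) := by
    have : 0 ≤ m - 1 := by linarith
    positivity
  rw [potential, mul_add]
  linarith

end step

end ERM

namespace RealRAM

/-! ### A program logic -/

section logic

variable {O : Oracle}

/-- The probability that a configuration halts within `T` steps in a good memory. -/
noncomputable def haltProb (O : Oracle) (good : Mem → Prop) (T : ℕ) (cfg : Config) : ℝ≥0∞ :=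
  (run O T cfg).toOuterMeasure {cfg | cfg.1 = [] ∧ good cfg.2}

lemma haltProb_succ (good : Mem → Prop) (T : ℕ) (cfg : Config) :
    haltProb O good (T + 1) cfg = ∑' c, step O cfg c * haltProb O good T c := by
  simp only [haltProb, run, PMF.toOuterMeasure_bind_apply]

lemma haltProb_succ_of_pure {good : Mem → Prop} {T : ℕ} {cfg cfg' : Config}
    (h : step O cfg = PMF.pure cfg') :
    haltProb O good (T + 1) cfg = haltProb O good T cfg' := by
  simp only [haltProb, run, h, PMF.pure_bind]

/-- Halted configurations are fixed by `step`, and a configuration with pending commands has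
probability zero of having halted at time `0`. -/
lemma haltProb_mono_succ (good : Mem → Prop) (T : ℕ) (cfg : Config) :
    haltProb O good T cfg ≤ haltProb O good (T + 1) cfg := by
  induction T generalizing cfg with
  | zero =>
    obtain ⟨K, m⟩ := cfg
    cases K with
    | nil => rw [haltProb_succ_of_pure (cfg' := ([], m)) (by rw [step])]
    | cons c K =>
      have : haltProb O good 0 (c :: K, m) = 0 := by
        simp [haltProb, run, PMF.toOuterMeasure_pure_apply]
      rw [this]
      exact bot_le
  | succ T ih =>
    rw [haltProb_succ, haltProb_succ]
    exact ENNReal.tsum_le_tsum fun c => by gcongr; exact ih c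

lemma haltProb_mono (good : Mem → Prop) (cfg : Config) :
    Monotone fun T => haltProb O good T cfg :=
  monotone_nat_of_le_succ fun T => haltProb_mono_succ good T cfg

/-- The natural-number arrays that a command may modify. -/
def Cmd.writesN : Cmd → List ℕ
  | .skip => []
  | .setN a _ _ _ => [a]
  | .setR _ _ _ _ => []
  | .rand a _ _ _ => [a]
  | .seq c d => c.writesN ++ d.writesN
  | .cond _ c d => c.writesN ++ d.writesN
  | .loop _ c => c.writesN

/-- The real arrays that a command may modify. -/
def Cmd.writesR : Cmd → List ℕ
  | .skip => []
  | .setN _ _ _ _ => []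
  | .setR a _ _ _ => [a]
  | .rand _ _ _ _ => []
  | .seq c d => c.writesR ++ d.writesR
  | .cond _ c d => c.writesR ++ d.writesR
  | .loop _ c => c.writesR

/-- The memories agree outside of the listed arrays. -/
def Frame (wN wR : List ℕ) (m m' : Mem) : Prop :=
  (∀ a, a ∉ wN → m'.N a = m.N a) ∧ ∀ a, a ∉ wR → m'.R a = m.R a

lemma Frame.refl (wN wR : List ℕ) (m : Mem) : Frame wN wR m m := ⟨fun _ _ => rfl, fun _ _ => rfl⟩

lemma Frame.trans {wN wR : List ℕ} {m₁ m₂ m₃ : Mem} (h : Frame wN wR m₁ m₂)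
    (h' : Frame wN wR m₂ m₃) : Frame wN wR m₁ m₃ :=
  ⟨fun a ha => (h'.1 a ha).trans (h.1 a ha), fun a ha => (h'.2 a ha).trans (h.2 a ha)⟩

lemma Frame.mono {wN wR wN' wR' : List ℕ} {m₁ m₂ : Mem} (h : Frame wN wR m₁ m₂)
    (hN : wN ⊆ wN') (hR : wR ⊆ wR') : Frame wN' wR' m₁ m₂ :=
  ⟨fun a ha => h.1 a fun h' => ha (hN h'), fun a ha => h.2 a fun h' => ha (hR h')⟩

/-- Executing `c` on `m` takes at most `T` steps and yields a memory distributed as `ν`. -/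
structure Exec (O : Oracle) (c : Cmd) (m : Mem) (T : ℕ) (ν : PMF Mem) : Prop where
  le_haltProb : ∀ (good : Mem → Prop) (K : List Cmd) (T' : ℕ),
    ∑' m', ν m' * haltProb O good T' (K, m') ≤ haltProb O good (T + T') (c :: K, m)
  frame : ∀ m' ∈ ν.support, Frame c.writesN c.writesR m m'

lemma tsum_pure_mul {α : Type*} (a : α) (f : α → ℝ≥0∞) : ∑' x, PMF.pure a x * f x = f a := by
  rw [tsum_eq_single a]
  · simp
  · intro b hb
    simp [hb]

lemma tsum_bind_mul {α β : Type*} (p : PMF α) (q : α → PMF β) (f : β → ℝ≥0∞) :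
    ∑' y, p.bind q y * f y = ∑' x, p x * ∑' y, q x y * f y := by
  simp only [PMF.bind_apply, ← ENNReal.tsum_mul_right, ← ENNReal.tsum_mul_left]
  rw [ENNReal.tsum_comm]
  simp only [mul_assoc]

lemma tsum_mul_le_of_support {α : Type*} (p : PMF α) {f g : α → ℝ≥0∞}
    (h : ∀ x ∈ p.support, f x ≤ g x) : ∑' x, p x * f x ≤ ∑' x, p x * g x := by
  refine ENNReal.tsum_le_tsum fun x => ?_
  by_cases hx : x ∈ p.support
  · gcongr
    exact h x hx
  · simp [(PMF.apply_eq_zero_iff p x).mpr hx]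

lemma tsum_mul_const {α : Type*} (p : PMF α) (b : ℝ≥0∞) : ∑' x, p x * b = b := by
  rw [ENNReal.tsum_mul_right, p.tsum_coe, one_mul]

lemma Exec.mono {c : Cmd} {m : Mem} {T T' : ℕ} {ν : PMF Mem} (h : Exec O c m T ν) (hT : T ≤ T') :
    Exec O c m T' ν :=
  ⟨fun good K S => (h.le_haltProb good K S).trans (haltProb_mono good _ (by omega)), h.frame⟩

/-- `Exec` quantifies over all continuations and remaining times, so `c` can be used with the
continuation `d :: K`. The extra step unfolds the sequence. -/
lemma Exec.seq {c d : Cmd} {m : Mem} {T₁ T₂ : ℕ} {ν : PMF Mem} {ρ : Mem → PMF Mem}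
    (h₁ : Exec O c m T₁ ν) (h₂ : ∀ m' ∈ ν.support, Exec O d m' T₂ (ρ m')) :
    Exec O (.seq c d) m (T₁ + T₂ + 1) (ν.bind ρ) where
  le_haltProb good K T' := by
    rw [show T₁ + T₂ + 1 + T' = T₁ + (T₂ + T') + 1 by ring,
      haltProb_succ_of_pure (cfg' := (c :: d :: K, m)) (by rw [step]), tsum_bind_mul]
    refine le_trans ?_ (h₁.le_haltProb good (d :: K) (T₂ + T'))
    exact tsum_mul_le_of_support ν fun m' hm' => (h₂ m' hm').le_haltProb good K T'
  frame m' hm' := by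
    rw [PMF.mem_support_bind_iff] at hm'
    obtain ⟨m₁, hm₁, hm'⟩ := hm'
    exact ((h₁.frame m₁ hm₁).mono (by simp [Cmd.writesN]) (by simp [Cmd.writesR])).trans
      (((h₂ m₁ hm₁).frame m' hm').mono (by simp [Cmd.writesN]) (by simp [Cmd.writesR]))

lemma Exec.of_step {c : Cmd} {m m' : Mem} (h : ∀ K, step O (c :: K, m) = PMF.pure (K, m'))
    (hf : Frame c.writesN c.writesR m m') : Exec O c m 1 (PMF.pure m') where
  le_haltProb good K T' := by
    rw [tsum_pure_mul, add_comm, haltProb_succ_of_pure (h K)]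
  frame m₁ hm₁ := by
    rw [PMF.support_pure, Set.mem_singleton_iff] at hm₁
    rwa [hm₁]

lemma Exec.skip (m : Mem) : Exec O .skip m 1 (PMF.pure m) :=
  .of_step (fun _ => by rw [step]) (.refl _ _ _)

lemma Exec.setN (m : Mem) (a : ℕ) (i j e : NExpr) :
    Exec O (.setN a i j e) m 1 (PMF.pure (m.setN a (i.eval m) (j.eval m) (e.eval m))) :=
  .of_step (fun _ => by rw [step]) ⟨fun b hb => by
    have : b ≠ a := by simpa [Cmd.writesN] using hb
    simp [Mem.setN, this], fun _ _ => rfl⟩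

lemma Exec.setR (m : Mem) (a : ℕ) (i j : NExpr) (e : RExpr) :
    Exec O (.setR a i j e) m 1 (PMF.pure (m.setR a (i.eval m) (j.eval m) (e.eval O m))) :=
  .of_step (fun _ => by rw [step]) ⟨fun _ _ => rfl, fun b hb => by
    have : b ≠ a := by simpa [Cmd.writesR] using hb
    simp [Mem.setR, this]⟩

lemma Exec.rand (m : Mem) (a : ℕ) (i j e : NExpr) :
    Exec O (.rand a i j e) m 1 ((PMF.uniformOfFintype (Fin (e.eval m + 1))).map
      fun r : Fin (e.eval m + 1) => m.setN a (i.eval m) (j.eval m) (r : ℕ)) where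
  le_haltProb good K T' := by
    rw [add_comm 1 T', haltProb_succ, step]
    refine le_of_eq ?_
    rw [← PMF.bind_pure_comp, ← PMF.bind_pure_comp, tsum_bind_mul, tsum_bind_mul]
    simp only [Function.comp, tsum_pure_mul]
    refine Eq.trans ?_ (tsum_bind_mul (PMF.uniformOfFintype (Fin (e.eval m + 1)))
      (fun r => PMF.pure (r : ℕ)) _).symm
    simp only [tsum_pure_mul]
  frame m' hm' := by
    rw [PMF.support_map] at hm'
    obtain ⟨r, -, rfl⟩ := hm'
    refine ⟨fun b hb => ?_, fun _ _ => rfl⟩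
    have : b ≠ a := by simpa [Cmd.writesN] using hb
    simp [Mem.setN, this]

lemma Exec.cond {b : BExpr} {c d : Cmd} {m : Mem} {T : ℕ} {ν : PMF Mem}
    (h₁ : b.eval O m = true → Exec O c m T ν) (h₂ : b.eval O m = false → Exec O d m T ν) :
    Exec O (.cond b c d) m (T + 1) ν := by
  cases hb : b.eval O m with
  | true =>
    refine ⟨fun good K T' => ?_, fun m' hm' => ((h₁ hb).frame m' hm').mono
      (by simp [Cmd.writesN]) (by simp [Cmd.writesR])⟩
    rw [show T + 1 + T' = T + T' + 1 by ring,
      haltProb_succ_of_pure (cfg' := (c :: K, m)) (by rw [step]; simp [hb])]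
    exact (h₁ hb).le_haltProb good K T'
  | false =>
    refine ⟨fun good K T' => ?_, fun m' hm' => ((h₂ hb).frame m' hm').mono
      (by simp [Cmd.writesN]) (by simp [Cmd.writesR])⟩
    rw [show T + 1 + T' = T + T' + 1 by ring,
      haltProb_succ_of_pure (cfg' := (d :: K, m)) (by rw [step]; simp [hb])]
    exact (h₂ hb).le_haltProb good K T'

lemma Exec.loop_false {b : BExpr} {c : Cmd} {m : Mem} (h : b.eval O m = false) :
    Exec O (.loop b c) m 1 (PMF.pure m) :=
  .of_step (fun _ => by rw [step]; simp [h]) (.refl _ _ _)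

lemma Exec.loop_true {b : BExpr} {c : Cmd} {m : Mem} {T₁ T₂ : ℕ} {ν : PMF Mem} {ρ : Mem → PMF Mem}
    (h : b.eval O m = true)
    (h₁ : Exec O c m T₁ ν) (h₂ : ∀ m' ∈ ν.support, Exec O (.loop b c) m' T₂ (ρ m')) :
    Exec O (.loop b c) m (T₁ + T₂ + 1) (ν.bind ρ) where
  le_haltProb good K T' := by
    rw [show T₁ + T₂ + 1 + T' = T₁ + (T₂ + T') + 1 by ring,
      haltProb_succ_of_pure (cfg' := (c :: .loop b c :: K, m)) (by rw [step]; simp [h]),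
      tsum_bind_mul]
    refine le_trans ?_ (h₁.le_haltProb good (.loop b c :: K) (T₂ + T'))
    exact tsum_mul_le_of_support ν fun m' hm' => (h₂ m' hm').le_haltProb good K T'
  frame m' hm' := by
    rw [PMF.mem_support_bind_iff] at hm'
    obtain ⟨m₁, hm₁, hm'⟩ := hm'
    exact (h₁.frame m₁ hm₁).trans ((h₂ m₁ hm₁).frame m' hm')

/-- Executing `c` on `m` takes at most `T` steps, always ends in a memory with property `I`, and
the expectation of `Φ` in the final memory is at most `b`. -/
def Spec (O : Oracle) (c : Cmd) (m : Mem) (T : ℕ) (I : Mem → Prop) (Φ : Mem → ℝ≥0∞)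
    (b : ℝ≥0∞) : Prop :=
  ∃ ν, Exec O c m T ν ∧ (∀ m' ∈ ν.support, I m') ∧ ∑' m', ν m' * Φ m' ≤ b

/-- Executing `c` on `m` takes at most `T` steps and always ends in a memory with property `I`. -/
def Ensures (O : Oracle) (c : Cmd) (m : Mem) (T : ℕ) (I : Mem → Prop) : Prop :=
  ∃ ν, Exec O c m T ν ∧ ∀ m' ∈ ν.support, I m'

lemma Ensures.spec {c : Cmd} {m : Mem} {T : ℕ} {I : Mem → Prop} (h : Ensures O c m T I)
    {Φ : Mem → ℝ≥0∞} {b : ℝ≥0∞} (hb : ∀ m', I m' → Φ m' ≤ b) : Spec O c m T I Φ b := by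
  obtain ⟨ν, h₁, h₂⟩ := h
  refine ⟨ν, h₁, h₂, ?_⟩
  rw [← tsum_mul_const ν b]
  exact tsum_mul_le_of_support ν fun m' hm' => hb m' (h₂ m' hm')

/-- The tower property: the bound for `d` is the value of the intermediate potential, whose
expectation after `c` is bounded by `b`. Off the support of the first distribution the choice of `ρ`
is irrelevant. -/
lemma Spec.seq {c d : Cmd} {m : Mem} {T₁ T₂ : ℕ} {I J : Mem → Prop} {Φ Ψ : Mem → ℝ≥0∞} {b : ℝ≥0∞}
    (h₁ : Spec O c m T₁ I Φ b) (h₂ : ∀ m', I m' → Spec O d m' T₂ J Ψ (Φ m')) :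
    Spec O (.seq c d) m (T₁ + T₂ + 1) J Ψ b := by
  obtain ⟨ν, e₁, i₁, b₁⟩ := h₁
  have : ∀ m', ∃ ρ, m' ∈ ν.support → Exec O d m' T₂ ρ ∧ (∀ m'' ∈ ρ.support, J m'') ∧
      ∑' m'', ρ m'' * Ψ m'' ≤ Φ m' := fun m' => by
    by_cases h : m' ∈ ν.support
    · obtain ⟨ρ, hρ⟩ := h₂ m' (i₁ m' h)
      exact ⟨ρ, fun _ => hρ⟩
    · exact ⟨ν, fun h' => absurd h' h⟩
  choose ρ hρ using this
  refine ⟨ν.bind ρ, e₁.seq fun m' hm' => (hρ m' hm').1, fun m'' hm'' => ?_, ?_⟩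
  · rw [PMF.mem_support_bind_iff] at hm''
    obtain ⟨m', hm', hm''⟩ := hm''
    exact (hρ m' hm').2.1 m'' hm''
  · rw [tsum_bind_mul]
    exact (tsum_mul_le_of_support ν fun m' hm' => (hρ m' hm').2.2).trans b₁

lemma Spec.loop_true {b : BExpr} {c : Cmd} {m : Mem} {T₁ T₂ : ℕ} {I J : Mem → Prop}
    {Φ Ψ : Mem → ℝ≥0∞} {v : ℝ≥0∞} (hb : b.eval O m = true)
    (h₁ : Spec O c m T₁ I Φ v) (h₂ : ∀ m', I m' → Spec O (.loop b c) m' T₂ J Ψ (Φ m')) :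
    Spec O (.loop b c) m (T₁ + T₂ + 1) J Ψ v := by
  obtain ⟨ν, e₁, i₁, b₁⟩ := h₁
  have : ∀ m', ∃ ρ, m' ∈ ν.support → Exec O (.loop b c) m' T₂ ρ ∧ (∀ m'' ∈ ρ.support, J m'') ∧
      ∑' m'', ρ m'' * Ψ m'' ≤ Φ m' := fun m' => by
    by_cases h : m' ∈ ν.support
    · obtain ⟨ρ, hρ⟩ := h₂ m' (i₁ m' h)
      exact ⟨ρ, fun _ => hρ⟩
    · exact ⟨ν, fun h' => absurd h' h⟩
  choose ρ hρ using this
  refine ⟨ν.bind ρ, e₁.loop_true hb fun m' hm' => (hρ m' hm').1, fun m'' hm'' => ?_, ?_⟩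
  · rw [PMF.mem_support_bind_iff] at hm''
    obtain ⟨m', hm', hm''⟩ := hm''
    exact (hρ m' hm').2.1 m'' hm''
  · rw [tsum_bind_mul]
    exact (tsum_mul_le_of_support ν fun m' hm' => (hρ m' hm').2.2).trans b₁

lemma Spec.ensures {c : Cmd} {m : Mem} {T : ℕ} {I : Mem → Prop} {Φ : Mem → ℝ≥0∞} {b : ℝ≥0∞}
    (h : Spec O c m T I Φ b) : Ensures O c m T I :=
  let ⟨ν, h₁, h₂, _⟩ := h
  ⟨ν, h₁, h₂⟩

lemma Spec.mono {c : Cmd} {m : Mem} {T T' : ℕ} {I J : Mem → Prop} {Φ Ψ : Mem → ℝ≥0∞}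
    {b b' : ℝ≥0∞} (h : Spec O c m T I Φ b) (hT : T ≤ T')
    (hJ : ∀ m', I m' → Frame c.writesN c.writesR m m' → J m' ∧ Ψ m' ≤ Φ m') (hb : b ≤ b') :
    Spec O c m T' J Ψ b' :=
  let ⟨ν, h₁, h₂, h₃⟩ := h
  ⟨ν, h₁.mono hT, fun m' hm' => (hJ m' (h₂ m' hm') (h₁.frame m' hm')).1,
    ((tsum_mul_le_of_support ν fun m' hm' =>
      (hJ m' (h₂ m' hm') (h₁.frame m' hm')).2).trans h₃).trans hb⟩

lemma Ensures.mono {c : Cmd} {m : Mem} {T T' : ℕ} {I J : Mem → Prop}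
    (h : Ensures O c m T I) (hT : T ≤ T')
    (hJ : ∀ m', I m' → Frame c.writesN c.writesR m m' → J m') : Ensures O c m T' J :=
  let ⟨ν, h₁, h₂⟩ := h
  ⟨ν, h₁.mono hT, fun m' hm' => hJ m' (h₂ m' hm') (h₁.frame m' hm')⟩

lemma Ensures.seq {c d : Cmd} {m : Mem} {T₁ T₂ : ℕ} {I J : Mem → Prop}
    (h₁ : Ensures O c m T₁ I)
    (h₂ : ∀ m', I m' → Frame c.writesN c.writesR m m' → Ensures O d m' T₂ J) :
    Ensures O (.seq c d) m (T₁ + T₂ + 1) J :=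
  Spec.ensures (Φ := fun _ => 0) (b := 0) (Spec.seq
    (I := fun m' => I m' ∧ Frame c.writesN c.writesR m m') (Φ := fun _ => 0)
    ((h₁.mono le_rfl fun _ h hf => ⟨h, hf⟩).spec fun _ _ => le_rfl)
    fun m' h => (h₂ m' h.1 h.2).spec fun _ _ => le_rfl)

lemma Ensures.seq_spec {c d : Cmd} {m : Mem} {T₁ T₂ : ℕ} {I J : Mem → Prop} {Ψ : Mem → ℝ≥0∞}
    {b : ℝ≥0∞} (h₁ : Ensures O c m T₁ I)
    (h₂ : ∀ m', I m' → Frame c.writesN c.writesR m m' → Spec O d m' T₂ J Ψ b) :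
    Spec O (.seq c d) m (T₁ + T₂ + 1) J Ψ b :=
  Spec.seq (I := fun m' => I m' ∧ Frame c.writesN c.writesR m m') (Φ := fun _ => b)
    ((h₁.mono le_rfl fun _ h hf => ⟨h, hf⟩).spec fun _ _ => le_rfl)
    fun m' h => h₂ m' h.1 h.2

lemma Ensures.of_exec_pure {c : Cmd} {m m' : Mem} {T : ℕ} (h : Exec O c m T (PMF.pure m'))
    {I : Mem → Prop} (hI : I m') : Ensures O c m T I :=
  ⟨_, h, fun m₁ hm₁ => by
    rw [PMF.support_pure, Set.mem_singleton_iff] at hm₁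
    rwa [hm₁]⟩

lemma Ensures.setN {m : Mem} {a : ℕ} {i j e : NExpr} {I : Mem → Prop}
    (h : I (m.setN a (i.eval m) (j.eval m) (e.eval m))) : Ensures O (.setN a i j e) m 1 I :=
  .of_exec_pure (.setN m a i j e) h

lemma Ensures.setR {m : Mem} {a : ℕ} {i j : NExpr} {e : RExpr} {I : Mem → Prop}
    (h : I (m.setR a (i.eval m) (j.eval m) (e.eval O m))) : Ensures O (.setR a i j e) m 1 I :=
  .of_exec_pure (.setR m a i j e) h

lemma Ensures.skip {m : Mem} {I : Mem → Prop} (h : I m) : Ensures O .skip m 1 I :=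
  .of_exec_pure (.skip m) h

lemma Ensures.cond {b : BExpr} {c d : Cmd} {m : Mem} {T : ℕ} {I : Mem → Prop}
    (h₁ : b.eval O m = true → Ensures O c m T I) (h₂ : b.eval O m = false → Ensures O d m T I) :
    Ensures O (.cond b c d) m (T + 1) I := by
  cases hb : b.eval O m with
  | true =>
    obtain ⟨ν, h, hI⟩ := h₁ hb
    exact ⟨ν, .cond (fun _ => h) (fun h' => by simp [hb] at h'), hI⟩
  | false =>
    obtain ⟨ν, h, hI⟩ := h₂ hb
    exact ⟨ν, .cond (fun h' => by simp [hb] at h') (fun _ => h), hI⟩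

lemma Spec.rand {m : Mem} {a : ℕ} {i j e : NExpr} {Φ : Mem → ℝ≥0∞} {b : ℝ≥0∞}
    (hb : ∑ r ∈ Finset.range (e.eval m + 1), Φ (m.setN a (i.eval m) (j.eval m) r)
      ≤ (e.eval m + 1 : ℕ) * b) :
    Spec O (.rand a i j e) m 1
      (fun m' => ∃ r, r < e.eval m + 1 ∧ m' = m.setN a (i.eval m) (j.eval m) r) Φ b := by
  refine ⟨_, .rand m a i j e, fun m' hm' => ?_, ?_⟩
  · rw [PMF.support_map] at hm'
    obtain ⟨r, -, rfl⟩ := hm'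
    exact ⟨r, r.2, rfl⟩
  · rw [← PMF.bind_pure_comp, tsum_bind_mul]
    simp only [Function.comp, tsum_pure_mul, PMF.uniformOfFintype_apply, Fintype.card_fin]
    rw [ENNReal.tsum_mul_left, tsum_fintype,
      Fin.sum_univ_eq_sum_range (fun r => Φ (m.setN a (i.eval m) (j.eval m) r))]
    rw [ENNReal.inv_mul_le_iff (by simp) (by simp)]
    exact hb

/-- The number `B` of iterations is deterministic and known to the analysis only; the invariants
force the test to succeed exactly `B` times. The final `+ 1` pays for the failing test. -/
lemma Spec.loop_while {b : BExpr} {c : Cmd} (J : ℕ → Mem → Prop) (Φ : ℕ → Mem → ℝ≥0∞) (B : ℕ)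
    (Tb : ℕ → ℕ) (hb : ∀ k, k < B → ∀ m, J k m → b.eval O m = true)
    (hB : ∀ m, J B m → b.eval O m = false)
    (hc : ∀ k, k < B → ∀ m, J k m → Spec O c m (Tb k) (J (k + 1)) (Φ (k + 1)) (Φ k m))
    (k : ℕ) (hk : k ≤ B) : ∀ (m : Mem), J k m →
    Spec O (.loop b c) m (∑ i ∈ Finset.Ico k B, (Tb i + 1) + 1) (J B) (Φ B) (Φ k m) := by
  induction hk using Nat.decreasingInduction with
  | self =>
    intro m hm
    rw [Finset.Ico_self, Finset.sum_empty]
    exact (Ensures.of_exec_pure (.loop_false (hB m hm)) (I := fun m' => m' = m) rfl).spec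
      (b := Φ B m) (fun m' h => by rw [h]) |>.mono le_rfl (fun m' h _ => ⟨h ▸ hm, le_rfl⟩) le_rfl
  | of_succ k hk ih =>
    intro m hm
    rw [Finset.sum_eq_sum_Ico_succ_bot hk]
    exact (Spec.loop_true (hb k hk m hm) (hc k hk m hm) (fun m' hm' => ih m' hm')).mono
      (by omega) (fun _ h _ => ⟨h, le_rfl⟩) le_rfl

lemma Ensures.loop_while {b : BExpr} {c : Cmd} (J : ℕ → Mem → Prop) (B : ℕ) (Tb : ℕ → ℕ)
    (hb : ∀ k, k < B → ∀ m, J k m → b.eval O m = true) (hB : ∀ m, J B m → b.eval O m = false)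
    (hc : ∀ k, k < B → ∀ m, J k m → Ensures O c m (Tb k) (J (k + 1))) (m : Mem) (hm : J 0 m) :
    Ensures O (.loop b c) m (∑ i ∈ Finset.range B, (Tb i + 1) + 1) (J B) := by
  rw [Finset.range_eq_Ico]
  exact (Spec.loop_while J (fun _ _ => 0) B Tb hb hB
    (fun k hk m hm => (hc k hk m hm).spec fun _ _ => le_rfl) 0 (Nat.zero_le _) m hm).ensures

/-- `for v < bound do body`, with the loop variable in cell `(0, 0)` of the array `v`. -/
def Cmd.forUp (v : ℕ) (bound : NExpr) (body : Cmd) : Cmd :=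
  .seq (.setN v (.const 0) (.const 0) (.const 0))
    (.loop (.ltN (.get v (.const 0) (.const 0)) bound)
      (.seq body (.setN v (.const 0) (.const 0) (.add (.get v (.const 0) (.const 0)) (.const 1)))))

lemma frame_setN {wN wR : List ℕ} {m : Mem} {a i j k : ℕ} (h : a ∈ wN) :
    Frame wN wR m (m.setN a i j k) :=
  ⟨fun b hb => by
    have : b ≠ a := fun h' => hb (h' ▸ h)
    simp [Mem.setN, this], fun _ _ => rfl⟩

lemma frame_setR {wN wR : List ℕ} {m : Mem} {a i j : ℕ} {r : ℝ} (h : a ∈ wR) :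
    Frame wN wR m (m.setR a i j r) :=
  ⟨fun _ _ => rfl, fun b hb => by
    have : b ≠ a := fun h' => hb (h' ▸ h)
    simp [Mem.setR, this]⟩

/-- The bound is evaluated anew at every test, hence it must stay constant under everything the loop
may write. Each round adds three steps: the test, the inner sequencing and the increment. -/
lemma Spec.forUp {v : ℕ} {bound : NExpr} {body : Cmd} (J : ℕ → Mem → Prop) (Φ : ℕ → Mem → ℝ≥0∞)
    (B : ℕ) (Tb : ℕ → ℕ) {m : Mem} (hv : v ∉ body.writesN)
    (hB : ∀ m', Frame (v :: body.writesN) body.writesR m m' → bound.eval m' = B)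
    (h0 : J 0 (m.setN v 0 0 0))
    (hc : ∀ k, k < B → ∀ m', Frame (v :: body.writesN) body.writesR m m' → m'.N v 0 0 = k →
      J k m' → Spec O body m' (Tb k) (fun m'' => J (k + 1) (m''.setN v 0 0 (k + 1)))
        (fun m'' => Φ (k + 1) (m''.setN v 0 0 (k + 1))) (Φ k m')) :
    Spec O (.forUp v bound body) m (∑ k ∈ Finset.range B, (Tb k + 3) + 3) (J B) (Φ B)
      (Φ 0 (m.setN v 0 0 0)) := by
  have hloop := Spec.loop_while (O := O) (b := .ltN (.get v (.const 0) (.const 0)) bound)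
    (c := (.seq body (.setN v (.const 0) (.const 0) (.add (.get v (.const 0) (.const 0)) (.const 1)))))
    (fun k m' => Frame (v :: body.writesN) body.writesR m m' ∧ m'.N v 0 0 = k ∧ J k m') Φ B
    (fun k => Tb k + 2)
    (fun k hk m' h => by simp [BExpr.eval, NExpr.eval, h.2.1, hB m' h.1, hk])
    (fun m' h => by simp [BExpr.eval, NExpr.eval, h.2.1, hB m' h.1])
    (fun k hk m' h => by
      have h1 := (hc k hk m' h.1 h.2.1 h.2.2).mono le_rfl (J := fun m'' =>
        J (k + 1) (m''.setN v 0 0 (k + 1)) ∧ Frame body.writesN body.writesR m' m'')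
        (fun m'' h hf => ⟨⟨h, hf⟩, le_rfl⟩) le_rfl
      refine (h1.seq (T₂ := 1) fun m₁ h₁ => ?_).mono (by omega) (fun _ h _ => ⟨h, le_rfl⟩) le_rfl
      have hv1 : m₁.N v = m'.N v := h₁.2.1 v hv
      refine ((Ensures.setN (I := fun m₂ => m₂ = m₁.setN v 0 0 (k + 1)) ?_).spec
        (Φ := Φ (k + 1)) (fun m₂ h₂ => by rw [h₂])).mono le_rfl (fun m₂ h₂ _ => ⟨?_, le_rfl⟩) le_rfl
      · simp only [NExpr.eval, hv1, h.2.1]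
      · rw [h₂]
        exact ⟨h.1.trans ((h₁.2.mono (by simp) (by simp)).trans (frame_setN (by simp))),
          by simp [Mem.setN], h₁.1⟩)
    0 (Nat.zero_le _)
  have hset : Ensures O (.setN v (.const 0) (.const 0) (.const 0)) m 1
    (fun m' => m' = m.setN v 0 0 0) := Ensures.setN rfl
  refine (hset.seq_spec (T₂ := ∑ k ∈ Finset.range B, (Tb k + 3) + 1) fun m' hm' _ => ?_).mono
    (by omega) (fun _ h _ => ⟨h, le_rfl⟩) le_rfl
  rw [hm']
  refine (hloop _ ⟨frame_setN (by simp), by simp [Mem.setN], h0⟩).mono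
    (by rw [Finset.range_eq_Ico]) (fun _ h _ => ⟨h.2.2, le_rfl⟩) le_rfl

lemma Ensures.forUp {v : ℕ} {bound : NExpr} {body : Cmd} (J : ℕ → Mem → Prop) (B : ℕ) (Tb : ℕ → ℕ)
    {m : Mem} (hv : v ∉ body.writesN)
    (hB : ∀ m', Frame (v :: body.writesN) body.writesR m m' → bound.eval m' = B)
    (h0 : J 0 (m.setN v 0 0 0))
    (hc : ∀ k, k < B → ∀ m', Frame (v :: body.writesN) body.writesR m m' → m'.N v 0 0 = k →
      J k m' → Ensures O body m' (Tb k) fun m'' => J (k + 1) (m''.setN v 0 0 (k + 1))) :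
    Ensures O (.forUp v bound body) m (∑ k ∈ Finset.range B, (Tb k + 3) + 3) (J B) :=
  (Spec.forUp J (fun _ _ => 0) B Tb hv hB h0
    fun k hk m' hf hk' hJ => (hc k hk m' hf hk' hJ).spec fun _ _ => le_rfl).ensures

/-- A loop whose body contracts the expectation of `Φ` by the factor `θ`. -/
lemma Spec.forUp_contract {v : ℕ} {bound : NExpr} {body : Cmd} (J : Mem → Prop) (Φ : Mem → ℝ≥0∞)
    (θ : ℝ≥0∞) (B : ℕ) (Tb : ℕ) {m : Mem} (hv : v ∉ body.writesN)
    (hB : ∀ m', Frame (v :: body.writesN) body.writesR m m' → bound.eval m' = B)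
    (hJ : ∀ m' k, J m' → J (m'.setN v 0 0 k)) (hΦ : ∀ m' k, Φ (m'.setN v 0 0 k) = Φ m')
    (h0 : J m)
    (hc : ∀ m', Frame (v :: body.writesN) body.writesR m m' → J m' →
      Spec O body m' Tb J Φ (θ * Φ m')) :
    Spec O (.forUp v bound body) m (B * (Tb + 3) + 3) J Φ (θ ^ B * Φ m) := by
  -- Weighting the potential after `k` rounds by `θ ^ (B - k)` turns a contraction into a quantity
  -- that does not increase in expectation.
  have := Spec.forUp (O := O) (fun _ => J) (fun k m => θ ^ (B - k) * Φ m) B (fun _ => Tb) hv hB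
    (hJ _ _ h0) fun k hk m' hf _ hJ' => by
      obtain ⟨ν, e, i, b⟩ := hc m' hf hJ'
      refine ⟨ν, e, fun m₁ hm₁ => hJ _ _ (i m₁ hm₁), ?_⟩
      simp only [hΦ]
      calc ∑' m₁, ν m₁ * (θ ^ (B - (k + 1)) * Φ m₁) = θ ^ (B - (k + 1)) * ∑' m₁, ν m₁ * Φ m₁ := by
            rw [← ENNReal.tsum_mul_left]
            exact tsum_congr fun _ => by ring
        _ ≤ θ ^ (B - (k + 1)) * (θ * Φ m') := by gcongr
        _ = _ := by
          rw [← mul_assoc, ← pow_succ]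
          congr 2
          omega
  simp only [hΦ] at this
  exact this.mono (by simp) (fun _ h _ => ⟨h, by simp⟩) le_rfl

lemma haltProb_nil (good : Mem → Prop) (m : Mem) (h : good m) : haltProb O good 0 ([], m) = 1 := by
  rw [haltProb, run, PMF.toOuterMeasure_pure_apply, if_pos ⟨rfl, h⟩]

lemma Ensures.probHaltsWith {c : Cmd} {m : Mem} {T : ℕ} {I : Mem → Prop} (h : Ensures O c m T I) :
    1 ≤ probHaltsWith O c m T I := by
  obtain ⟨ν, e, i⟩ := h
  refine le_trans ?_ (e.le_haltProb I [] 0)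
  rw [← tsum_mul_const ν 1]
  exact tsum_mul_le_of_support ν fun m' hm' => by rw [haltProb_nil _ _ (i m' hm')]

/-- Markov's inequality. -/
lemma Spec.probHaltsWith {c : Cmd} {m : Mem} {T : ℕ} {I good : Mem → Prop} {Φ : Mem → ℝ≥0∞}
    {b : ℝ≥0∞} (h : Spec O c m T I Φ b) (hgood : ∀ m', I m' → ¬ good m' → 1 ≤ Φ m') :
    1 - b ≤ RealRAM.probHaltsWith O c m T good := by
  obtain ⟨ν, e, i, hb⟩ := h
  refine le_trans ?_ (e.le_haltProb good [] 0)
  rw [tsub_le_iff_right]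
  calc (1 : ℝ≥0∞) = ∑' m', ν m' * 1 := (tsum_mul_const ν 1).symm
    _ ≤ ∑' m', ν m' * (haltProb O good 0 ([], m') + Φ m') :=
      tsum_mul_le_of_support ν fun m' hm' => by
        by_cases hg : good m'
        · rw [haltProb_nil _ _ hg]
          exact le_self_add
        · exact (hgood m' (i m' hm') hg).trans le_add_self
    _ ≤ _ := by
      simp only [mul_add]
      rw [ENNReal.tsum_add]
      gcongr

end logic

/-! ### Loops over vectors and sparse rows -/

section loops

variable {O : Oracle}

/-- The scalar stored in the natural-number array `a`. -/
def NExpr.scalar (a : ℕ) : NExpr := .get a (.const 0) (.const 0)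

/-- The scalar stored in the real array `a`. -/
def RExpr.scalar (a : ℕ) : RExpr := .get a (.const 0) (.const 0)

/-- The entry `i` of the vector stored in the real array `a`. -/
def RExpr.entry (a : ℕ) (i : NExpr) : RExpr := .get a i (.const 0)

@[simp] lemma NExpr.eval_scalar (m : Mem) (a : ℕ) : (NExpr.scalar a).eval m = m.N a 0 0 := rfl

@[simp] lemma RExpr.eval_scalar (m : Mem) (a : ℕ) : (RExpr.scalar a).eval O m = m.R a 0 0 := rfl

@[simp] lemma RExpr.eval_entry (m : Mem) (a : ℕ) (i : NExpr) :
    (RExpr.entry a i).eval O m = m.R a (i.eval m) 0 := rfl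

/-- Store the sum of `term` over `v < bound` in the scalar `acc`. -/
def Cmd.sumLoop (v acc : ℕ) (bound : NExpr) (term : RExpr) : Cmd :=
  .seq (.setR acc (.const 0) (.const 0) (.ofNat (.const 0)))
    (.forUp v bound (.setR acc (.const 0) (.const 0) (.add (.scalar acc) term)))

/-- Store `term` in entry `v` of the vector `arr`, for all `v < bound`. -/
def Cmd.fill (v arr : ℕ) (bound : NExpr) (term : RExpr) : Cmd :=
  .forUp v bound (.setR arr (.scalar v) (.const 0) term)

lemma ensures_sumLoop {v acc : ℕ} {bound : NExpr} {term : RExpr} {m : Mem} (B : ℕ) (f : ℕ → ℝ)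
    (hB : ∀ m', Frame [v] [acc] m m' → bound.eval m' = B)
    (ht : ∀ k, k < B → ∀ m', Frame [v] [acc] m m' → m'.N v 0 0 = k → term.eval O m' = f k) :
    Ensures O (.sumLoop v acc bound term) m (4 * B + 5)
      fun m' => m'.R acc 0 0 = ∑ k ∈ Finset.range B, f k := by
  have h0 : Ensures O (.setR acc (.const 0) (.const 0) (.ofNat (.const 0))) m 1
      (fun m' => m' = m.setR acc 0 0 0) := by
    refine Ensures.setR ?_
    simp [RExpr.eval, NExpr.eval]
  refine (h0.seq (T₂ := 4 * B + 3) fun m₁ h₁ _ => ?_).mono (by omega) fun _ h _ => h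
  have hf : ∀ m', Frame [v] [acc] m₁ m' → Frame [v] [acc] m m' := fun m' h =>
    (h₁ ▸ frame_setR (by simp) : Frame [v] [acc] m m₁).trans h
  refine (Ensures.forUp (fun k m' => m'.R acc 0 0 = ∑ i ∈ Finset.range k, f i) B (fun _ => 1)
    (by simp [Cmd.writesN]) (fun m' h => hB m' (hf m' h)) ?_ fun k hk m' h hv hJ => ?_).mono
    (by simp; omega) fun _ h _ => h
  · simp [h₁, Mem.setN, Mem.setR]
  · refine Ensures.setR ?_
    simp only [RExpr.eval, NExpr.eval, Mem.setN, Mem.setR, RExpr.eval_scalar]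
    simp [Finset.sum_range_succ, hJ, ht k hk m' (hf m' h) hv]

/-- The hypothesis that entry `k` still has its old value allows `term` to read the entry it
overwrites, as in a gradient step performed in place. -/
lemma ensures_fill {v arr : ℕ} {bound : NExpr} {term : RExpr} {m : Mem} (B : ℕ) (f : ℕ → ℝ)
    (hB : ∀ m', Frame [v] [arr] m m' → bound.eval m' = B)
    (ht : ∀ k, k < B → ∀ m', Frame [v] [arr] m m' → m'.N v 0 0 = k → m'.R arr k 0 = m.R arr k 0 →
      term.eval O m' = f k) :
    Ensures O (.fill v arr bound term) m (4 * B + 3)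
      fun m' => ∀ k, k < B → m'.R arr k 0 = f k := by
  refine (Ensures.forUp (fun k m' => (∀ i, i < k → m'.R arr i 0 = f i) ∧
    ∀ i, k ≤ i → m'.R arr i 0 = m.R arr i 0) B (fun _ => 1)
    (by simp [Cmd.writesN]) hB ⟨by simp, by simp [Mem.setN]⟩ fun k hk m' h hv hJ => ?_).mono
    (by simp; omega) fun _ h _ => h.1
  refine Ensures.setR ?_
  have := ht k hk m' h hv (hJ.2 k le_rfl)
  simp only [NExpr.eval, Mem.setN, Mem.setR, NExpr.eval_scalar, hv, this]
  refine ⟨fun i hi => ?_, fun i hi => ?_⟩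
  · by_cases hik : i = k
    · simp [hik]
    · simp [hik, hJ.1 i (by omega)]
  · have : i ≠ k := by omega
    simp [this, hJ.2 i (by omega)]

end loops

end RealRAM

namespace ERM

open RealRAM

/-! ### Sparse rows: inner products, row updates and the gradient. -/

section rows

variable {n d : ℕ}

lemma sum_range_getElem?_map_getD {α : Type*} (l : List α) (φ : α → ℝ) :
    ∑ k ∈ Finset.range l.length, (l[k]?.map φ).getD 0 = (l.map φ).sum := by
  induction l with
  | nil => simp
  | cons a l ih =>
    rw [List.length_cons, Finset.sum_range_succ', List.map_cons, List.sum_cons, ← ih, add_comm]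
    simp

lemma sum_rowSupport (A : Matrix (Fin n) (Fin d) ℝ) (i : Fin n) (φ : Fin d → ℝ)
    (h : ∀ j, A i j = 0 → φ j = 0) :
    ∑ k ∈ Finset.range (rowSupport A i).length, ((rowSupport A i)[k]?.map φ).getD 0
      = ∑ j, φ j := by
  classical
  rw [sum_range_getElem?_map_getD]
  have hnd : (rowSupport A i).Nodup := (List.nodup_finRange d).filter _
  rw [← List.sum_toFinset φ hnd]
  refine Finset.sum_subset (Finset.subset_univ _) fun j _ hj => h j ?_
  by_contra hne
  exact hj (by simp [rowSupport, hne])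

lemma colArray_eq (A : Matrix (Fin n) (Fin d) ℝ) (i : Fin n) (k : ℕ) :
    colArray A i k = ((rowSupport A i)[k]?.map fun j => (j : ℕ)).getD 0 := by
  simp [colArray]

lemma valArray_eq (A : Matrix (Fin n) (Fin d) ℝ) (i : Fin n) (k : ℕ) :
    valArray A i k = ((rowSupport A i)[k]?.map fun j => A i j).getD 0 := by
  simp [valArray]

lemma valArray_mul_colArray (A : Matrix (Fin n) (Fin d) ℝ) (i : Fin n) (k : ℕ) (g : ℕ → ℝ) :
    valArray A i k * g (colArray A i k)
      = ((rowSupport A i)[k]?.map fun j => A i j * g j).getD 0 := by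
  rw [valArray_eq, colArray_eq]
  cases (rowSupport A i)[k]? <;> simp

lemma sum_valArray_mul (A : Matrix (Fin n) (Fin d) ℝ) (i : Fin n) (g : ℕ → ℝ) :
    ∑ k ∈ Finset.range (rowSupport A i).length, valArray A i k * g (colArray A i k)
      = ∑ j, A i j * g j := by
  simp only [valArray_mul_colArray]
  exact sum_rowSupport A i _ fun j h => by simp [h]

lemma sum_valArray_sq (A : Matrix (Fin n) (Fin d) ℝ) (i : Fin n) :
    ∑ k ∈ Finset.range (rowSupport A i).length, valArray A i k * valArray A i k
      = A i ⬝ᵥ A i := by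
  rw [dotProduct, ← sum_rowSupport A i (fun j => A i j * A i j) fun j h => by simp [h]]
  refine Finset.sum_congr rfl fun k _ => ?_
  rw [valArray_eq]
  cases (rowSupport A i)[k]? <;> simp

lemma length_rowSupport_le (A : Matrix (Fin n) (Fin d) ℝ) (i : Fin n) :
    (rowSupport A i).length ≤ rowSparsity A := by
  classical
  refine le_trans (le_of_eq ?_) (Finset.le_sup (f := fun i =>
    (Finset.univ.filter fun j => A i j ≠ 0).card) (Finset.mem_univ i))
  have hnd : (rowSupport A i).Nodup := (List.nodup_finRange d).filter _
  rw [← List.toFinset_card_of_nodup hnd]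
  congr 1
  ext j
  simp [rowSupport]

/-- The memory contains the sparse rows of `A`. -/
structure HoldsMatrix (A : Matrix (Fin n) (Fin d) ℝ) (m : Mem) : Prop where
  rows : m.N 0 0 0 = n
  cols : m.N 1 0 0 = d
  len : ∀ i : Fin n, m.N 2 i 0 = (rowSupport A i).length
  col : m.N 3 = colArray A
  val : m.R 0 = valArray A

lemma HoldsMatrix.frame {A : Matrix (Fin n) (Fin d) ℝ} {m m' : Mem} (h : HoldsMatrix A m)
    {wN wR : List ℕ} (hf : Frame wN wR m m') (hN : ∀ a ∈ wN, 3 < a) (hR : ∀ a ∈ wR, 6 < a) :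
    HoldsMatrix A m' := by
  have e : ∀ a, a ≤ 3 → m'.N a = m.N a := fun a ha => hf.1 a fun h => by
    have := hN a h
    omega
  have e' : m'.R 0 = m.R 0 := hf.2 0 fun h => by
    have := hR 0 h
    omega
  exact ⟨by rw [e 0 (by omega), h.rows], by rw [e 1 (by omega), h.cols],
    fun i => by rw [e 2 (by omega), h.len], by rw [e 3 (by omega), h.col], by rw [e', h.val]⟩

/-- The number of stored entries of row `i`. -/
def rowLen (i : NExpr) : NExpr := .get 2 i (.const 0)

/-- The column of the stored entry of row `i` selected by the loop variable `v`. -/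
def rowCol (i : NExpr) (v : ℕ) : NExpr := .get 3 i (.scalar v)

/-- The value of the stored entry of row `i` selected by the loop variable `v`. -/
def rowVal (i : NExpr) (v : ℕ) : RExpr := .get 0 i (.scalar v)

/-- Add `coef` times row `i` to the vector `arr`. -/
def scatter (v arr : ℕ) (i : NExpr) (coef : RExpr) : Cmd :=
  .forUp v (rowLen i) (.setR arr (rowCol i v) (.const 0)
    (.add (.entry arr (rowCol i v)) (.mul coef (rowVal i v))))

variable {O : Oracle}

/-- The invariant describes every cell by a partial sum of indicators `colArray A i k = j`.
Distinctness of the stored columns is thus needed only once, when the complete sum is identified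
with `A i j`. -/
lemma ensures_scatter {A : Matrix (Fin n) (Fin d) ℝ} {m : Mem} (hA : HoldsMatrix A m) {v arr : ℕ}
    (hv : 3 < v) (harr : 6 < arr) {ie : NExpr} {coef : RExpr} (i : Fin n) (a : ℝ)
    (hi : ∀ m', Frame [v] [arr] m m' → ie.eval m' = i)
    (ha : ∀ m', Frame [v] [arr] m m' → coef.eval O m' = a) :
    Ensures O (scatter v arr ie coef) m (4 * rowSparsity A + 3)
      fun m' => ∀ j : Fin d, m'.R arr j 0 = m.R arr j 0 + a * A i j := by
  have hA' : ∀ m', Frame [v] [arr] m m' → HoldsMatrix A m' := fun m' h =>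
    hA.frame h (by simpa using hv) (by simpa using harr)
  refine (Ensures.forUp (fun K m' => ∀ j : ℕ, m'.R arr j 0 = m.R arr j 0
    + a * ∑ k ∈ Finset.range K, valArray A i k * if colArray A i k = j then 1 else 0)
    (rowSupport A i).length (fun _ => 1) (by simp [Cmd.writesN]) (fun m' h => ?_)
    (by simp [Mem.setN]) fun k hk m' h hvk hJ => ?_).mono ?_ fun m' h _ j => ?_
  · simp [rowLen, NExpr.eval, hi m' h, (hA' m' h).len]
  · refine Ensures.setR ?_
    intro j
    simp only [NExpr.eval, RExpr.eval, Mem.setN, Mem.setR, RExpr.eval_entry, rowCol, rowVal,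
      NExpr.eval_scalar, hvk, hi m' h, ha m' h, (hA' m' h).col, (hA' m' h).val, true_and, and_true]
    rw [Finset.sum_range_succ, hJ, hJ]
    by_cases hj : j = colArray A i k
    · subst hj
      simp
      ring
    · simp [hj, Ne.symm hj]
  · have := length_rowSupport_le A i
    simp
    omega
  · rw [h j, sum_valArray_mul A i (fun k => if k = j then 1 else 0)]
    simp [Fin.val_inj]

/-- The vector need not be stored: `X` only has to evaluate to the right coordinate at each column
visited. This lets a random step read its implicitly represented point in sparse time. -/
lemma ensures_rowSum {A : Matrix (Fin n) (Fin d) ℝ} {m : Mem} (hA : HoldsMatrix A m) {v acc : ℕ}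
    (hv : 3 < v) (hacc : 6 < acc) {ie : NExpr} {X : RExpr} (i : Fin n) (x : ℕ → ℝ)
    (hi : ∀ m', Frame [v] [acc] m m' → ie.eval m' = i)
    (hX : ∀ m' k, Frame [v] [acc] m m' → (rowCol ie v).eval m' = k → X.eval O m' = x k) :
    Ensures O (.sumLoop v acc (rowLen ie) (.mul (rowVal ie v) X)) m (4 * rowSparsity A + 5)
      fun m' => m'.R acc 0 0 = A i ⬝ᵥ (fun j : Fin d => x j) := by
  have hA' : ∀ m', Frame [v] [acc] m m' → HoldsMatrix A m' := fun m' h =>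
    hA.frame h (by simpa using hv) (by simpa using hacc)
  refine (ensures_sumLoop (rowSupport A i).length
    (fun k => valArray A i k * x (colArray A i k)) (fun m' h => ?_) fun k hk m' h hvk => ?_).mono ?_
    fun m' h _ => ?_
  · simp [rowLen, NExpr.eval, hi m' h, (hA' m' h).len]
  · simp only [RExpr.eval, rowVal, NExpr.eval_scalar, hvk, hi m' h, (hA' m' h).val]
    rw [hX m' _ h rfl]
    simp [rowCol, NExpr.eval, hvk, hi m' h, (hA' m' h).col]
  · have := length_rowSupport_le A i
    omega
  · rw [h, sum_valArray_mul]
    rfl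

lemma ensures_rowSq {A : Matrix (Fin n) (Fin d) ℝ} {m : Mem} (hA : HoldsMatrix A m) {v acc : ℕ}
    (hv : 3 < v) (hacc : 6 < acc) {ie : NExpr} (i : Fin n)
    (hi : ∀ m', Frame [v] [acc] m m' → ie.eval m' = i) :
    Ensures O (.sumLoop v acc (rowLen ie) (.mul (rowVal ie v) (rowVal ie v))) m
      (4 * rowSparsity A + 5) fun m' => m'.R acc 0 0 = A i ⬝ᵥ A i := by
  have hA' : ∀ m', Frame [v] [acc] m m' → HoldsMatrix A m' := fun m' h =>
    hA.frame h (by simpa using hv) (by simpa using hacc)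
  refine (ensures_sumLoop (rowSupport A i).length
    (fun k => valArray A i k * valArray A i k) (fun m' h => ?_) fun k hk m' h hvk => ?_).mono ?_
    fun m' h _ => ?_
  · simp [rowLen, NExpr.eval, hi m' h, (hA' m' h).len]
  · simp only [RExpr.eval, rowVal, NExpr.eval_scalar, hvk, hi m' h, (hA' m' h).val]
  · have := length_rowSupport_le A i
    omega
  · rw [h, sum_valArray_sq]

/-- Store in the scalar `acc` the squared norm of the `d`-dimensional vector `arr`. -/
def sqNorm (arr acc : ℕ) : Cmd :=
  .sumLoop 12 acc (.scalar 1) (.mul (.entry arr (.scalar 12)) (.entry arr (.scalar 12)))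

/-- The vector stored in the real array `a`. -/
def vec (n : ℕ) (a : ℕ) (m : Mem) : Fin n → ℝ := fun i => m.R a i 0

lemma ensures_sqNorm {A : Matrix (Fin n) (Fin d) ℝ} {m : Mem} (hA : HoldsMatrix A m) {arr acc : ℕ}
    (hacc : 6 < acc) (hne : arr ≠ acc) :
    Ensures O (sqNorm arr acc) m (4 * d + 5) fun m' => m'.R acc 0 0 = vec d arr m ⬝ᵥ vec d arr m := by
  refine (ensures_sumLoop d (fun k => m.R arr k 0 * m.R arr k 0) (fun m' h => ?_)
    fun k hk m' h hvk => ?_).mono le_rfl fun m' h _ => ?_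
  · simp [(hA.frame h (by simp) (by simpa using hacc)).cols]
  · simp [RExpr.eval, hvk, h.2 arr (by simpa using hne)]
  · rw [h, Finset.sum_range]
    rfl

/-- Store in the arrays `8` and `9` the gradient at the vector `7` and the vector of the inner
products with the rows. -/
def gradientCmd : Cmd :=
  .seq (.fill 12 8 (.scalar 1) (.ofNat (.const 0)))
    (.forUp 10 (.scalar 0)
      (.seq (.sumLoop 11 12 (rowLen (.scalar 10))
          (.mul (rowVal (.scalar 10) 11) (.entry 7 (rowCol (.scalar 10) 11))))
      (.seq (.setR 9 (.scalar 10) (.const 0) (.scalar 12))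
      (.seq (.setR 13 (.const 0) (.const 0) (.der (.scalar 10) (.scalar 12)))
        (scatter 11 8 (.scalar 10) (.scalar 13))))))

variable {ψ : Fin n → ℝ → ℝ}

lemma oracle_der (ψ : Fin n → ℝ → ℝ) (i : Fin n) (t : ℝ) :
    (oracle ψ).der i t = deriv (ψ i) t := by
  simp [oracle]

lemma ensures_gradientCmd {A : Matrix (Fin n) (Fin d) ℝ} {m : Mem} (hA : HoldsMatrix A m) :
    Ensures (oracle ψ) gradientCmd m (n * (8 * rowSparsity A + 16) + 4 * d + 7)
      fun m' => vec n 9 m' = (fun i => A i ⬝ᵥ vec d 7 m) ∧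
        vec d 8 m' = gradient A ψ (vec d 7 m) := by
  have h0 : Ensures (oracle ψ) (.fill 12 8 (.scalar 1) (.ofNat (.const 0))) m (4 * d + 3)
      fun m' => ∀ k, k < d → m'.R 8 k 0 = 0 :=
    ensures_fill d (fun _ => 0)
      (fun m' h => by simp [(hA.frame h (by simp) (by simp)).cols])
      (fun k hk m' h hv _ => by simp [RExpr.eval, NExpr.eval])
  refine (h0.seq (T₂ := n * (8 * rowSparsity A + 16) + 3) fun m₁ h₁ hf₁ => ?_).mono (by omega)
    fun _ h _ => h
  have hA₁ : HoldsMatrix A m₁ := hA.frame hf₁ (by decide) (by decide)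
  have h7 : vec d 7 m₁ = vec d 7 m := by
    funext j
    rw [vec, hf₁.2 7 (by decide), vec]
  set x := vec d 7 m with hx
  refine (Ensures.forUp (fun k m' => (∀ i : Fin n, (i : ℕ) < k → m'.R 9 i 0 = A i ⬝ᵥ x) ∧
      ∀ j : Fin d, m'.R 8 j 0 = ∑ i : Fin n, if (i : ℕ) < k then
        deriv (ψ i) (A i ⬝ᵥ x) * A i j else 0) n (fun _ => 8 * rowSparsity A + 13)
    (by decide) (fun m' h => ?_) ?_ fun k hk m' h hvk hJ => ?_).mono (by simp) fun m' h _ => ?_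
  · simp [(hA₁.frame h (by decide) (by decide)).rows]
  · simpa [Mem.setN] using fun j : Fin d => h₁ j j.2
  · have hA₂ := hA₁.frame h (by decide) (by decide)
    have h7' : m'.R 7 = m₁.R 7 := h.2 7 (by decide)
    have hs := ensures_rowSum (O := oracle ψ) hA₂ (v := 11) (acc := 12) (by norm_num) (by norm_num)
      (ie := .scalar 10) (X := .entry 7 (rowCol (.scalar 10) 11)) ⟨k, hk⟩ (fun j => m₁.R 7 j 0)
      (fun m'' h => by simp [h.1 10 (by decide), hvk])
      (fun m'' j h hj => by rw [RExpr.eval_entry, h.2 7 (by decide), h7', hj])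
    have hs' : (fun j : Fin d => m₁.R 7 j 0) = x := h7
    rw [hs'] at hs
    refine (hs.seq (T₂ := 4 * rowSparsity A + 7) fun m₂ h₂ hf₂ => ?_).mono (by omega) fun _ h _ => h
    have e10 : m₂.N 10 0 0 = k := by rw [hf₂.1 10 (by decide), hvk]
    have e8 : m₂.R 8 = m'.R 8 := hf₂.2 8 (by decide)
    have e9 : m₂.R 9 = m'.R 9 := hf₂.2 9 (by decide)
    have hA₃ := hA₂.frame hf₂ (by decide) (by decide)
    refine (Ensures.seq (T₁ := 1) (T₂ := 4 * rowSparsity A + 5)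
      (Ensures.setR (I := fun m₃ => m₃ = m₂.setR 9 k 0 (A ⟨k, hk⟩ ⬝ᵥ x)) ?_)
      fun m₃ h₃ hf₃ => ?_).mono (by omega) fun _ h _ => h
    · simp [NExpr.eval, e10, h₂]
    refine (Ensures.seq (T₁ := 1) (T₂ := 4 * rowSparsity A + 3)
      (Ensures.setR (I := fun m₄ => m₄ = m₃.setR 13 0 0 (deriv (ψ ⟨k, hk⟩) (A ⟨k, hk⟩ ⬝ᵥ x))) ?_)
      fun m₄ h₄ hf₄ => ?_).mono (by omega) fun _ h _ => h
    · subst h₃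
      simp [NExpr.eval, RExpr.eval, e10, h₂, Mem.setR, ← oracle_der]
    have hA₄ := (hA₃.frame hf₃ (by decide) (by decide)).frame hf₄ (by decide) (by decide)
    refine (ensures_scatter hA₄ (by norm_num) (by norm_num) ⟨k, hk⟩
      (deriv (ψ ⟨k, hk⟩) (A ⟨k, hk⟩ ⬝ᵥ x)) (fun m₅ h₅ => ?_) fun m₅ h₅ => ?_).mono le_rfl
      fun m₅ h₅ hf₅ => ⟨fun i hi => ?_, fun j => ?_⟩
    · rw [NExpr.eval_scalar, h₅.1 10 (by decide), hf₄.1 10 (by decide), hf₃.1 10 (by decide), e10]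
    · rw [RExpr.eval_scalar, h₅.2 13 (by decide), h₄]
      simp [Mem.setR]
    · simp only [Mem.setN]
      rw [hf₅.2 9 (by decide), hf₄.2 9 (by decide), h₃]
      by_cases hik : (i : ℕ) = k
      · have : i = ⟨k, hk⟩ := Fin.ext hik
        subst this
        simp [Mem.setR]
      · simp [Mem.setR, hik, e9, hJ.1 i (by omega)]
    · simp only [Mem.setN]
      rw [h₅ j, hf₄.2 8 (by decide), hf₃.2 8 (by decide), e8, hJ.2 j,
        ← Finset.add_sum_erase _ _ (Finset.mem_univ (⟨k, hk⟩ : Fin n)),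
        ← Finset.add_sum_erase (a := (⟨k, hk⟩ : Fin n)) (f := fun i : Fin n => if (i : ℕ) < k + 1 then
        deriv (ψ i) (A i ⬝ᵥ x) * A i j else 0) _ (Finset.mem_univ _)]
      rw [Finset.sum_congr rfl (g := fun i : Fin n => if (i : ℕ) < k + 1 then
        deriv (ψ i) (A i ⬝ᵥ x) * A i j else 0)]
      · simp [add_comm]
      · intro i hi
        have : (i : ℕ) ≠ k := fun h => Finset.ne_of_mem_erase hi (Fin.ext h)
        have e : (i : ℕ) < k ↔ (i : ℕ) < k + 1 := by omega
        simp only [e]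
  · refine ⟨funext fun i => h.1 i i.2, funext fun j => ?_⟩
    rw [vec, h.2 j, gradient, Finset.sum_apply]
    simp

end rows

/-! ### The randomized step with its lazy representation, and a proximal stage. -/

section stage

variable {n d : ℕ} {A : Matrix (Fin n) (Fin d) ℝ} {ψ : Fin n → ℝ → ℝ} {lam : ℝ} {k : Fin n → ℕ}

/-- The memory contains `lam`, and a table in which each index `i` occurs `k i` times. -/
structure HoldsTable (A : Matrix (Fin n) (Fin d) ℝ) (lam : ℝ) (k : Fin n → ℕ) (m : Mem) :
    Prop where
  matrix : HoldsMatrix A m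
  lam : m.R 5 0 0 = lam
  mult : ∀ i : Fin n, m.N 5 i 0 = k i
  size : m.N 6 0 0 = ∑ i, k i
  table : ∀ g : ℕ → ℝ≥0∞, ∑ r ∈ Finset.range (∑ i, k i), g (m.N 4 r 0) = ∑ i : Fin n, k i * g i

lemma HoldsTable.frame {m m' : Mem} (h : HoldsTable A lam k m)
    {wN wR : List ℕ} (hf : Frame wN wR m m') (hN : ∀ a ∈ wN, 6 < a) (hR : ∀ a ∈ wR, 6 < a) :
    HoldsTable A lam k m' := by
  have e : ∀ a, a ≤ 6 → m'.N a = m.N a := fun a ha => hf.1 a fun h => by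
    have := hN a h
    omega
  have e' : m'.R 5 = m.R 5 := hf.2 5 fun h => by
    have := hR 5 h
    omega
  exact ⟨h.matrix.frame hf (fun a ha => lt_trans (by norm_num) (hN a ha)) hR, by rw [e', h.lam],
    fun i => by rw [e 5 (by omega), h.mult], by rw [e 6 (by omega), h.size],
    fun g => by rw [e 4 (by omega), h.table]⟩

/-- Apply the counting identity of the table to the indicator of the numbers `≥ n`: the total is
zero, so each cell contributes zero. -/
lemma HoldsTable.table_lt {m : Mem} (h : HoldsTable A lam k m) {r : ℕ} (hr : r < ∑ i, k i) :
    m.N 4 r 0 < n := by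
  have := h.table fun i => if i < n then 0 else 1
  simp only [Fin.is_lt, if_true, mul_zero, Finset.sum_const_zero] at this
  rw [Finset.sum_eq_zero_iff] at this
  have h1 := this r (Finset.mem_range.mpr hr)
  by_contra hlt
  rw [if_neg hlt] at h1
  exact one_ne_zero h1

/-- The coordinate selected by `j` of the point `w` that is represented by the center `7`, the
gradient `8`, and the multiple `11` of the vector `10`. -/
def currentPoint (j : NExpr) : RExpr :=
  .add (.sub (.entry 7 j) (.div (.entry 8 j) (.scalar 5))) (.mul (.scalar 11) (.entry 10 j))

/-- The point represented by the memory. -/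
noncomputable def point (d : ℕ) (m : Mem) : Fin d → ℝ :=
  fun j => m.R 7 j 0 - m.R 8 j 0 / m.R 5 0 0 + m.R 11 0 0 * m.R 10 j 0

/-- The part of a randomized step that follows the draw of a cell of the table. -/
def stepTail : Cmd :=
  .seq (.setN 17 (.const 0) (.const 0) (.get 4 (.scalar 17) (.const 0)))
  (.seq (.sumLoop 11 12 (rowLen (.scalar 17))
    (.mul (rowVal (.scalar 17) 11) (currentPoint (rowCol (.scalar 17) 11))))
  (.seq (.setR 12 (.const 0) (.const 0) (.add
    (.mul (.sub (.ofNat (.const 1)) (.div (.ofNat (.const 1)) (.ofNat (.get 5 (.scalar 17) (.const 0)))))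
      (.entry 9 (.scalar 17)))
    (.mul (.div (.ofNat (.const 1)) (.ofNat (.get 5 (.scalar 17) (.const 0)))) (.scalar 12))))
  (.seq (.setR 13 (.const 0) (.const 0)
    (.sub (.der (.scalar 17) (.scalar 12)) (.der (.scalar 17) (.entry 9 (.scalar 17)))))
  (.seq (.setR 9 (.scalar 17) (.const 0) (.scalar 12))
  (.seq (scatter 11 8 (.scalar 17) (.scalar 13))
    (scatter 11 10 (.scalar 17) (.div (.mul (.sub (.div (.ofNat (.const 1)) (.scalar 5))
      (.div (.sub (.ofNat (.const 1)) (.div (.ofNat (.const 1)) (.ofNat (.scalar 6))))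
        (.mul (.scalar 5) (.ofNat (.get 5 (.scalar 17) (.const 0)))))) (.scalar 13))
      (.scalar 11))))))))

/-- One randomized step. -/
def stepCmd : Cmd :=
  .seq (.setR 11 (.const 0) (.const 0) (.div (.mul (.scalar 11) (.ofNat (.scalar 6)))
    (.add (.ofNat (.scalar 6)) (.ofNat (.const 1)))))
  (.seq (.rand 17 (.const 0) (.const 0) (.sub (.scalar 6) (.const 1))) stepTail)

/-- The invariant of the randomized steps with center `c`. -/
structure StepInv (A : Matrix (Fin n) (Fin d) ℝ) (ψ : Fin n → ℝ → ℝ) (lam : ℝ) (k : Fin n → ℕ)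
    (c : Fin d → ℝ) (m : Mem) : Prop where
  table : HoldsTable A lam k m
  center : vec d 7 m = c
  dual : vec d 8 m = ∑ i, deriv (ψ i) (m.R 9 i 0) • A i
  scale : 0 < m.R 11 0 0

/-- With `w = c - g / lam + b v`, averaging `w` with `c - g / lam` at weights `K : 1` leaves `c - g
/ lam` alone and multiplies `b` by `K / (K + 1)`. The dense primal update is therefore a single
scalar assignment. -/
lemma primalPoint_eq {m m₁ : Mem} {c : Fin d → ℝ} (h : StepInv A ψ lam k c m) {K : ℝ} (hK : 0 < K)
    (hlam : 0 < lam) (h7 : m₁.R 7 = m.R 7) (h8 : m₁.R 8 = m.R 8) (h10 : m₁.R 10 = m.R 10)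
    (h5 : m₁.R 5 = m.R 5) (h11 : m₁.R 11 0 0 = m.R 11 0 0 * K / (K + 1)) :
    point d m₁ = primalPoint A ψ lam K c (point d m) (vec n 9 m) := by
  funext j
  have h7' : m.R 7 j 0 = c j := congrFun h.center j
  have h8' : (∑ i, deriv (ψ i) (vec n 9 m i) • A i) j = m.R 8 j 0 := (congrFun h.dual j).symm
  simp only [primalPoint, point, h7, h8, h10, h5, h11, h.table.lam, Pi.smul_apply, Pi.add_apply,
    Pi.sub_apply, smul_eq_mul, h8', ← h7']
  field_simp
  ring

/-- The deterministic part of a step, after the index `i` has been drawn. -/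
lemma ensures_step_of_index {m m₁ : Mem} {c : Fin d → ℝ} (h : StepInv A ψ lam k c m)
    (hlam : 0 < lam) (hk : ∀ i, 1 ≤ k i) {r : ℕ}
    (hm₁ : m₁ = (m.setR 11 0 0 (m.R 11 0 0 * (∑ i, k i : ℕ) / ((∑ i, k i : ℕ) + 1))).setN 17 0 0 r)
    (hr : r < ∑ i, k i) (i : Fin n) (hi : m.N 4 r 0 = i) :
    Ensures (oracle ψ) stepTail m₁ (12 * rowSparsity A + 21) fun m' =>
      StepInv A ψ lam k c m' ∧
      point d m' = shiftedPoint A ψ lam (∑ i, k i : ℕ) k c (point d m) (vec n 9 m) i ∧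
      vec n 9 m' = Function.update (vec n 9 m) i
        (dualPoint A ψ lam (∑ i, k i : ℕ) k c (point d m) (vec n 9 m) i) := by
  have hK : 0 < ((∑ i, k i : ℕ) : ℝ) := by exact_mod_cast (by omega : 0 < ∑ i, k i)
  obtain ⟨K, hKd⟩ : ∃ K, K = ((∑ i, k i : ℕ) : ℝ) := ⟨_, rfl⟩
  have hKi : ((∑ i, k i : ℕ) : ℝ) = K := hKd.symm
  rw [hKi] at hm₁ hK ⊢
  have hki : 0 < (k i : ℝ) := by exact_mod_cast hk i
  -- the index
  refine (Ensures.seq (T₁ := 1) (T₂ := 12 * rowSparsity A + 19) (Ensures.setN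
    (I := fun m₂ => m₂ = m₁.setN 17 0 0 i) ?_) fun m₂ h₂ hf₂ => ?_).mono (by omega) fun _ h _ => h
  · simp [NExpr.eval, ← hi, hm₁, Mem.setN, Mem.setR]
  have hfm₂ : Frame [17] [11] m m₂ := by
    rw [h₂, hm₁]
    exact ((frame_setR (by simp)).trans (frame_setN (by simp))).trans (frame_setN (by simp))
  have hT₂ := h.table.frame hfm₂ (by simp) (by simp)
  have e17 : m₂.N 17 0 0 = i := by simp [h₂, Mem.setN]
  have e11 : m₂.R 11 0 0 = m.R 11 0 0 * K / (K + 1) := by simp [h₂, hm₁, Mem.setN, Mem.setR]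
  have hpt := primalPoint_eq h hK hlam (hfm₂.2 7 (by decide)) (hfm₂.2 8 (by decide))
    (hfm₂.2 10 (by decide)) (hfm₂.2 5 (by decide)) e11
  set p := primalPoint A ψ lam K c (point d m) (vec n 9 m) with hp
  -- the inner product
  have hs := ensures_rowSum (O := oracle ψ) hT₂.matrix (v := 11) (acc := 12) (by norm_num)
    (by norm_num) (ie := .scalar 17) (X := currentPoint (rowCol (.scalar 17) 11)) i
    (fun j => m₂.R 7 j 0 - m₂.R 8 j 0 / m₂.R 5 0 0 + m₂.R 11 0 0 * m₂.R 10 j 0)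
    (fun m' h => by simp [h.1 17 (by decide), e17])
    (fun m' j h hj => by
      simp [currentPoint, RExpr.eval, hj, h.2 7 (by decide), h.2 8 (by decide), h.2 5 (by decide),
        h.2 11 (by decide), h.2 10 (by decide)])
  have hs' : (fun j : Fin d => m₂.R 7 j 0 - m₂.R 8 j 0 / m₂.R 5 0 0 + m₂.R 11 0 0 * m₂.R 10 j 0)
    = p := hpt
  rw [hs'] at hs
  refine (hs.seq (T₂ := 8 * rowSparsity A + 13) fun m₃ h₃ hf₃ => ?_).mono (by omega) fun _ h _ => h
  have e17₃ : m₃.N 17 0 0 = i := by rw [hf₃.1 17 (by decide), e17]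
  have hT₃ := hT₂.frame hf₃ (by decide) (by decide)
  have e9₃ : m₃.R 9 = m.R 9 := by rw [hf₃.2 9 (by decide), hfm₂.2 9 (by decide)]
  -- the new dual point
  set z' := dualPoint A ψ lam K k c (point d m) (vec n 9 m) i with hz'
  refine (Ensures.seq (T₁ := 1) (T₂ := 8 * rowSparsity A + 11) (Ensures.setR
    (I := fun m₄ => m₄ = m₃.setR 12 0 0 z') ?_) fun m₄ h₄ hf₄ => ?_).mono (by omega) fun _ h _ => h
  · simp [NExpr.eval, RExpr.eval, e17₃, h₃, hT₃.mult, e9₃, hz', dualPoint, vec, ← hp]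
  have e17₄ : m₄.N 17 0 0 = i := by rw [hf₄.1 17 (by decide), e17₃]
  have e9₄ : m₄.R 9 = m.R 9 := by rw [hf₄.2 9 (by decide), e9₃]
  have e12₄ : m₄.R 12 0 0 = z' := by simp [h₄, Mem.setR]
  obtain ⟨δ, hδ⟩ : ∃ δ, δ = deriv (ψ i) z' - deriv (ψ i) (m.R 9 i 0) := ⟨_, rfl⟩
  refine (Ensures.seq (T₁ := 1) (T₂ := 8 * rowSparsity A + 9) (Ensures.setR
    (I := fun m₅ => m₅ = m₄.setR 13 0 0 δ) ?_) fun m₅ h₅ hf₅ => ?_).mono (by omega) fun _ h _ => h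
  · simp [NExpr.eval, RExpr.eval, e17₄, e12₄, e9₄, hδ, oracle_der]
  have e17₅ : m₅.N 17 0 0 = i := by rw [hf₅.1 17 (by decide), e17₄]
  have e9₅ : m₅.R 9 = m.R 9 := by rw [hf₅.2 9 (by decide), e9₄]
  have e12₅ : m₅.R 12 0 0 = z' := by rw [hf₅.2 12 (by decide), e12₄]
  have e13₅ : m₅.R 13 0 0 = δ := by simp [h₅, Mem.setR]
  refine (Ensures.seq (T₁ := 1) (T₂ := 8 * rowSparsity A + 7) (Ensures.setR
    (I := fun m₆ => m₆ = m₅.setR 9 i 0 z') ?_) fun m₆ h₆ hf₆ => ?_).mono (by omega) fun _ h _ => h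
  · simp [NExpr.eval, e17₅, e12₅]
  have e17₆ : m₆.N 17 0 0 = i := by rw [hf₆.1 17 (by decide), e17₅]
  have e13₆ : m₆.R 13 0 0 = δ := by rw [hf₆.2 13 (by decide), e13₅]
  have hT₆ := ((hT₃.frame hf₄ (by decide) (by decide)).frame hf₅ (by decide) (by decide)).frame hf₆
    (by decide) (by decide)
  -- the gradient
  refine ((ensures_scatter hT₆.matrix (v := 11) (arr := 8) (by norm_num) (by norm_num) i δ
    (fun m' h => by simp [h.1 17 (by decide), e17₆])
    (fun m' h => by simp [h.2 13 (by decide), e13₆])).seq (T₂ := 4 * rowSparsity A + 3)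
    fun m₇ h₇ hf₇ => ?_).mono (by omega) fun _ h _ => h
  have e17₇ : m₇.N 17 0 0 = i := by rw [hf₇.1 17 (by decide), e17₆]
  have e13₇ : m₇.R 13 0 0 = δ := by rw [hf₇.2 13 (by decide), e13₆]
  have e11₇ : m₇.R 11 = m₂.R 11 := by
    rw [hf₇.2 11 (by decide), hf₆.2 11 (by decide), hf₅.2 11 (by decide), hf₄.2 11 (by decide),
      hf₃.2 11 (by decide)]
  have hT₇ := hT₆.frame hf₇ (by decide) (by decide)
  -- the scaled vector
  refine (ensures_scatter hT₇.matrix (v := 11) (arr := 10) (by norm_num) (by norm_num) i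
    ((1 / lam - (1 - 1 / K) / (lam * k i)) * δ / m₂.R 11 0 0)
    (fun m' h => by simp [h.1 17 (by decide), e17₇])
    (fun m' h => by
      have hT := hT₇.frame h (by decide) (by decide)
      simp [RExpr.eval, NExpr.eval, h.1 17 (by decide), e17₇, hT.mult, hT.lam, hT.size,
        h.2 13 (by decide), e13₇, h.2 11 (by decide), e11₇, ← hKi])).mono le_rfl
    fun m₈ h₈ hf₈ => ?_
  have hT₈ := hT₇.frame hf₈ (by decide) (by decide)
  have e7 : m₈.R 7 = m.R 7 := by
    rw [hf₈.2 7 (by decide), hf₇.2 7 (by decide), hf₆.2 7 (by decide), hf₅.2 7 (by decide),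
      hf₄.2 7 (by decide), hf₃.2 7 (by decide), hfm₂.2 7 (by decide)]
  have e10 : ∀ j : Fin d, m₈.R 10 j 0 = m.R 10 j 0
      + (1 / lam - (1 - 1 / K) / (lam * k i)) * δ / m₂.R 11 0 0 * A i j := fun j => by
    rw [h₈ j, hf₇.2 10 (by decide), hf₆.2 10 (by decide), hf₅.2 10 (by decide),
      hf₄.2 10 (by decide), hf₃.2 10 (by decide), hfm₂.2 10 (by decide)]
  have e8 : ∀ j : Fin d, m₈.R 8 j 0 = m.R 8 j 0 + δ * A i j := fun j => by
    rw [hf₈.2 8 (by decide), h₇ j, hf₆.2 8 (by decide), hf₅.2 8 (by decide),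
      hf₄.2 8 (by decide), hf₃.2 8 (by decide), hfm₂.2 8 (by decide)]
  have e9 : vec n 9 m₈ = Function.update (vec n 9 m) i z' := by
    funext i'
    rw [vec, hf₈.2 9 (by decide), hf₇.2 9 (by decide), h₆]
    by_cases hii : i' = i
    · simp [hii, Mem.setR]
    · simp [hii, Mem.setR, Fin.val_inj, e9₅, vec]
  have e11₈ : m₈.R 11 0 0 = m.R 11 0 0 * K / (K + 1) := by rw [hf₈.2 11 (by decide), e11₇, e11]
  have hpos : 0 < m.R 11 0 0 * K / (K + 1) := by
    have := h.scale
    positivity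
  refine ⟨⟨hT₈, ?_, ?_, by rw [e11₈]; exact hpos⟩, ?_, e9⟩
  · rw [← h.center]
    funext j
    rw [vec, e7, vec]
  · have e9' : ∀ i', m₈.R 9 (i' : Fin n) 0 = Function.update (vec n 9 m) i z' i' :=
      fun i' => congrFun e9 i'
    funext j
    have hd : m.R 8 j 0 = _ := congrFun h.dual j
    rw [vec, e8, hd, Finset.sum_apply, Finset.sum_apply, ← Finset.add_sum_erase _ _ (Finset.mem_univ i),
      ← Finset.add_sum_erase (a := i) (f := fun i' => (deriv (ψ i') (m₈.R 9 i' 0) • A i') j) _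
        (Finset.mem_univ i)]
    rw [Finset.sum_congr rfl (g := fun i' => (deriv (ψ i') (m₈.R 9 i' 0) • A i') j)]
    · simp only [e9', Function.update_self, Pi.smul_apply, smul_eq_mul, hδ]
      ring
    · intro i' hi'
      rw [e9', Function.update_of_ne (Finset.ne_of_mem_erase hi')]
      rfl
  · funext j
    have hpj : m₂.R 7 j 0 - m₂.R 8 j 0 / m₂.R 5 0 0 + m₂.R 11 0 0 * m₂.R 10 j 0 = p j :=
      congrFun hpt j
    rw [hfm₂.2 7 (by decide), hfm₂.2 8 (by decide), hfm₂.2 10 (by decide), hT₂.lam, e11] at hpj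
    rw [shiftedPoint, ← hp, ← hz', point, e7, e8, e10, e11₈, hT₈.lam, Pi.sub_apply, ← hpj, e11]
    have hδ' : deriv (ψ i) z' - deriv (ψ i) (vec n 9 m i) = δ := hδ.symm
    rw [hδ', Pi.smul_apply, smul_eq_mul]
    obtain ⟨b, hb⟩ : ∃ b, b = m.R 11 0 0 * K / (K + 1) := ⟨_, rfl⟩
    rw [← hb] at hpos ⊢
    -- Adding `δ a i` to the gradient moves the represented point by `-δ a i / lam`, while only `(1
    -- - 1 / K) / (lam k i)` of this is wanted; the vector `10`, divided by its scale, carries the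
    -- difference.
    have : b * (m.R 10 j 0 + (1 / lam - (1 - 1 / K) / (lam * k i)) * δ / b * A i j)
      = b * m.R 10 j 0 + (1 / lam - (1 - 1 / K) / (lam * k i)) * δ * A i j := by
      field_simp
    rw [this]
    ring

lemma spec_stepCmd {m : Mem} {μ L : Fin n → ℝ} (hψ : ∀ i, SecondDerivIn (ψ i) (μ i) (L i))
    (hμ : ∀ i, 0 ≤ μ i) (hL : ∀ i, 0 < L i) (hlam : 0 < lam) {c x : Fin d → ℝ}
    (hg : gradient A ψ x = lam • (c - x)) (hk1 : ∀ i, 1 ≤ k i)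
    (hk : ∀ i, L i * (A i ⬝ᵥ A i) / lam ≤ ((k i : ℝ) - 1) * k i) (hK2 : 2 ≤ ∑ i, k i)
    (h : StepInv A ψ lam k c m) :
    Spec (oracle ψ) stepCmd m (12 * rowSparsity A + 25) (StepInv A ψ lam k c)
      (fun m' => ENNReal.ofReal (potential A ψ lam (∑ i, k i : ℕ) x (point d m') (vec n 9 m')))
      (ENNReal.ofReal (1 - 1 / (∑ i, k i : ℕ)) *
        ENNReal.ofReal (potential A ψ lam (∑ i, k i : ℕ) x (point d m) (vec n 9 m))) := by
  set K := ∑ i, k i with hKd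
  have hKR : (2 : ℝ) ≤ (K : ℝ) := by exact_mod_cast hK2
  set m₁ := m.setR 11 0 0 (m.R 11 0 0 * K / (K + 1)) with hm₁
  set pot : Fin n → ℝ := fun i => potential A ψ lam K x
    (shiftedPoint A ψ lam K k c (point d m) (vec n 9 m) i)
    (Function.update (vec n 9 m) i (dualPoint A ψ lam K k c (point d m) (vec n 9 m) i)) with hpot
  -- The potential after the step as a function of the drawn index. Summed over the cells of the
  -- table it becomes `∑ i, k i * g i`, so a uniform cell realizes the weighted sampling.
  set g : ℕ → ℝ≥0∞ := fun i => if h : i < n then ENNReal.ofReal (pot ⟨i, h⟩) else 0 with hgd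
  have hset : Ensures (oracle ψ) (.setR 11 (.const 0) (.const 0)
    (.div (.mul (.scalar 11) (.ofNat (.scalar 6)))
    (.add (.ofNat (.scalar 6)) (.ofNat (.const 1))))) m 1 (fun m' => m' = m₁) := by
    refine Ensures.setR ?_
    simp [NExpr.eval, RExpr.eval, h.table.size, hm₁, hKd]
  refine (hset.seq_spec (T₂ := 12 * rowSparsity A + 23) fun m' hm' _ => ?_).mono (by omega)
    (fun _ h _ => ⟨h, le_rfl⟩) le_rfl
  subst hm'
  have hN : m₁.N = m.N := rfl
  have hrand := Spec.rand (O := oracle ψ) (m := m₁) (a := 17) (i := .const 0) (j := .const 0)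
    (e := .sub (.scalar 6) (.const 1)) (Φ := fun m' => g (m.N 4 (m'.N 17 0 0) 0))
    (b := ENNReal.ofReal (1 - 1 / K) *
        ENNReal.ofReal (potential A ψ lam K x (point d m) (vec n 9 m))) (by
      -- The draw is from `{0, …, K - 1}`; the truncated subtraction is harmless because `K ≥ 2`.
      have e : NExpr.eval m₁ (.sub (.scalar 6) (.const 1)) + 1 = K := by
        simp only [NExpr.eval, NExpr.eval_scalar, hN, h.table.size]
        omega
      rw [e]
      simp only [NExpr.eval, Mem.setN, and_self, if_true]
      rw [h.table.table]
      have hpn : ∀ i, 0 ≤ pot i := fun i => by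
        have := bregman_nonneg (A := A) hψ hμ x (Function.update (vec n 9 m) i
          (dualPoint A ψ lam K k c (point d m) (vec n 9 m) i))
        have h2 := dotProduct_self_nonneg'
          (shiftedPoint A ψ lam K k c (point d m) (vec n 9 m) i - x)
        have h3 : 0 ≤ (K : ℝ) - 1 := by linarith
        simp only [hpot, potential]
        positivity
      have hle := sum_mul_potential_step_le hψ hμ hL hlam hg k hk1 hk (m := K)
        (by rw [hKd]; push_cast; rfl) hKR (point d m) (vec n 9 m)
      calc ∑ i : Fin n, (k i : ℝ≥0∞) * g i = ENNReal.ofReal (∑ i, (k i : ℝ) * pot i) := by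
            rw [ENNReal.ofReal_sum_of_nonneg fun i _ => by have := hpn i; positivity]
            refine Finset.sum_congr rfl fun i _ => ?_
            rw [ENNReal.ofReal_mul (by positivity), ENNReal.ofReal_natCast]
            simp [hgd]
        _ ≤ ENNReal.ofReal (K * ((1 - 1 / K) * potential A ψ lam K x (point d m) (vec n 9 m))) :=
            ENNReal.ofReal_le_ofReal hle
        _ = _ := by
            have : 0 ≤ 1 - 1 / (K : ℝ) := by
              rw [sub_nonneg, div_le_one (by linarith)]
              linarith
            rw [ENNReal.ofReal_mul (by positivity), ENNReal.ofReal_mul this,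
              ENNReal.ofReal_natCast])
  refine (hrand.seq (T₂ := 12 * rowSparsity A + 21) fun m₂ h₂ => ?_).mono (by omega)
    (fun _ h _ => ⟨h, le_rfl⟩) le_rfl
  obtain ⟨r, hr, rfl⟩ := h₂
  have hr' : r < K := by
    simp only [NExpr.eval, NExpr.eval_scalar, hN, h.table.size] at hr
    omega
  have hlt := h.table.table_lt hr'
  refine ((ensures_step_of_index h hlam hk1 (by rw [hm₁]; rfl) hr' ⟨m.N 4 r 0, hlt⟩ rfl).spec
    (Φ := fun m' => ENNReal.ofReal (potential A ψ lam K x (point d m') (vec n 9 m')))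
    fun m' hm' => ?_).mono le_rfl (fun m' hm' _ => ⟨hm'.1, le_rfl⟩) le_rfl
  rw [hm'.2.1, hm'.2.2]
  simp only [hgd, NExpr.eval, Mem.setN, and_self, if_true]
  rw [dif_pos hlt]

/-- One stage: solve the proximal subproblem centered at the vector `7` approximately, and replace
the center by the result. -/
def stageCmd : Cmd :=
  .seq gradientCmd
  (.seq (.fill 12 10 (.scalar 1) (.div (.entry 8 (.scalar 12)) (.scalar 5)))
  (.seq (.setR 11 (.const 0) (.const 0) (.ofNat (.const 1)))
  (.seq (.forUp 14 (.mul (.scalar 6) (.scalar 8)) stepCmd)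
    (.fill 12 7 (.scalar 1) (currentPoint (.scalar 12))))))

lemma HoldsTable.setN {m : Mem} (h : HoldsTable A lam k m) {a i j r : ℕ} (ha : 6 < a) :
    HoldsTable A lam k (m.setN a i j r) :=
  h.frame (frame_setN (wN := [a]) (wR := []) (by simp)) (by simpa using ha) (by simp)

lemma StepInv.setN {m : Mem} {c : Fin d → ℝ} (h : StepInv A ψ lam k c m) {a i j r : ℕ} (ha : 6 < a) :
    StepInv A ψ lam k c (m.setN a i j r) :=
  ⟨h.table.setN ha, h.center, h.dual, h.scale⟩

/-- A stage multiplies the expected suboptimality by `3 / 4`. -/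
lemma spec_stageCmd {m : Mem} {μ L : Fin n → ℝ} (hψ : ∀ i, SecondDerivIn (ψ i) (μ i) (L i))
    (hμ : ∀ i, 0 ≤ μ i) (hL : ∀ i, 0 < L i) (hlam : 0 < lam) (hs : StronglyCvx A ψ lam)
    (hk1 : ∀ i, 1 ≤ k i) (hk : ∀ i, L i * (A i ⬝ᵥ A i) / lam ≤ ((k i : ℝ) - 1) * k i)
    (hK2 : 2 ≤ ∑ i, k i) (hRK : smoothness A L + lam ≤ ((∑ i, k i : ℕ) : ℝ) ^ 2 * lam) {ℓ : ℕ}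
    (hℓ : 4 * (∑ i, k i) ^ 2 ≤ 2 ^ ℓ) (hT : HoldsTable A lam k m) (hm : m.N 8 0 0 = ℓ) :
    Spec (oracle ψ) stageCmd m
      ((∑ i, k i) * ℓ * (12 * rowSparsity A + 28) + n * (8 * rowSparsity A + 16) + 12 * d + 21)
      (HoldsTable A lam k) (fun m' => ENNReal.ofReal (gap A ψ (vec d 7 m')))
      (ENNReal.ofReal (3 / 4) * ENNReal.ofReal (gap A ψ (vec d 7 m))) := by
  set K := ∑ i, k i with hKd
  set c := vec d 7 m with hc
  have hKR : (2 : ℝ) ≤ (K : ℝ) := by exact_mod_cast hK2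
  obtain ⟨x, hx, hg⟩ := hs.exists_prox hψ (fun i => (hL i).le) hlam c
  refine ((ensures_gradientCmd hT.matrix).seq_spec (T₂ := K * ℓ * (12 * rowSparsity A + 28)
    + 8 * d + 13) fun m₁ h₁ hf₁ => ?_).mono (by omega) (fun _ h _ => ⟨h, le_rfl⟩) le_rfl
  have hT₁ := hT.frame hf₁ (by decide) (by decide)
  have hfill : Ensures (oracle ψ)
      (.fill 12 10 (.scalar 1) (.div (.entry 8 (.scalar 12)) (.scalar 5))) m₁ (4 * d + 3)
      fun m' => ∀ j, j < d → m'.R 10 j 0 = m₁.R 8 j 0 / lam :=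
    ensures_fill d _ (fun m' h => by simp [(hT₁.frame h (by decide) (by decide)).matrix.cols])
      (fun j hj m' h hv _ => by
        simp [RExpr.eval, hv, h.2 8 (by decide), (hT₁.frame h (by decide) (by decide)).lam])
  refine (hfill.seq_spec (T₂ := K * ℓ * (12 * rowSparsity A + 28) + 4 * d + 9)
    fun m₂ h₂ hf₂ => ?_).mono (by omega) (fun _ h _ => ⟨h, le_rfl⟩) le_rfl
  have hT₂ := hT₁.frame hf₂ (by decide) (by decide)
  have hone : Ensures (oracle ψ) (.setR 11 (.const 0) (.const 0) (.ofNat (.const 1))) m₂ 1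
      fun m' => m' = m₂.setR 11 0 0 1 := by
    refine Ensures.setR ?_
    simp [NExpr.eval, RExpr.eval]
  refine (hone.seq_spec (T₂ := K * ℓ * (12 * rowSparsity A + 28) + 4 * d + 7)
    fun m₃ h₃ hf₃ => ?_).mono (by omega) (fun _ h _ => ⟨h, le_rfl⟩) le_rfl
  have hT₃ := hT₂.frame hf₃ (by decide) (by decide)
  have hR : ∀ a, a ∉ [8, 9, 10, 11, 12, 13] → m₃.R a = m.R a := fun a ha => by
    simp only [List.mem_cons, List.not_mem_nil, or_false, not_or] at ha
    rw [hf₃.2 a (by simp [Cmd.writesR, ha]),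
      hf₂.2 a (by simp [Cmd.writesR, Cmd.fill, Cmd.forUp, ha]),
      hf₁.2 a (by simp [Cmd.writesR, Cmd.fill, Cmd.forUp, gradientCmd, Cmd.sumLoop, scatter, ha])]
  have e8 : m₃.R 8 = m₁.R 8 := by rw [hf₃.2 8 (by decide), hf₂.2 8 (by decide)]
  have e9 : m₃.R 9 = m₁.R 9 := by rw [hf₃.2 9 (by decide), hf₂.2 9 (by decide)]
  have e10 : ∀ j : Fin d, m₃.R 10 j 0 = m₁.R 8 j 0 / lam := fun j => by
    rw [hf₃.2 10 (by decide), h₂ j j.2]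
  have e11 : m₃.R 11 0 0 = 1 := by simp [h₃, Mem.setR]
  have eN8 : m₃.N 8 0 0 = ℓ := by
    rw [hf₃.1 8 (by decide), hf₂.1 8 (by decide), hf₁.1 8 (by decide), hm]
  have hz : vec n 9 m₃ = fun i => A i ⬝ᵥ c := by
    rw [← h₁.1]
    funext i
    rw [vec, vec, e9]
  have hcen : vec d 7 m₃ = c := by
    funext j
    rw [vec, hR 7 (by decide), hc, vec]
  have hinv : StepInv A ψ lam k c m₃ := by
    refine ⟨hT₃, hcen, ?_, by rw [e11]; norm_num⟩
    have : vec d 8 m₃ = vec d 8 m₁ := by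
      funext j
      rw [vec, vec, e8]
    rw [this, h₁.2, gradient]
    refine Finset.sum_congr rfl fun i _ => ?_
    have hzi : m₃.R 9 i 0 = A i ⬝ᵥ c := congrFun hz i
    rw [hzi]
  have hpt : point d m₃ = c := by
    funext j
    have : m₃.R 7 j 0 = c j := congrFun hcen j
    rw [point, e10, e8, e11, hT₃.lam, this]
    ring
  -- the loop
  have hloop := Spec.forUp_contract (O := oracle ψ) (v := 14) (bound := .mul (.scalar 6) (.scalar 8))
    (body := stepCmd) (StepInv A ψ lam k c)
    (fun m' => ENNReal.ofReal (potential A ψ lam K x (point d m') (vec n 9 m')))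
    (ENNReal.ofReal (1 - 1 / K)) (K * ℓ) (12 * rowSparsity A + 25) (m := m₃) (by decide)
    (fun m' h => by
      simp [NExpr.eval, h.1 8 (by decide), eN8, h.1 6 (by decide), hT₃.size, ← hKd])
    (fun m' r h => h.setN (by norm_num)) (fun m' r => rfl) hinv
    (fun m' _ h => spec_stepCmd hψ hμ hL hlam hg hk1 hk hK2 h)
  have hθ : 0 ≤ 1 - 1 / (K : ℝ) := by
    rw [sub_nonneg, div_le_one (by linarith)]
    linarith
  have hgap := gap_nonneg (fun i => (hψ i).1) hlam hs c
  -- The initial potential is at most `K` times the gap of `c`, and `(1 - 1 / K) ^ (K ℓ) ≤ 2 ^ (-ℓ)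
  -- ≤ 1 / (4 K²)`.
  have hpot : (1 - 1 / (K : ℝ)) ^ (K * ℓ) * potential A ψ lam K x (point d m₃) (vec n 9 m₃)
      ≤ gap A ψ c / (4 * K) := by
    rw [hpt, hz]
    have h1 := potential_center_le hψ hμ hlam hs hg (m := K) (by linarith)
    have h2 : (1 - 1 / (K : ℝ)) ^ K ≤ 1 / 2 := by
      have h3 : (1 - 1 / (K : ℝ)) ^ K ≤ Real.exp (-1) := Real.one_sub_div_pow_le_exp_neg
        (by linarith)
      have h4 : (2 : ℝ) ≤ Real.exp 1 := by linarith [Real.add_one_le_exp (1 : ℝ)]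
      rw [Real.exp_neg] at h3
      refine h3.trans ?_
      rw [one_div]
      exact inv_anti₀ (by norm_num) h4
    have h5 : (1 - 1 / (K : ℝ)) ^ (K * ℓ) ≤ 1 / (4 * K ^ 2) := by
      rw [pow_mul]
      refine (pow_le_pow_left₀ (by positivity) h2 ℓ).trans ?_
      rw [one_div_pow]
      refine one_div_le_one_div_of_le (by positivity) ?_
      exact_mod_cast hℓ
    calc _ ≤ 1 / (4 * (K : ℝ) ^ 2) * (K * gap A ψ c) := by
          refine mul_le_mul h5 h1 ?_ (by positivity)
          have := bregman_nonneg (A := A) hψ hμ x (fun i => A i ⬝ᵥ c)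
          have h6 := dotProduct_self_nonneg' (c - x)
          have h7 : 0 ≤ (K : ℝ) - 1 := by linarith
          unfold potential
          positivity
      _ = _ := by field_simp
  -- the new center
  refine (Spec.seq (I := StepInv A ψ lam k c) (T₂ := 4 * d + 3)
    (Φ := fun m' => ENNReal.ofReal (gap A ψ c / 2)
      + ENNReal.ofReal K * ENNReal.ofReal (potential A ψ lam K x (point d m') (vec n 9 m')))
    (b := ENNReal.ofReal (3 / 4) * ENNReal.ofReal (gap A ψ c)) ?_ fun m₄ h₄ => ?_).mono
    (T := K * ℓ * (12 * rowSparsity A + 25 + 3) + 3 + (4 * d + 3) + 1)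
    (by rw [add_assoc (12 * rowSparsity A)]; omega) (fun _ h _ => ⟨h, le_rfl⟩) le_rfl
  -- The new gap is at most half the old one plus `K` times the final potential, and the latter term
  -- is a quarter of the old gap in expectation: `1 / 2 + 1 / 4 = 3 / 4`.
  · obtain ⟨ν, hex, hI, hb⟩ := hloop
    refine ⟨ν, hex, hI, ?_⟩
    simp only [mul_add]
    rw [ENNReal.tsum_add, tsum_mul_const]
    have e : ∀ m', ν m' * (ENNReal.ofReal K *
        ENNReal.ofReal (potential A ψ lam K x (point d m') (vec n 9 m'))) = ENNReal.ofReal K *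
        (ν m' * ENNReal.ofReal (potential A ψ lam K x (point d m') (vec n 9 m'))) :=
      fun m' => by ring
    simp only [e]
    rw [ENNReal.tsum_mul_left]
    calc _ ≤ ENNReal.ofReal (gap A ψ c / 2) + ENNReal.ofReal K * (ENNReal.ofReal (1 - 1 / K) ^ (K * ℓ)
          * ENNReal.ofReal (potential A ψ lam K x (point d m₃) (vec n 9 m₃))) := by gcongr
      _ ≤ ENNReal.ofReal (gap A ψ c / 2) + ENNReal.ofReal K * ENNReal.ofReal (gap A ψ c / (4 * K)) := by
          gcongr
          rw [← ENNReal.ofReal_pow hθ, ← ENNReal.ofReal_mul (by positivity)]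
          exact ENNReal.ofReal_le_ofReal hpot
      _ = _ := by
          rw [← ENNReal.ofReal_mul (by positivity), ← ENNReal.ofReal_add (by positivity)
            (by positivity), ← ENNReal.ofReal_mul (by norm_num)]
          congr 1
          field_simp
          ring
  · have hfin : Ensures (oracle ψ) (.fill 12 7 (.scalar 1) (currentPoint (.scalar 12))) m₄ (4 * d + 3)
        fun m' => ∀ j, j < d → m'.R 7 j 0
          = m₄.R 7 j 0 - m₄.R 8 j 0 / m₄.R 5 0 0 + m₄.R 11 0 0 * m₄.R 10 j 0 :=
      ensures_fill d _
        (fun m' h => by simp [(h₄.table.frame h (by decide) (by decide)).matrix.cols])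
        (fun j hj m' h hv h7 => by
          simp [currentPoint, RExpr.eval, hv, h.2 8 (by decide), h.2 5 (by decide),
            h.2 11 (by decide), h.2 10 (by decide), h7])
    refine ((hfin.mono le_rfl (J := fun m' => vec d 7 m' = point d m₄ ∧ HoldsTable A lam k m')
      fun m' h hf => ⟨funext fun j => h j j.2, h₄.table.frame hf (by decide) (by decide)⟩).spec
      (Φ := fun m' => ENNReal.ofReal (gap A ψ (vec d 7 m'))) fun m' h => ?_).mono le_rfl
      (fun m' h _ => ⟨h.2, le_rfl⟩) le_rfl
    rw [h.1, ← ENNReal.ofReal_mul (by positivity)]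
    refine (ENNReal.ofReal_le_ofReal (gap_le_of_potential hψ hμ (fun i => (hL i).le) hlam hs hx hg
      (m := K) (by linarith) hRK (point d m₄) (vec n 9 m₄))).trans ?_
    exact ENNReal.ofReal_add_le

end stage

/-! ### Preparation: the sampling table, the loop counts and gradient descent. -/

section program

variable {n d : ℕ} {A : Matrix (Fin n) (Fin d) ℝ} {ψ : Fin n → ℝ → ℝ} {M lam ε : ℝ}
  {L : Fin n → ℝ} {x₀ : Fin d → ℝ} {O : Oracle}

/-- The memory contains the input. -/
structure HoldsInput (A : Matrix (Fin n) (Fin d) ℝ) (M : ℝ) (L : Fin n → ℝ) (lam : ℝ)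
    (x₀ : Fin d → ℝ) (ε : ℝ) (m : Mem) : Prop where
  matrix : HoldsMatrix A m
  start : vec d 1 m = x₀
  smooth : ∀ i : Fin n, m.R 3 i 0 = L i
  bound : m.R 4 0 0 = M
  lam : m.R 5 0 0 = lam
  eps : m.R 6 0 0 = ε

lemma HoldsInput.frame {m m' : Mem} (h : HoldsInput A M L lam x₀ ε m)
    {wN wR : List ℕ} (hf : Frame wN wR m m') (hN : ∀ a ∈ wN, 3 < a) (hR : ∀ a ∈ wR, 6 < a) :
    HoldsInput A M L lam x₀ ε m' := by
  have e : ∀ a, a ≤ 6 → m'.R a = m.R a := fun a ha => hf.2 a fun h => by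
    have := hR a h
    omega
  refine ⟨h.matrix.frame hf hN hR, ?_, fun i => ?_, ?_, ?_, ?_⟩
  · rw [← h.start]
    funext j
    rw [vec, vec, e 1 (by omega)]
  · rw [e 3 (by omega), h.smooth]
  · rw [e 4 (by omega), h.bound]
  · rw [e 5 (by omega), h.lam]
  · rw [e 6 (by omega), h.eps]

lemma holdsInput_inputMem (μ : Fin n → ℝ) :
    HoldsInput A M L lam x₀ ε (inputMem A M μ L lam x₀ ε) :=
  ⟨⟨by simp [inputMem, scalarArray], by simp [inputMem, scalarArray],
    fun i => by simp [inputMem, vecArray], rfl, rfl⟩, funext fun j => by simp [inputMem, vec, vecArray],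
    fun i => by simp [inputMem, vecArray], by simp [inputMem, scalarArray],
    by simp [inputMem, scalarArray], by simp [inputMem, scalarArray]⟩

/-- The multiplicity of index `i` in the sampling table. -/
noncomputable def multiplicity (A : Matrix (Fin n) (Fin d) ℝ) (L : Fin n → ℝ) (lam : ℝ)
    (i : Fin n) : ℕ :=
  ⌈1 + √(L i * (A i ⬝ᵥ A i) / lam)⌉₊

/-- Append `⌈1 + √(x / lam)⌉` copies of the loop variable `10` to the table, where `x` is the
scalar `12`. -/
def appendCmd : Cmd :=
  .loop (.ltR (.ofNat (.get 5 (.scalar 10) (.const 0)))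
      (.add (.ofNat (.const 1)) (.sqrt (.div (.scalar 12) (.scalar 5)))))
    (.seq (.setN 4 (.scalar 6) (.const 0) (.scalar 10))
    (.seq (.setN 6 (.const 0) (.const 0) (.add (.scalar 6) (.const 1)))
      (.setN 5 (.scalar 10) (.const 0) (.add (.get 5 (.scalar 10) (.const 0)) (.const 1)))))

/-- Counting up while the counter is below `1 + √(x / lam)` computes the ceiling by comparisons
alone, as reals cannot be rounded. The cost is proportional to the number of copies, so the whole
table costs `O(K)` beyond the row norms. -/
lemma ensures_appendCmd {m : Mem} (i B s : ℕ) (hi : m.N 10 0 0 = i) (hs : m.N 6 0 0 = s)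
    (h5 : m.N 5 i 0 = 0) (hB : ⌈1 + √(m.R 12 0 0 / m.R 5 0 0)⌉₊ = B) :
    Ensures O appendCmd m (6 * B + 1) fun m' =>
      m'.N 5 i 0 = B ∧ (∀ i', i' ≠ i → m'.N 5 i' 0 = m.N 5 i' 0) ∧ m'.N 6 0 0 = s + B ∧
      ∀ g : ℕ → ℝ≥0∞, ∑ r ∈ Finset.range (s + B), g (m'.N 4 r 0)
        = ∑ r ∈ Finset.range s, g (m.N 4 r 0) + B * g i := by
  refine (Ensures.loop_while (fun k m' => Frame [4, 5, 6] [] m m' ∧ m'.N 5 i 0 = k ∧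
    (∀ i', i' ≠ i → m'.N 5 i' 0 = m.N 5 i' 0) ∧ m'.N 6 0 0 = s + k ∧
      ∀ g : ℕ → ℝ≥0∞, ∑ r ∈ Finset.range (s + k), g (m'.N 4 r 0)
        = ∑ r ∈ Finset.range s, g (m.N 4 r 0) + k * g i) B (fun _ => 5) (fun k hk m' h => ?_)
    (fun m' h => ?_) (fun k hk m' h => ?_) m ⟨.refl _ _ _, h5, fun _ _ => rfl, hs, by simp⟩).mono
    (by simp; omega) fun m' h _ => h.2
  · have h10 : m'.N 10 0 0 = i := by rw [h.1.1 10 (by decide), hi]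
    simp only [BExpr.eval, RExpr.eval, NExpr.eval, NExpr.eval_scalar, RExpr.eval_scalar, h10, h.2.1,
      h.1.2 12 (by decide), h.1.2 5 (by decide), decide_eq_true_eq, Nat.cast_one]
    exact Nat.lt_ceil.mp (hB ▸ hk)
  · have h10 : m'.N 10 0 0 = i := by rw [h.1.1 10 (by decide), hi]
    simp only [BExpr.eval, RExpr.eval, NExpr.eval, NExpr.eval_scalar, RExpr.eval_scalar, h10, h.2.1,
      h.1.2 12 (by decide), h.1.2 5 (by decide), decide_eq_false_iff_not, Nat.cast_one]
    intro hlt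
    rw [← Nat.lt_ceil, hB] at hlt
    exact lt_irrefl _ hlt
  · have h10 : m'.N 10 0 0 = i := by rw [h.1.1 10 (by decide), hi]
    obtain ⟨hf, ha, hb, hc, hd⟩ := h
    refine (Ensures.seq (T₁ := 1) (T₂ := 3) (Ensures.setN (I := fun m₁ => m₁ = m'.setN 4 (s + k) 0 i)
      ?_) fun m₁ h₁ _ => ?_).mono (by omega) fun _ h _ => h
    · simp [NExpr.eval, h10, hc]
    refine (Ensures.seq (T₁ := 1) (T₂ := 1) (Ensures.setN (I := fun m₂ => m₂ = m₁.setN 6 0 0 (s + k + 1))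
      ?_) fun m₂ h₂ _ => ?_).mono (by omega) fun _ h _ => h
    · simp [NExpr.eval, h₁, Mem.setN, hc]
    refine Ensures.setN ?_
    have e10 : m₂.N 10 0 0 = i := by simp [h₂, h₁, Mem.setN, h10]
    have e5 : m₂.N 5 = m'.N 5 := by
      funext a b
      simp [h₂, h₁, Mem.setN]
    simp only [NExpr.eval, NExpr.eval_scalar, e10, e5, ha]
    refine ⟨?_, by simp [Mem.setN], fun i' hi' => ?_, ?_, fun g => ?_⟩
    · rw [h₂, h₁]
      exact ((hf.trans (frame_setN (by simp))).trans (frame_setN (by simp))).trans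
        (frame_setN (by simp))
    · simp [Mem.setN, hi', e5, hb i' hi']
    · simp [Mem.setN, h₂, add_assoc]
    · have e4 : ∀ r, ((m₂.setN 5 i 0 (k + 1)).N 4 r 0) = if r = s + k then i else m'.N 4 r 0 := by
        intro r
        simp [h₂, h₁, Mem.setN]
      rw [← add_assoc, Finset.sum_range_succ]
      simp only [e4, if_true]
      rw [Finset.sum_congr rfl (g := fun r => g (m'.N 4 r 0)), hd]
      · push_cast
        ring
      · intro r hr
        rw [if_neg (Finset.mem_range.mp hr).ne]

/-- Build the sampling table, and store `∑ i, min (L i) M ‖a i‖²` in the scalar `14`. -/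
def tableCmd : Cmd :=
  .seq (.setN 6 (.const 0) (.const 0) (.const 0))
  (.seq (.setR 14 (.const 0) (.const 0) (.ofNat (.const 0)))
    (.forUp 10 (.scalar 0)
      (.seq (.sumLoop 11 12 (rowLen (.scalar 10)) (.mul (rowVal (.scalar 10) 11) (rowVal (.scalar 10) 11)))
      (.seq (.cond (.ltR (.entry 3 (.scalar 10)) (.scalar 4))
        (.setR 13 (.const 0) (.const 0) (.entry 3 (.scalar 10)))
        (.setR 13 (.const 0) (.const 0) (.scalar 4)))
      (.seq (.setR 12 (.const 0) (.const 0) (.mul (.scalar 13) (.scalar 12)))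
      (.seq (.setR 14 (.const 0) (.const 0) (.add (.scalar 14) (.scalar 12)))
      (.seq (.setN 5 (.scalar 10) (.const 0) (.const 0)) appendCmd)))))))

lemma sum_range_vecArray {α : Type} [AddCommMonoid α] (f : Fin n → α) :
    ∑ i ∈ Finset.range n, vecArray f i 0 = ∑ i, f i := by
  rw [Finset.sum_range]
  simp [vecArray]

lemma ensures_tableCmd {m : Mem} (h : HoldsInput A M L lam x₀ ε m) :
    Ensures O tableCmd m
      (n * (4 * rowSparsity A + 19) + 6 * ∑ i, multiplicity A (fun i => min (L i) M) lam i + 7)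
      fun m' => HoldsTable A lam (multiplicity A (fun i => min (L i) M) lam) m' ∧
        m'.R 14 0 0 = smoothness A fun i => min (L i) M := by
  set L' : Fin n → ℝ := fun i => min (L i) M with hL'
  set k := multiplicity A L' lam with hk
  obtain ⟨w, hw⟩ : ∃ w : Fin n → ℝ, w = fun i => L' i * (A i ⬝ᵥ A i) := ⟨_, rfl⟩
  refine (Ensures.seq (T₁ := 1) (T₂ := n * (4 * rowSparsity A + 19) + 6 * ∑ i, k i + 5)
    (Ensures.setN (I := fun m₁ => m₁ = m.setN 6 0 0 0) rfl)
    fun m₁ h₁ hf₁ => ?_).mono (by omega) fun _ h _ => h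
  refine (Ensures.seq (T₁ := 1) (T₂ := n * (4 * rowSparsity A + 19) + 6 * ∑ i, k i + 3)
    (Ensures.setR (I := fun m₂ => m₂ = m₁.setR 14 0 0 0) ?_)
    fun m₂ h₂ hf₂ => ?_).mono (by omega) fun _ h _ => h
  · simp [NExpr.eval, RExpr.eval]
  have hI₂ := (h.frame hf₁ (by decide) (by decide)).frame hf₂ (by decide) (by decide)
  refine (Ensures.forUp (fun b m' => m'.R 14 0 0 = ∑ i ∈ Finset.range b, vecArray w i 0 ∧
      m'.N 6 0 0 = ∑ i ∈ Finset.range b, vecArray k i 0 ∧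
      (∀ i : Fin n, (i : ℕ) < b → m'.N 5 i 0 = k i) ∧
      ∀ g : ℕ → ℝ≥0∞, ∑ r ∈ Finset.range (∑ i ∈ Finset.range b, vecArray k i 0), g (m'.N 4 r 0)
        = ∑ i ∈ Finset.range b, ((vecArray k i 0 : ℕ) : ℝ≥0∞) * g i) n
    (fun i => 4 * rowSparsity A + 16 + 6 * vecArray k i 0) (by decide)
    (fun m' h => by simp [(hI₂.frame h (by decide) (by decide)).matrix.rows])
    ?_ fun b hb m' hf hvb hJ => ?_).mono ?_ fun m' hJ hf => ?_
  · simp [h₂, h₁, Mem.setN, Mem.setR]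
  · have hI := hI₂.frame hf (by decide) (by decide)
    have ekb : vecArray k b 0 = k ⟨b, hb⟩ := by simp [vecArray, hb]
    have ewb : vecArray w b 0 = w ⟨b, hb⟩ := by simp [vecArray, hb]
    refine ((ensures_rowSq hI.matrix (v := 11) (acc := 12) (by norm_num) (by norm_num)
      (ie := .scalar 10) ⟨b, hb⟩ (fun m'' h => by simp [h.1 10 (by decide), hvb])).seq
      (T₂ := 10 + 6 * k ⟨b, hb⟩) fun m₃ h₃ hf₃ => ?_).mono (by rw [ekb]; omega) fun _ h _ => h
    have hI₃ := hI.frame hf₃ (by decide) (by decide)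
    have e10 : m₃.N 10 0 0 = b := by rw [hf₃.1 10 (by decide), hvb]
    refine (Ensures.seq (T₁ := 2) (T₂ := 7 + 6 * k ⟨b, hb⟩) (I := fun m₄ =>
      m₄ = m₃.setR 13 0 0 (L' ⟨b, hb⟩)) (Ensures.cond (T := 1) (fun hc => Ensures.setR ?_)
      (fun hc => Ensures.setR ?_)) fun m₄ h₄ hf₄ => ?_).mono (by omega) fun _ h _ => h
    · simp only [BExpr.eval, RExpr.eval_entry, RExpr.eval_scalar, NExpr.eval_scalar, e10, hI₃.bound,
        hI₃.smooth ⟨b, hb⟩, decide_eq_true_eq] at hc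
      simp [NExpr.eval, e10, hL', hc.le, hI₃.smooth ⟨b, hb⟩]
    · simp only [BExpr.eval, RExpr.eval_entry, RExpr.eval_scalar, NExpr.eval_scalar, e10, hI₃.bound,
        hI₃.smooth ⟨b, hb⟩, decide_eq_false_iff_not, not_lt] at hc
      simp [NExpr.eval, hL', hc, hI₃.bound]
    refine (Ensures.seq (T₁ := 1) (T₂ := 5 + 6 * k ⟨b, hb⟩) (Ensures.setR
      (I := fun m₅ => m₅ = m₄.setR 12 0 0 (w ⟨b, hb⟩)) ?_)
      fun m₅ h₅ hf₅ => ?_).mono (by omega) fun _ h _ => h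
    · simp [NExpr.eval, RExpr.eval, h₄, Mem.setR, h₃, hw]
    have e14₄ : m₅.R 14 0 0 = m'.R 14 0 0 := by
      rw [hf₅.2 14 (by decide), hf₄.2 14 (by decide), hf₃.2 14 (by decide)]
    refine (Ensures.seq (T₁ := 1) (T₂ := 3 + 6 * k ⟨b, hb⟩) (Ensures.setR
      (I := fun m₆ => m₆ = m₅.setR 14 0 0 (m'.R 14 0 0 + w ⟨b, hb⟩)) ?_)
      fun m₆ h₆ hf₆ => ?_).mono (by omega) fun _ h _ => h
    · simp only [RExpr.eval, RExpr.eval_scalar, e14₄, NExpr.eval]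
      simp [h₅, Mem.setR]
    have e10₆ : m₆.N 10 0 0 = b := by
      rw [hf₆.1 10 (by decide), hf₅.1 10 (by decide), hf₄.1 10 (by decide), e10]
    refine (Ensures.seq (T₁ := 1) (T₂ := 1 + 6 * k ⟨b, hb⟩) (Ensures.setN
      (I := fun m₇ => m₇ = m₆.setN 5 b 0 0) ?_)
      fun m₇ h₇ hf₇ => ?_).mono (by omega) fun _ h _ => h
    · simp [NExpr.eval, e10₆]
    have hI₇ := (((hI₃.frame hf₄ (by decide) (by decide)).frame hf₅ (by decide) (by decide)).frame
      hf₆ (by decide) (by decide)).frame hf₇ (by decide) (by decide)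
    have e12 : m₇.R 12 0 0 = w ⟨b, hb⟩ := by
      rw [hf₇.2 12 (by decide), hf₆.2 12 (by decide), h₅]
      simp [Mem.setR]
    have eN : ∀ a, a ∉ [5, 11] → m₇.N a = m'.N a := fun a ha => by
      simp only [List.mem_cons, List.not_mem_nil, or_false, not_or] at ha
      rw [hf₇.1 a (by simp [Cmd.writesN, ha]), hf₆.1 a (by simp [Cmd.writesN]),
        hf₅.1 a (by simp [Cmd.writesN]), hf₄.1 a (by simp [Cmd.writesN]),
        hf₃.1 a (by simp [Cmd.writesN, Cmd.sumLoop, Cmd.forUp, ha])]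
    have e5 : ∀ i, i ≠ b → m₇.N 5 i 0 = m'.N 5 i 0 := fun i hi => by
      have : m₆.N 5 = m'.N 5 := by
        rw [hf₆.1 5 (by decide), hf₅.1 5 (by decide), hf₄.1 5 (by decide), hf₃.1 5 (by decide)]
      simp [h₇, Mem.setN, hi, this]
    refine (ensures_appendCmd b (k ⟨b, hb⟩) (∑ i ∈ Finset.range b, vecArray k i 0)
      (by rw [eN 10 (by decide), hvb]) (by rw [eN 6 (by decide), hJ.2.1]) (by simp [h₇, Mem.setN])
      (by rw [e12, hI₇.lam, hk, multiplicity, hw])).mono (by omega) fun m₈ h₈ hf₈ => ?_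
    simp only [Mem.setN]
    rw [Finset.sum_range_succ, Finset.sum_range_succ, ekb, ewb]
    refine ⟨?_, ?_, fun i hi => ?_, fun g => ?_⟩
    · rw [hf₈.2 14 (by decide), hf₇.2 14 (by decide), h₆, ← hJ.1]
      simp [Mem.setR]
    · simpa using h₈.2.2.1
    · by_cases hib : (i : ℕ) = b
      · have : i = ⟨b, hb⟩ := Fin.ext hib
        subst this
        simpa using h₈.1
      · simpa using (h₈.2.1 i hib).trans ((e5 i hib).trans (hJ.2.2.1 i (by omega)))
    · have := h₈.2.2.2 g
      simp only [eN 4 (by decide)] at this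
      rw [hJ.2.2.2 g] at this
      simpa [Finset.sum_range_succ, ekb] using this
  · rw [Finset.sum_add_distrib, Finset.sum_add_distrib, ← Finset.mul_sum, sum_range_vecArray]
    simp
    ring_nf
    omega
  · refine ⟨⟨(hI₂.frame hf (by decide) (by decide)).matrix, (hI₂.frame hf (by decide) (by decide)).lam,
      fun i => hJ.2.2.1 i i.2, ?_, fun g => ?_⟩, ?_⟩
    · rw [hJ.2.1, sum_range_vecArray]
    · have := hJ.2.2.2 g
      rw [sum_range_vecArray] at this
      rw [this, Finset.sum_range]
      simp [vecArray]
    · rw [hJ.1, sum_range_vecArray, hw, smoothness]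

/-- The `c`-th power of an expression. -/
def powN (e : NExpr) : ℕ → NExpr
  | 0 => .const 1
  | c + 1 => .mul (powN e c) e

lemma eval_powN (m : Mem) (e : NExpr) (c : ℕ) : (powN e c).eval m = e.eval m ^ c := by
  induction c with
  | zero => rfl
  | succ c ih => rw [powN, NExpr.eval, ih, pow_succ]

/-- Store in the scalar `7` the number of stages. -/
def countCmd (c : ℕ) : Cmd :=
  .seq (.setR 17 (.const 0) (.const 0) (.div (.scalar 6) (.ofNat (powN (.scalar 0) c))))
  (.seq (.setN 7 (.const 0) (.const 0) (.const 0))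
    (.loop (.ltR (.scalar 17) (.ofNat (.const 1)))
      (.seq (.setR 17 (.const 0) (.const 0) (.mul (.scalar 17)
        (.div (.ofNat (.const 4)) (.ofNat (.const 3)))))
        (.setN 7 (.const 0) (.const 0) (.add (.scalar 7) (.const 1))))))

/-- The two hypotheses say that `S` is the first exponent at which `ε / n ^ c * (4 / 3) ^ S` reaches
`1`; repeated multiplication replaces a logarithm. -/
lemma ensures_countCmd {m : Mem} (h : HoldsInput A M L lam x₀ ε m) (c S : ℕ)
    (hS : ∀ j, j < S → ε / n ^ c * (4 / 3) ^ j < 1) (hS' : 1 ≤ ε / n ^ c * (4 / 3) ^ S) :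
    Ensures O (countCmd c) m (4 * S + 5) fun m' => m'.N 7 0 0 = S := by
  refine (Ensures.seq (T₁ := 1) (T₂ := 4 * S + 3) (Ensures.setR
    (I := fun m₁ => m₁ = m.setR 17 0 0 (ε / n ^ c)) ?_)
    fun m₁ h₁ _ => ?_).mono (by omega) fun _ h _ => h
  · simp [RExpr.eval, NExpr.eval, eval_powN, h.matrix.rows, h.eps]
  refine (Ensures.seq (T₁ := 1) (T₂ := 4 * S + 1) (Ensures.setN
    (I := fun m₂ => m₂ = m₁.setN 7 0 0 0) rfl) fun m₂ h₂ _ => ?_).mono (by omega) fun _ h _ => h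
  refine (Ensures.loop_while (fun j m' => m'.R 17 0 0 = ε / n ^ c * (4 / 3) ^ j ∧ m'.N 7 0 0 = j) S
    (fun _ => 3) (fun j hj m' h => ?_) (fun m' h => ?_) (fun j hj m' h => ?_) m₂ ?_).mono
    (by simp; omega) fun m' h _ => h.2
  · simpa [BExpr.eval, RExpr.eval, NExpr.eval, h.1] using hS j hj
  · simpa [BExpr.eval, RExpr.eval, NExpr.eval, h.1] using hS'
  · refine Ensures.seq (T₁ := 1) (T₂ := 1) (Ensures.setR
      (I := fun m₃ => m₃ = m'.setR 17 0 0 (ε / n ^ c * (4 / 3) ^ (j + 1))) ?_) fun m₃ h₃ _ => ?_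
    · simp [RExpr.eval, NExpr.eval, h.1, pow_succ, mul_assoc]
    · refine Ensures.setN ?_
      simp [h₃, Mem.setN, Mem.setR, NExpr.eval, h.2]
  · simp [h₂, h₁, Mem.setN, Mem.setR]

/-- Store in the scalar `8` the logarithm of the squared size of the table. -/
def logCmd : Cmd :=
  .seq (.setN 16 (.const 0) (.const 0) (.const 1))
  (.seq (.setN 8 (.const 0) (.const 0) (.const 0))
    (.loop (.ltN (.scalar 16) (.mul (.const 4) (.mul (.scalar 6) (.scalar 6))))
      (.seq (.setN 16 (.const 0) (.const 0) (.mul (.scalar 16) (.const 2)))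
        (.setN 8 (.const 0) (.const 0) (.add (.scalar 8) (.const 1))))))

lemma ensures_logCmd {m : Mem} (K ℓ : ℕ) (hK : m.N 6 0 0 = K)
    (hℓ : ∀ j, j < ℓ → 2 ^ j < 4 * (K * K)) (hℓ' : 4 * (K * K) ≤ 2 ^ ℓ) :
    Ensures O logCmd m (4 * ℓ + 5) fun m' => m'.N 8 0 0 = ℓ := by
  refine (Ensures.seq (T₁ := 1) (T₂ := 4 * ℓ + 3) (Ensures.setN
    (I := fun m₁ => m₁ = m.setN 16 0 0 1) rfl)
    fun m₁ h₁ _ => ?_).mono (by omega) fun _ h _ => h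
  refine (Ensures.seq (T₁ := 1) (T₂ := 4 * ℓ + 1) (Ensures.setN
    (I := fun m₂ => m₂ = m₁.setN 8 0 0 0) rfl) fun m₂ h₂ _ => ?_).mono (by omega) fun _ h _ => h
  refine (Ensures.loop_while (fun j m' => m'.N 16 0 0 = 2 ^ j ∧ m'.N 8 0 0 = j ∧ m'.N 6 0 0 = K) ℓ
    (fun _ => 3) (fun j hj m' h => ?_) (fun m' h => ?_) (fun j hj m' h => ?_) m₂ ?_).mono
    (by simp; omega) fun m' h _ => h.2.1
  · simpa [BExpr.eval, NExpr.eval, h.1, h.2.2] using hℓ j hj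
  · simpa [BExpr.eval, NExpr.eval, h.1, h.2.2] using hℓ'
  · refine Ensures.seq (T₁ := 1) (T₂ := 1) (Ensures.setN
      (I := fun m₃ => m₃ = m'.setN 16 0 0 (2 ^ (j + 1))) ?_) fun m₃ h₃ _ => ?_
    · simp [NExpr.eval, h.1, pow_succ]
    · refine Ensures.setN ?_
      simp [h₃, Mem.setN, NExpr.eval, h.2]
  · simp [h₂, h₁, Mem.setN, hK]

/-- Gradient descent on the vector `7`. -/
def descentCmd : Cmd :=
  .seq (.setN 15 (.const 0) (.const 0) (.const 0))
    (.loop (.ltN (.mul (.scalar 15) (.scalar 0)) (.mul (.scalar 7) (.scalar 6)))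
      (.seq (.fill 12 7 (.scalar 1)
        (.sub (.entry 7 (.scalar 12)) (.div (.entry 8 (.scalar 12)) (.scalar 14))))
      (.seq gradientCmd (.setN 15 (.const 0) (.const 0) (.add (.scalar 15) (.const 1))))))

/-- The guard `j * n < S * K` encodes `G = ⌈S K / n⌉` without division. A gradient costs `O(n s(A) +
d)`, so the phase stays within the order of `S K s(A)` when `d ≤ n`. -/
lemma ensures_descentCmd {m : Mem} (hA : HoldsMatrix A m) (S K G : ℕ) (hS : m.N 7 0 0 = S)
    (hK : m.N 6 0 0 = K) (hG : ∀ j, j < G → j * n < S * K) (hG' : S * K ≤ G * n)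
    (hq : vec d 8 m = gradient A ψ (vec d 7 m)) :
    Ensures (oracle ψ) descentCmd m (G * (n * (8 * rowSparsity A + 16) + 8 * d + 14) + 3) fun m' =>
      vec d 7 m' = (gdStep A ψ (m.R 14 0 0))^[G] (vec d 7 m) ∧
      vec d 8 m' = gradient A ψ ((gdStep A ψ (m.R 14 0 0))^[G] (vec d 7 m)) := by
  refine (Ensures.seq (T₁ := 1) (T₂ := G * (n * (8 * rowSparsity A + 16) + 8 * d + 14) + 1)
    (Ensures.setN (I := fun m₁ => m₁ = m.setN 15 0 0 0) rfl)
    fun m₁ h₁ hf₁ => ?_).mono (by omega) fun _ h _ => h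
  refine (Ensures.loop_while (fun j m' => Frame [10, 11, 12, 15] [7, 8, 9, 12, 13] m m' ∧
    m'.N 15 0 0 = j ∧ vec d 7 m' = (gdStep A ψ (m.R 14 0 0))^[j] (vec d 7 m) ∧
      vec d 8 m' = gradient A ψ ((gdStep A ψ (m.R 14 0 0))^[j] (vec d 7 m))) G
    (fun _ => n * (8 * rowSparsity A + 16) + 8 * d + 13) (fun j hj m' h => ?_) (fun m' h => ?_)
    (fun j hj m' h => ?_) m₁ ?_).mono (by simp) fun m' h _ => h.2.2
  · simpa [BExpr.eval, NExpr.eval, h.2.1, h.1.1 0 (by decide), h.1.1 7 (by decide),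
      h.1.1 6 (by decide), hS, hK, hA.rows] using hG j hj
  · simpa [BExpr.eval, NExpr.eval, h.2.1, h.1.1 0 (by decide), h.1.1 7 (by decide),
      h.1.1 6 (by decide), hS, hK, hA.rows] using hG'
  · obtain ⟨hf, h15, h7, h8⟩ := h
    have hA' := hA.frame hf (by decide) (by decide)
    have hfill : Ensures (oracle ψ) (.fill 12 7 (.scalar 1)
        (.sub (.entry 7 (.scalar 12)) (.div (.entry 8 (.scalar 12)) (.scalar 14)))) m' (4 * d + 3)
        fun m'' => ∀ j, j < d → m''.R 7 j 0 = m'.R 7 j 0 - m'.R 8 j 0 / m.R 14 0 0 :=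
      ensures_fill d _
        (fun m' h => by simp [(hA'.frame h (by decide) (by decide)).cols])
        (fun j hj m' h hv h7 => by
          simp [RExpr.eval, hv, h.2 8 (by decide), h.2 14 (by decide), h7, hf.2 14 (by decide)])
    refine (hfill.seq (T₂ := n * (8 * rowSparsity A + 16) + 4 * d + 9) fun m₂ h₂ hf₂ => ?_).mono
      (by omega) fun _ h _ => h
    have hA₂ := hA'.frame hf₂ (by decide) (by decide)
    have h7₂ : vec d 7 m₂ = (gdStep A ψ (m.R 14 0 0))^[j + 1] (vec d 7 m) := by
      rw [Function.iterate_succ_apply', gdStep, ← h8, ← h7]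
      funext i
      rw [vec, h₂ i i.2]
      simp [vec, div_eq_inv_mul]
    refine ((ensures_gradientCmd hA₂).seq (T₂ := 1) fun m₃ h₃ hf₃ => ?_).mono
      (by omega) fun _ h _ => h
    refine Ensures.setN ?_
    have e15 : m₃.N 15 0 0 = j := by rw [hf₃.1 15 (by decide), hf₂.1 15 (by decide), h15]
    simp only [NExpr.eval, NExpr.eval_scalar, e15]
    refine ⟨(hf.trans ((hf₂.mono (by decide) (by decide)).trans
      (hf₃.mono (by decide) (by decide)))).trans (frame_setN (by simp)), by simp [Mem.setN], ?_, ?_⟩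
    · rw [← h7₂]
      funext i
      simp only [vec, Mem.setN]
      rw [hf₃.2 7 (by decide)]
    · rw [← h7₂, ← h₃.2]
      rfl
  · rw [h₁]
    exact ⟨frame_setN (by simp), by simp [Mem.setN], rfl, hq⟩

/-- Everything up to the test on the gradient norm. -/
def prepareCmd (c : ℕ) : Cmd :=
  .seq (.fill 12 7 (.scalar 1) (.entry 1 (.scalar 12)))
  (.seq tableCmd
  (.seq (countCmd c)
  (.seq gradientCmd
  (.seq (sqNorm 8 15)
  (.seq descentCmd (sqNorm 8 16))))))

lemma ensures_prepareCmd {m : Mem} (h : HoldsInput A M L lam x₀ ε m) {L' : Fin n → ℝ}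
    (hL' : L' = fun i => min (L i) M) {K : ℕ} (hK : K = ∑ i, multiplicity A L' lam i) (c S G : ℕ)
    (hS : ∀ j, j < S → ε / n ^ c * (4 / 3) ^ j < 1) (hS' : 1 ≤ ε / n ^ c * (4 / 3) ^ S)
    (hG : ∀ j, j < G → j * n < S * K) (hG' : S * K ≤ G * n) :
    Ensures (oracle ψ) (prepareCmd c) m
      ((G + 2) * (n * (8 * rowSparsity A + 19) + 8 * d + 14) + 6 * K + 4 * S + 24) fun m' =>
        HoldsTable A lam (multiplicity A L' lam) m' ∧ m'.R 14 0 0 = smoothness A L' ∧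
        m'.N 7 0 0 = S ∧ m'.R 6 0 0 = ε ∧
        vec d 7 m' = (gdStep A ψ (smoothness A L'))^[G] x₀ ∧
        m'.R 15 0 0 = gradient A ψ x₀ ⬝ᵥ gradient A ψ x₀ ∧
        m'.R 16 0 0 = gradient A ψ ((gdStep A ψ (smoothness A L'))^[G] x₀) ⬝ᵥ
          gradient A ψ ((gdStep A ψ (smoothness A L'))^[G] x₀) := by
  have hfill : Ensures (oracle ψ) (.fill 12 7 (.scalar 1) (.entry 1 (.scalar 12))) m (4 * d + 3)
      fun m' => ∀ j, j < d → m'.R 7 j 0 = m.R 1 j 0 :=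
    ensures_fill d _ (fun m' h' => by simp [(h.frame h' (by decide) (by decide)).matrix.cols])
      (fun j hj m' h hv _ => by simp [hv, h.2 1 (by decide)])
  obtain ⟨g, hg⟩ : ∃ g, g = n * (8 * rowSparsity A + 16) := ⟨_, rfl⟩
  obtain ⟨t, ht⟩ : ∃ t, t = n * (4 * rowSparsity A + 19) := ⟨_, rfl⟩
  have htime : (4 * d + 3) + (t + 6 * K + 7) + (4 * S + 5) + (g + 4 * d + 7) + (4 * d + 5) +
      (G * (g + 8 * d + 14) + 3) + (4 * d + 5) + 6
      ≤ (G + 2) * (n * (8 * rowSparsity A + 19) + 8 * d + 14) + 6 * K + 4 * S + 24 := by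
    have e1 : t ≤ n * (8 * rowSparsity A + 19) := by
      rw [ht]
      gcongr
      omega
    have e2 : g ≤ n * (8 * rowSparsity A + 19) := by
      rw [hg]
      gcongr
      omega
    have e3 : G * (g + 8 * d + 14) ≤ G * (n * (8 * rowSparsity A + 19) + 8 * d + 14) := by
      gcongr
    rw [add_mul]
    omega
  refine Ensures.mono (T := (4 * d + 3) + ((t + 6 * K + 7) + ((4 * S + 5) + ((g + 4 * d + 7) +
    ((4 * d + 5) + ((G * (g + 8 * d + 14) + 3) + (4 * d + 5) + 1) + 1) + 1) + 1) + 1) + 1)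
    (hfill.seq fun m₁ h₁ hf₁ => ?_) (by omega) fun _ h _ => h
  have hI₁ := h.frame hf₁ (by decide) (by decide)
  have htab := ensures_tableCmd (O := oracle ψ) hI₁
  rw [← hL', ← hK, ← ht] at htab
  refine htab.seq fun m₂ h₂ hf₂ => ?_
  have hI₂ := hI₁.frame hf₂ (by decide) (by decide)
  refine (ensures_countCmd hI₂ c S hS hS').seq fun m₃ h₃ hf₃ => ?_
  have hI₃ := hI₂.frame hf₃ (by simp [countCmd, Cmd.writesN]) (by simp [countCmd, Cmd.writesR])
  have hT₃ := h₂.1.frame hf₃ (by simp [countCmd, Cmd.writesN]) (by simp [countCmd, Cmd.writesR])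
  have hx₃ : vec d 7 m₃ = x₀ := by
    rw [← h.start]
    funext j
    rw [vec, hf₃.2 7 (by simp [countCmd, Cmd.writesR]), hf₂.2 7 (by decide), h₁ j j.2, vec]
  have e14₃ : m₃.R 14 0 0 = smoothness A L' := by
    rw [hf₃.2 14 (by simp [countCmd, Cmd.writesR]), h₂.2]
  have hgrad := ensures_gradientCmd (ψ := ψ) hI₃.matrix
  rw [← hg] at hgrad
  refine hgrad.seq fun m₄ h₄ hf₄ => ?_
  have hT₄ := hT₃.frame hf₄ (by decide) (by decide)
  have hI₄ := hI₃.frame hf₄ (by decide) (by decide)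
  rw [hx₃] at h₄
  refine (ensures_sqNorm hT₄.matrix (by norm_num) (by norm_num)).seq fun m₅ h₅ hf₅ => ?_
  have hT₅ := hT₄.frame hf₅ (by decide) (by decide)
  have hI₅ := hI₄.frame hf₅ (by decide) (by decide)
  have hx₅ : vec d 7 m₅ = x₀ := by
    rw [← hx₃]
    funext j
    rw [vec, hf₅.2 7 (by decide), hf₄.2 7 (by decide), vec]
  have h8₅ : vec d 8 m₅ = gradient A ψ x₀ := by
    rw [← h₄.2]
    funext j
    rw [vec, hf₅.2 8 (by decide), vec]
  have e14₅ : m₅.R 14 0 0 = smoothness A L' := by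
    rw [hf₅.2 14 (by decide), hf₄.2 14 (by decide), e14₃]
  have e7₅ : m₅.N 7 0 0 = S := by
    rw [hf₅.1 7 (by decide), hf₄.1 7 (by decide), h₃]
  have hdes := ensures_descentCmd hT₅.matrix S K G e7₅ (hT₅.size.trans hK.symm) hG hG'
    (by rw [h8₅, hx₅])
  rw [← hg, hx₅, e14₅] at hdes
  refine hdes.seq fun m₆ h₆ hf₆ => ?_
  have hT₆ := hT₅.frame hf₆ (by decide) (by decide)
  have hI₆ := hI₅.frame hf₆ (by decide) (by decide)
  refine (ensures_sqNorm hT₆.matrix (by norm_num) (by norm_num)).mono le_rfl fun m₇ h₇ hf₇ => ?_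
  have hT₇ := hT₆.frame hf₇ (by decide) (by decide)
  have hI₇ := hI₆.frame hf₇ (by decide) (by decide)
  refine ⟨hT₇, ?_, ?_, hI₇.eps, ?_, ?_, ?_⟩
  · rw [hf₇.2 14 (by decide), hf₆.2 14 (by decide), e14₅]
  · rw [hf₇.1 7 (by decide), hf₆.1 7 (by decide), e7₅]
  · rw [← h₆.1]
    funext j
    rw [vec, hf₇.2 7 (by decide), vec]
  · rw [hf₇.2 15 (by decide), hf₆.2 15 (by decide), h₅, h₄.2]
  · rw [h₇, h₆.2]

end program

/-! ### The condition number -/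

section spectrum

variable {n d : ℕ} (A : Matrix (Fin n) (Fin d) ℝ)

lemma dotProduct_gram (v w : Fin d → ℝ) :
    v ⬝ᵥ ((A.conjTranspose * A).mulVec w) = ∑ i, (A i ⬝ᵥ v) * (A i ⬝ᵥ w) := by
  rw [← Matrix.mulVec_mulVec, Matrix.dotProduct_mulVec, Matrix.vecMul_conjTranspose]
  simp only [star_trivial]
  rfl

lemma eigenvector_dotProduct (j : Fin d) (v : Fin d → ℝ) :
    ∑ i, (A i ⬝ᵥ v) * (A i ⬝ᵥ ((Matrix.isHermitian_conjTranspose_mul_self A).eigenvectorBasis j))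
      = gramEigenvalues A j *
        (v ⬝ᵥ ((Matrix.isHermitian_conjTranspose_mul_self A).eigenvectorBasis j)) := by
  rw [← dotProduct_gram, Matrix.IsHermitian.mulVec_eigenvectorBasis, dotProduct_smul, smul_eq_mul]
  rfl

lemma eigenvectorBasis_dotProduct_self (j : Fin d) :
    (((Matrix.isHermitian_conjTranspose_mul_self A).eigenvectorBasis j : EuclideanSpace ℝ (Fin d)) :
      Fin d → ℝ) ⬝ᵥ ((Matrix.isHermitian_conjTranspose_mul_self A).eigenvectorBasis j) = 1 := by
  have h := (Matrix.isHermitian_conjTranspose_mul_self A).eigenvectorBasis.orthonormal.1 j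
  have h2 := EuclideanSpace.real_norm_sq_eq
    ((Matrix.isHermitian_conjTranspose_mul_self A).eigenvectorBasis j)
  rw [h] at h2
  simp only [dotProduct, ← pow_two]
  linarith

lemma sum_dotProduct_eigenvectorBasis (v w : Fin d → ℝ) :
    ∑ j, (v ⬝ᵥ ((Matrix.isHermitian_conjTranspose_mul_self A).eigenvectorBasis j)) *
      (w ⬝ᵥ ((Matrix.isHermitian_conjTranspose_mul_self A).eigenvectorBasis j)) = v ⬝ᵥ w := by
  have h := (Matrix.isHermitian_conjTranspose_mul_self A).eigenvectorBasis.sum_inner_mul_inner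
    (WithLp.toLp 2 v) (WithLp.toLp 2 w)
  simp only [EuclideanSpace.inner_eq_star_dotProduct, star_trivial] at h
  rw [dotProduct_comm v w, ← h]
  refine Finset.sum_congr rfl fun j _ => ?_
  rw [dotProduct_comm v]

lemma le_gramEigenvalues {a : ℝ} (h : ∀ v : Fin d → ℝ, a * (v ⬝ᵥ v) ≤ ∑ i, (A i ⬝ᵥ v) ^ 2)
    (j : Fin d) : a ≤ gramEigenvalues A j := by
  have h1 := h ((Matrix.isHermitian_conjTranspose_mul_self A).eigenvectorBasis j)
  have h2 := eigenvector_dotProduct A j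
    ((Matrix.isHermitian_conjTranspose_mul_self A).eigenvectorBasis j)
  rw [eigenvectorBasis_dotProduct_self] at h1 h2
  simp only [pow_two] at h1
  linarith

/-- Expand both quadratic forms in the orthonormal eigenbasis of `Aᵀ A` and compare termwise. -/
lemma iInf_gramEigenvalues_mul_le (v : Fin d → ℝ) :
    (⨅ j, gramEigenvalues A j) * (v ⬝ᵥ v) ≤ ∑ i, (A i ⬝ᵥ v) ^ 2 := by
  have h : ∑ i, (A i ⬝ᵥ v) ^ 2 = ∑ j, gramEigenvalues A j *
      (v ⬝ᵥ ((Matrix.isHermitian_conjTranspose_mul_self A).eigenvectorBasis j)) ^ 2 := by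
    simp only [pow_two]
    rw [← dotProduct_gram, ← sum_dotProduct_eigenvectorBasis A]
    refine Finset.sum_congr rfl fun j _ => ?_
    rw [dotProduct_comm ((A.conjTranspose * A).mulVec v), dotProduct_gram]
    simp only [mul_comm (A _ ⬝ᵥ ((Matrix.isHermitian_conjTranspose_mul_self A).eigenvectorBasis j : EuclideanSpace ℝ (Fin d)).ofLp)]
    rw [eigenvector_dotProduct]
    ring
  rw [h, ← sum_dotProduct_eigenvectorBasis A v v, Finset.mul_sum]
  refine Finset.sum_le_sum fun j _ => ?_
  rw [← pow_two]
  exact mul_le_mul_of_nonneg_right (ciInf_le (Set.finite_range _).bddBelow j) (sq_nonneg _)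

/-- The left side is the trace of `Aᵀ A`, hence the sum of its `d` eigenvalues. -/
lemma sum_dotProduct_self_le : ∑ i, A i ⬝ᵥ A i ≤ d * ⨆ j, gramEigenvalues A j := by
  have h : ∑ i, A i ⬝ᵥ A i = ∑ j, gramEigenvalues A j := by
    have h1 := (Matrix.isHermitian_conjTranspose_mul_self A).trace_eq_sum_eigenvalues
    simp only [RCLike.ofReal_real_eq_id, id] at h1
    rw [gramEigenvalues, ← h1, Matrix.trace_mul_comm]
    simp [Matrix.trace, Matrix.mul_apply, dotProduct]
  rw [h]
  calc ∑ j, gramEigenvalues A j ≤ ∑ _j : Fin d, ⨆ j, gramEigenvalues A j :=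
        Finset.sum_le_sum fun j _ => le_ciSup (Set.finite_range _).bddAbove j
    _ = _ := by simp

/-- Positive definiteness of `Aᵀ A` makes `A` injective. The inequality `d ≤ n` absorbs all dense
vector operations into the cost of a pass over the rows. -/
lemma le_of_forall_mul_le {a : ℝ} (ha : 0 < a)
    (h : ∀ v : Fin d → ℝ, a * (v ⬝ᵥ v) ≤ ∑ i, (A i ⬝ᵥ v) ^ 2) : d ≤ n := by
  have hinj : Function.Injective A.mulVecLin := by
    rw [← LinearMap.ker_eq_bot, LinearMap.ker_eq_bot']
    intro v hv
    have h0 : ∀ i, A i ⬝ᵥ v = 0 := fun i => congrFun hv i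
    have h1 := h v
    simp only [h0] at h1
    have h2 := dotProduct_self_nonneg' v
    have h3 : v ⬝ᵥ v = 0 := by
      simp only [ne_eq, OfNat.ofNat_ne_zero, not_false_eq_true, zero_pow,
        Finset.sum_const_zero] at h1
      nlinarith
    exact dotProduct_self_eq_zero.mp h3
  simpa using LinearMap.finrank_le_finrank_of_injective hinj

end spectrum

/-! ### Choice and size of the parameters. -/

section parameters

variable {n d : ℕ} {A : Matrix (Fin n) (Fin d) ℝ} {ψ : Fin n → ℝ → ℝ} {M lam ε : ℝ}
  {μ L : Fin n → ℝ} {x₀ : Fin d → ℝ}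

lemma rowNorm_sq (A : Matrix (Fin n) (Fin d) ℝ) (i : Fin n) : rowNorm A i ^ 2 = A i ⬝ᵥ A i := by
  rw [rowNorm, EuclideanSpace.real_norm_sq_eq]
  simp [dotProduct, pow_two]

/-- Gradient descent passes the test on the gradient norm if the table is large. -/
lemma gradient_test_of_large [NeZero d] (hψ : ∀ i, SecondDerivIn (ψ i) (μ i) (L i))
    (hL : ∀ i, 0 ≤ L i) (hR : 0 < smoothness A L) (hlam : 0 < lam) (hε : 0 < ε) {lam' Q : ℝ}
    (hlam' : 0 < lam') (hs' : StronglyCvx A ψ lam') (hn : 0 < n) (hQ1 : 1 ≤ Q)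
    (hQ : smoothness A L / lam' ≤ Q)
    {K S G : ℕ} (hRK : smoothness A L + lam ≤ (K : ℝ) ^ 2 * lam) (hS1 : 1 ≤ S)
    (hS : (3 / 4 : ℝ) ^ S ≤ ε) (hG : S * K ≤ G * n) (hK : 36 * n ^ 2 * Q ^ 2 ≤ K) :
    smoothness A L / lam * (gradient A ψ ((gdStep A ψ (smoothness A L))^[G] x₀) ⬝ᵥ
      gradient A ψ ((gdStep A ψ (smoothness A L))^[G] x₀))
        ≤ ε * (gradient A ψ x₀ ⬝ᵥ gradient A ψ x₀) := by
  set R := smoothness A L with hRd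
  set x := (gdStep A ψ R)^[G] x₀ with hx
  have hn' : (1 : ℝ) ≤ n := by exact_mod_cast hn
  have h1 := sq_gradient_le_gap hψ hL hR hlam' hs' x
  have h2 := gap_gdStep_iterate_le hψ hL hR hlam' hs' x₀ G
  have h3 := gap_le_sq_gradient (fun i => (hψ i).1) hlam' hs' x₀
  have hg0 := gap_nonneg (fun i => (hψ i).1) hlam' hs' x₀
  rw [← hRd, ← hx] at h2
  rw [← hRd] at h1
  have hle := hs'.le_smoothness hψ hL
  have hK0 : (0 : ℝ) < K := lt_of_lt_of_le (by positivity) hK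
  -- the exponent
  obtain ⟨y, hy⟩ : ∃ y, y = K / (n * Q) := ⟨_, rfl⟩
  have hy0 : 0 < y := by rw [hy]; positivity
  have hKy : (K : ℝ) = n * Q * y := by rw [hy]; field_simp
  have hy36 : 36 * (n * Q) ≤ y := by
    rw [hKy] at hK
    have : n * Q * (36 * (n * Q)) ≤ n * Q * y := by nlinarith
    exact le_of_mul_le_mul_left this (by positivity)
  -- From `y = K / (n Q) ≥ 36 n Q` follows `y² ≥ 36 K`. The degree-six term of the exponential
  -- series then gives a multiple of `K³`, and `Q ≤ K`.
  have hexp : 4 / 3 * ((K : ℝ) ^ 2 * Q) ≤ Real.exp y := by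
    have e1 : (36 : ℝ) * K ≤ y ^ 2 := by
      rw [hKy]
      nlinarith
    have e2 : Q ≤ K := by
      have h1 : Q ≤ Q ^ 2 := by nlinarith
      have h2 : Q ^ 2 ≤ (n : ℝ) ^ 2 * Q ^ 2 := le_mul_of_one_le_left (by positivity)
        (one_le_pow₀ hn')
      have h3 : 0 ≤ (n : ℝ) ^ 2 * Q ^ 2 := by positivity
      linarith
    have e3 : (36 * (K : ℝ)) ^ 3 ≤ (y ^ 2) ^ 3 := by gcongr
    have e4 : y ^ 6 / (Nat.factorial 6 : ℝ) ≤ Real.exp y := Real.pow_div_factorial_le_exp y hy0.le 6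
    have e5 : (K : ℝ) ^ 2 * Q ≤ (K : ℝ) ^ 2 * K := by gcongr
    have e6 : ((Nat.factorial 6 : ℕ) : ℝ) = 720 := by norm_num [Nat.factorial]
    rw [e6] at e4
    nlinarith
  -- `G ≥ S K / n` gives `G / Q ≥ S y`. One factor `(3 / 4) ^ S` yields `ε`; of the powers of `1 /
  -- (K² Q)` a single one is kept, which is possible because `S ≥ 1`.
  have hpow : (1 - lam' / R) ^ G ≤ ε / ((K : ℝ) ^ 2 * Q) := by
    have e1 : 1 - lam' / R ≤ Real.exp (-(1 / Q)) := by
      have : 1 / Q ≤ lam' / R := by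
        rw [div_le_iff₀ hlam'] at hQ
        rw [div_le_div_iff₀ (by positivity) hR]
        linarith
      linarith [Real.add_one_le_exp (-(1 / Q))]
    have e0 : 0 ≤ 1 - lam' / R := by
      rw [sub_nonneg, div_le_one hR]
      exact hle
    have hG' : (S : ℝ) * y ≤ G * (1 / Q) := by
      have : (S : ℝ) * K ≤ G * n := by exact_mod_cast hG
      rw [hy]
      rw [mul_one_div, ← mul_div_assoc, div_le_div_iff₀ (by positivity) (by positivity)]
      nlinarith
    have hD : 1 ≤ (K : ℝ) ^ 2 * Q := by
      have : (1 : ℝ) ≤ K := by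
        have : (0 : ℝ) < K := hK0
        exact_mod_cast this
      nlinarith [one_le_pow₀ this (n := 2)]
    calc (1 - lam' / R) ^ G ≤ Real.exp (-(1 / Q)) ^ G := pow_le_pow_left₀ e0 e1 G
      _ = Real.exp (-(G * (1 / Q))) := by rw [← Real.exp_nat_mul]; ring_nf
      _ ≤ Real.exp (-(S * y)) := Real.exp_le_exp.mpr (by linarith)
      _ = (Real.exp y)⁻¹ ^ S := by
        rw [← Real.exp_neg, ← Real.exp_nat_mul]
        ring_nf
      _ ≤ (4 / 3 * ((K : ℝ) ^ 2 * Q))⁻¹ ^ S := by gcongr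
      _ = (3 / 4) ^ S * (((K : ℝ) ^ 2 * Q)⁻¹) ^ S := by
        rw [← mul_pow]
        congr 1
        rw [mul_inv]
        norm_num
      _ ≤ ε * ((K : ℝ) ^ 2 * Q)⁻¹ := by
        refine mul_le_mul hS ?_ (by positivity) hε.le
        refine pow_le_of_le_one (by positivity) (inv_le_one_of_one_le₀ hD) (by omega)
      _ = _ := by rw [div_eq_mul_inv]
  have hRlam : R / lam ≤ (K : ℝ) ^ 2 := by
    rw [div_le_iff₀ hlam]
    linarith
  -- The factor `K²` pays for `R / lam`, which involves the possibly tiny given `lam`; the factor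
  -- `Q` converts `R` into `lam'`, so that the gradient at `x₀` can be bounded below.
  calc R / lam * (gradient A ψ x ⬝ᵥ gradient A ψ x)
      ≤ (K : ℝ) ^ 2 * (2 * R * (ε / ((K : ℝ) ^ 2 * Q) * gap A ψ x₀)) := by
        refine mul_le_mul hRlam (h1.trans ?_) (dotProduct_self_nonneg' _) (by positivity)
        refine mul_le_mul_of_nonneg_left (h2.trans ?_) (by positivity)
        exact mul_le_mul_of_nonneg_right hpow hg0
    _ = ε * (2 * (R / Q) * gap A ψ x₀) := by field_simp
    _ ≤ ε * (2 * lam' * gap A ψ x₀) := by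
        have : R / Q ≤ lam' := by
          rw [div_le_iff₀ hlam'] at hQ
          rw [div_le_iff₀ (by positivity)]
          linarith
        gcongr
    _ ≤ _ := mul_le_mul_of_nonneg_left h3 hε.le

lemma one_le_multiplicity (A : Matrix (Fin n) (Fin d) ℝ) (L : Fin n → ℝ) (lam : ℝ) (i : Fin n) :
    1 + √(L i * (A i ⬝ᵥ A i) / lam) ≤ multiplicity A L lam i :=
  Nat.le_ceil _

lemma one_le_multiplicity' (A : Matrix (Fin n) (Fin d) ℝ) (L : Fin n → ℝ) (lam : ℝ) (i : Fin n) :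
    1 ≤ multiplicity A L lam i := by
  have h1 := one_le_multiplicity A L lam i
  have h2 := Real.sqrt_nonneg (L i * (A i ⬝ᵥ A i) / lam)
  have : (1 : ℝ) ≤ multiplicity A L lam i := by linarith
  exact_mod_cast this

/-- Both `k - 1` and `k` are at least the square root, thanks to the summand `1` inside the ceiling.
-/
lemma le_multiplicity_mul (hlam : 0 < lam) (hL : ∀ i, 0 ≤ L i) (i : Fin n) :
    L i * (A i ⬝ᵥ A i) / lam ≤
      ((multiplicity A L lam i : ℝ) - 1) * multiplicity A L lam i := by
  have h1 := one_le_multiplicity A L lam i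
  have h0 : 0 ≤ L i * (A i ⬝ᵥ A i) / lam :=
    div_nonneg (mul_nonneg (hL i) (dotProduct_self_nonneg' _)) hlam.le
  have h2 := Real.sqrt_nonneg (L i * (A i ⬝ᵥ A i) / lam)
  have h3 := Real.sq_sqrt h0
  nlinarith

/-- `(1 + √t)² ≥ 1 + t` leaves a surplus of `1` for each row, and one such surplus covers the extra
`lam`. -/
lemma smoothness_add_le (hlam : 0 < lam) (hL : ∀ i, 0 ≤ L i) (hn : 0 < n) :
    smoothness A L + lam ≤ ((∑ i, multiplicity A L lam i : ℕ) : ℝ) ^ 2 * lam := by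
  have h1 : ∀ i, L i * (A i ⬝ᵥ A i) ≤ ((multiplicity A L lam i : ℝ) ^ 2 - 1) * lam := fun i => by
    have h1 := one_le_multiplicity A L lam i
    have h0 : 0 ≤ L i * (A i ⬝ᵥ A i) / lam :=
      div_nonneg (mul_nonneg (hL i) (dotProduct_self_nonneg' _)) hlam.le
    have h2 := Real.sqrt_nonneg (L i * (A i ⬝ᵥ A i) / lam)
    have h3 := Real.sq_sqrt h0
    rw [← div_le_iff₀ hlam]
    nlinarith
  have h2 : smoothness A L ≤ (∑ i, (multiplicity A L lam i : ℝ) ^ 2 - n) * lam := by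
    refine (Finset.sum_le_sum fun i _ => h1 i).trans_eq ?_
    rw [← Finset.sum_mul, Finset.sum_sub_distrib]
    simp
  have h3 : ∑ i, (multiplicity A L lam i : ℝ) ^ 2
      ≤ ((∑ i, multiplicity A L lam i : ℕ) : ℝ) ^ 2 := by
    push_cast
    exact Finset.sum_sq_le_sq_sum_of_nonneg fun i _ => Nat.cast_nonneg _
  have hn' : (1 : ℝ) ≤ n := by exact_mod_cast hn
  nlinarith

lemma card_le_sum_multiplicity (A : Matrix (Fin n) (Fin d) ℝ) (L : Fin n → ℝ) (lam : ℝ) :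
    n ≤ ∑ i, multiplicity A L lam i := by
  calc n = ∑ _i : Fin n, 1 := by simp
    _ ≤ _ := Finset.sum_le_sum fun i _ => one_le_multiplicity' A L lam i

/-- Each ceiling is below `2 + √·`, and the `2` is charged to `√(L i / μ i) ≥ 1`. This is how the
first sum of the time bound is used. -/
lemma sum_multiplicity_le {L' : Fin n → ℝ} (hL'0 : ∀ i, 0 ≤ L' i) (hL' : ∀ i, L' i ≤ L i)
    (hμ : ∀ i, 0 < μ i) (hμL : ∀ i, μ i ≤ L i) (hlam : 0 < lam) :
    ((∑ i, multiplicity A L' lam i : ℕ) : ℝ) ≤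
      2 * (∑ i, √(L i / μ i) + ∑ i, rowNorm A i * √(L i / lam)) := by
  push_cast
  rw [← Finset.sum_add_distrib, Finset.mul_sum]
  refine Finset.sum_le_sum fun i _ => ?_
  have hx := dotProduct_self_nonneg' (A i)
  have h1 : (multiplicity A L' lam i : ℝ) < 1 + √(L' i * (A i ⬝ᵥ A i) / lam) + 1 :=
    Nat.ceil_lt_add_one (by positivity)
  have h2 : 1 ≤ √(L i / μ i) := by
    rw [Real.one_le_sqrt, one_le_div (hμ i)]
    exact hμL i
  have h3 : √(L' i * (A i ⬝ᵥ A i) / lam) ≤ rowNorm A i * √(L i / lam) := by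
    have hr : 0 ≤ rowNorm A i := norm_nonneg _
    refine Real.sqrt_le_iff.mpr ⟨by positivity, ?_⟩
    have h0 : 0 ≤ L i := (hL'0 i).trans (hL' i)
    rw [mul_pow, rowNorm_sq, Real.sq_sqrt (by positivity), mul_comm (L' i), mul_div_assoc]
    gcongr
    exact hL' i
  have h4 : 0 ≤ rowNorm A i * √(L i / lam) := mul_nonneg (norm_nonneg _) (Real.sqrt_nonneg _)
  linarith

/-- The least admissible `S`. The factor `4` comes from `log (4 / 3) ≥ 1 / 4`, and `S ≥ 1` because
`ε / n ^ c < 1`. -/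
lemma exists_stage_count {ε : ℝ} (hε : 0 < ε) (hε2 : ε ≤ 1 / 2) {n : ℕ} (hn : 0 < n) (c : ℕ) :
    ∃ S : ℕ, 1 ≤ S ∧ (∀ j, j < S → ε / n ^ c * (4 / 3) ^ j < 1) ∧ 1 ≤ ε / n ^ c * (4 / 3) ^ S ∧
      (3 / 4 : ℝ) ^ S ≤ ε / n ^ c ∧
      (S : ℝ) ≤ 1 + 4 * (c * Real.log n + Real.log (1 / ε)) := by
  have hn' : (1 : ℝ) ≤ n := by exact_mod_cast hn
  have hnc : (1 : ℝ) ≤ (n : ℝ) ^ c := one_le_pow₀ hn'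
  have hr : 0 < ε / n ^ c := by positivity
  have hex : ∃ S : ℕ, 1 ≤ ε / n ^ c * (4 / 3) ^ S := by
    obtain ⟨S, hS⟩ := pow_unbounded_of_one_lt (1 / (ε / n ^ c)) (show (1 : ℝ) < 4 / 3 by norm_num)
    refine ⟨S, ?_⟩
    rw [div_lt_iff₀ hr] at hS
    linarith
  classical
  refine ⟨Nat.find hex, ?_, fun j hj => not_le.mp (Nat.find_min hex hj), Nat.find_spec hex, ?_, ?_⟩
  · rw [Nat.one_le_iff_ne_zero]
    intro h0
    have := Nat.find_spec hex
    rw [h0, pow_zero, mul_one, le_div_iff₀ (by positivity)] at this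
    linarith
  · have := Nat.find_spec hex
    have h43 : (3 / 4 : ℝ) ^ Nat.find hex * (4 / 3) ^ Nat.find hex = 1 := by
      rw [← mul_pow]
      norm_num
    have h0 : (0 : ℝ) < (4 / 3) ^ Nat.find hex := by positivity
    nlinarith
  · rcases Nat.eq_zero_or_pos (Nat.find hex) with h0 | hpos
    · rw [h0]
      have h1 : 0 ≤ Real.log n := Real.log_nonneg hn'
      have h2 : 0 ≤ Real.log (1 / ε) := Real.log_nonneg (by
        rw [le_div_iff₀ hε]
        linarith)
      push_cast
      positivity
    · obtain ⟨S, hS⟩ : ∃ S, Nat.find hex = S + 1 := ⟨_, (Nat.succ_pred_eq_of_pos hpos).symm⟩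
      have hlt := not_le.mp (Nat.find_min hex (show S < Nat.find hex by omega))
      have hlog := Real.log_lt_log (by positivity) hlt
      rw [Real.log_mul hr.ne' (by positivity), Real.log_div hε.ne' (by positivity), Real.log_pow,
        Real.log_pow, Real.log_one] at hlog
      have h43 : (1 / 4 : ℝ) ≤ Real.log (4 / 3) := by
        have := Real.one_sub_inv_le_log_of_pos (show (0 : ℝ) < 4 / 3 by norm_num)
        norm_num at this ⊢
        linarith
      rw [hS, one_div, Real.log_inv]
      push_cast
      have hS0 : (0 : ℝ) ≤ S := Nat.cast_nonneg _
      nlinarith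

lemma exists_doubling_count {K : ℕ} (hK : 1 ≤ K) :
    ∃ ℓ : ℕ, 1 ≤ ℓ ∧ (∀ j, j < ℓ → 2 ^ j < 4 * (K * K)) ∧ 4 * (K * K) ≤ 2 ^ ℓ ∧
      (ℓ : ℝ) ≤ 1 + 2 * Real.log (4 * (K * K)) := by
  have hex : ∃ ℓ : ℕ, 4 * (K * K) ≤ 2 ^ ℓ := ⟨_, Nat.lt_two_pow_self.le⟩
  have hpos : 1 ≤ Nat.find hex := by
    rw [Nat.one_le_iff_ne_zero]
    intro h0
    have := Nat.find_spec hex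
    rw [h0] at this
    nlinarith
  refine ⟨Nat.find hex, hpos, fun j hj => not_le.mp (Nat.find_min hex hj), Nat.find_spec hex, ?_⟩
  obtain ⟨l, hl⟩ : ∃ l, Nat.find hex = l + 1 := ⟨_, (Nat.succ_pred_eq_of_pos hpos).symm⟩
  have hlt := not_le.mp (Nat.find_min hex (show l < Nat.find hex by omega))
  have hlt' : (2 : ℝ) ^ l < 4 * (K * K) := by exact_mod_cast hlt
  have hlog := Real.log_lt_log (by positivity) hlt'
  rw [Real.log_pow] at hlog
  have h2 := Real.log_two_gt_d9
  have hl0 : (0 : ℝ) ≤ l := Nat.cast_nonneg _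
  rw [hl]
  push_cast
  nlinarith

lemma exists_descent_count {n : ℕ} (hn : 0 < n) (N : ℕ) :
    ∃ G : ℕ, (∀ j, j < G → j * n < N) ∧ N ≤ G * n ∧ G * n ≤ N + n := by
  have hex : ∃ G : ℕ, N ≤ G * n := ⟨N, Nat.le_mul_of_pos_right N hn⟩
  refine ⟨Nat.find hex, fun j hj => not_le.mp (Nat.find_min hex hj), Nat.find_spec hex, ?_⟩
  rcases Nat.eq_zero_or_pos (Nat.find hex) with h0 | hpos
  · rw [h0]
    omega
  · obtain ⟨l, hl⟩ : ∃ l, Nat.find hex = l + 1 := ⟨_, (Nat.succ_pred_eq_of_pos hpos).symm⟩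
    have hlt := not_le.mp (Nat.find_min hex (show l < Nat.find hex by omega))
    rw [hl, add_mul]
    omega

end parameters

/-! ### The program -/

section solver

variable {n d : ℕ} {A : Matrix (Fin n) (Fin d) ℝ} {ψ : Fin n → ℝ → ℝ} {M lam ε : ℝ}
  {μ L : Fin n → ℝ} {x₀ : Fin d → ℝ}

/-- The accelerated phase. -/
def accelCmd : Cmd := .seq logCmd (.forUp 13 (.scalar 7) stageCmd)

/-- The solver with failure probability `n ^ (-c)`. -/
def solver (c : ℕ) : Cmd :=
  .seq (prepareCmd c)
    (.cond (.not (.ltR (.mul (.scalar 6) (.scalar 15))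
      (.mul (.div (.scalar 14) (.scalar 5)) (.scalar 16)))) .skip accelCmd)

lemma spec_accelCmd {m : Mem} {k : Fin n → ℕ} (hψ : ∀ i, SecondDerivIn (ψ i) (μ i) (L i))
    (hμ : ∀ i, 0 ≤ μ i) (hL : ∀ i, 0 < L i) (hlam : 0 < lam) (hs : StronglyCvx A ψ lam)
    (hk1 : ∀ i, 1 ≤ k i) (hk : ∀ i, L i * (A i ⬝ᵥ A i) / lam ≤ ((k i : ℝ) - 1) * k i)
    {K : ℕ} (hK : K = ∑ i, k i)
    (hK2 : 2 ≤ K) (hRK : smoothness A L + lam ≤ (K : ℝ) ^ 2 * lam) {S ℓ : ℕ}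
    (hℓ : ∀ j, j < ℓ → 2 ^ j < 4 * (K * K)) (hℓ' : 4 * (K * K) ≤ 2 ^ ℓ)
    (hT : HoldsTable A lam k m) (hm : m.N 7 0 0 = S) :
    Spec (oracle ψ) accelCmd m
      (S * (K * ℓ * (12 * rowSparsity A + 28) + n * (8 * rowSparsity A + 16) + 12 * d + 24)
        + 4 * ℓ + 9) (fun _ => True) (fun m' => ENNReal.ofReal (gap A ψ (vec d 7 m')))
      (ENNReal.ofReal ((3 / 4) ^ S * gap A ψ (vec d 7 m))) := by
  subst hK
  refine ((ensures_logCmd _ ℓ hT.size hℓ hℓ').seq_spec (T₂ :=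
    S * ((∑ i, k i) * ℓ * (12 * rowSparsity A + 28) + n * (8 * rowSparsity A + 16) + 12 * d + 24)
        + 3) fun m₁ h₁ hf₁ => ?_).mono (by omega) (fun _ h _ => ⟨h, le_rfl⟩) le_rfl
  have hT₁ := hT.frame hf₁ (by decide) (by decide)
  have e7 : m₁.N 7 0 0 = S := by rw [hf₁.1 7 (by decide), hm]
  have hx : vec d 7 m₁ = vec d 7 m := by
    funext j
    rw [vec, hf₁.2 7 (by decide), vec]
  refine (Spec.forUp_contract (O := oracle ψ) (v := 13) (bound := .scalar 7) (body := stageCmd)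
    (fun m' => HoldsTable A lam k m' ∧ m'.N 8 0 0 = ℓ)
    (fun m' => ENNReal.ofReal (gap A ψ (vec d 7 m'))) (ENNReal.ofReal (3 / 4)) S
    ((∑ i, k i) * ℓ * (12 * rowSparsity A + 28) + n * (8 * rowSparsity A + 16) + 12 * d + 21)
    (m := m₁) (by decide) (fun m' h => by rw [NExpr.eval_scalar, h.1 7 (by decide), e7])
    (fun m' r h => ⟨h.1.setN (by norm_num), h.2⟩) (fun m' r => rfl) ⟨hT₁, h₁⟩
    fun m' _ h => ?_).mono le_rfl (fun _ _ _ => ⟨trivial, le_rfl⟩) ?_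
  · exact (spec_stageCmd hψ hμ hL hlam hs hk1 hk hK2 hRK (by rw [pow_two]; exact hℓ') h.1 h.2).mono
      le_rfl (fun m'' h' hf => ⟨⟨h', by rw [hf.1 8 (by decide), h.2]⟩, le_rfl⟩) le_rfl
  · rw [hx, ENNReal.ofReal_mul (by positivity), ENNReal.ofReal_pow (by norm_num)]

lemma Spec.const_mul {O : Oracle} {c : Cmd} {m : Mem} {T : ℕ} {I : Mem → Prop} {Φ : Mem → ℝ≥0∞}
    {b : ℝ≥0∞} (h : Spec O c m T I Φ b) (r : ℝ≥0∞) : Spec O c m T I (fun m' => r * Φ m') (r * b) := by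
  obtain ⟨ν, h₁, h₂, h₃⟩ := h
  refine ⟨ν, h₁, h₂, ?_⟩
  have e : ∀ m', ν m' * (r * Φ m') = r * (ν m' * Φ m') := fun m' => by ring
  simp only [e]
  rw [ENNReal.tsum_mul_left]
  gcongr

end solver

/-! ### Running time and correctness of the solver. -/

section correctness

variable {n d : ℕ} {A : Matrix (Fin n) (Fin d) ℝ} {ψ : Fin n → ℝ → ℝ} {M lam ε : ℝ}
  {μ L : Fin n → ℝ} {x₀ : Fin d → ℝ}

lemma prepare_time_le {n d s S K G : ℕ} (hd : d ≤ n) (hn : 1 ≤ n) (hs : 1 ≤ s) (hS : 1 ≤ S)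
    (hK : n ≤ K) (hG : G * n ≤ S * K + n) :
    (G + 2) * (n * (8 * s + 19) + 8 * d + 14) + 6 * K + 4 * S + 24 ≤ 230 * (S * K * s) := by
  have hK1 : 1 ≤ K := hn.trans hK
  have hns : n ≤ n * s := Nat.le_mul_of_pos_right n hs
  have h1 : n * (8 * s + 19) + 8 * d + 14 ≤ 49 * (n * s) := by
    have : n * (8 * s + 19) = 8 * (n * s) + 19 * n := by ring
    omega
  have hSK : K ≤ S * K := Nat.le_mul_of_pos_left K hS
  have hSK' : S ≤ S * K := Nat.le_mul_of_pos_right S hK1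
  have hSKs : S * K ≤ S * K * s := Nat.le_mul_of_pos_right _ hs
  have h2 : (G + 2) * n ≤ 4 * (S * K) := by
    rw [add_mul]
    omega
  have h3 : (G + 2) * (n * (8 * s + 19) + 8 * d + 14) ≤ 196 * (S * K * s) := by
    calc _ ≤ (G + 2) * (49 * (n * s)) := Nat.mul_le_mul_left _ h1
      _ = 49 * ((G + 2) * n * s) := by ring
      _ ≤ 49 * (4 * (S * K) * s) := by gcongr
      _ = _ := by ring
  omega

lemma accel_time_le {n d s S K ℓ : ℕ} (hd : d ≤ n) (hn : 1 ≤ n) (hs : 1 ≤ s) (hS : 1 ≤ S)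
    (hK : n ≤ K) (hℓ : 1 ≤ ℓ) :
    S * (K * ℓ * (12 * s + 28) + n * (8 * s + 16) + 12 * d + 24) + 4 * ℓ + 9
      ≤ 113 * (S * K * ℓ * s) := by
  have hns : n ≤ n * s := Nat.le_mul_of_pos_right n hs
  have hKs : n * s ≤ K * ℓ * s := by
    gcongr
    exact hK.trans (Nat.le_mul_of_pos_right K hℓ)
  have h1 : K * ℓ * (12 * s + 28) ≤ 40 * (K * ℓ * s) := by
    have : K * ℓ ≤ K * ℓ * s := Nat.le_mul_of_pos_right _ hs
    rw [mul_add]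
    have e : K * ℓ * (12 * s) = 12 * (K * ℓ * s) := by ring
    omega
  have h2 : n * (8 * s + 16) = 8 * (n * s) + 16 * n := by ring
  have h3 : S * (K * ℓ * (12 * s + 28) + n * (8 * s + 16) + 12 * d + 24)
      ≤ S * (100 * (K * ℓ * s)) := by
    refine Nat.mul_le_mul_left _ ?_
    omega
  have h4 : ℓ ≤ S * K * ℓ * s := by
    have e : S * K * ℓ * s = ℓ * (S * K * s) := by ring
    rw [e]
    refine Nat.le_mul_of_pos_right _ ?_
    have : 0 < K := by omega
    positivity
  have e : S * (100 * (K * ℓ * s)) = 100 * (S * K * ℓ * s) := by ring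
  omega

/-- The solver is correct, with an explicit running time. -/
lemma solver_correct [NeZero d] (hψ : ∀ i, SecondDerivIn (ψ i) (μ i) (min (L i) M))
    (hμ : ∀ i, 0 < μ i) (hlam : 0 < lam) (hs : StronglyCvx A ψ lam) (hε : 0 < ε)
    (hdn : d ≤ n) (hn2 : 2 ≤ n) (hsp : 1 ≤ rowSparsity A) {lam' Q : ℝ} (hlam' : 0 < lam')
    (hs' : StronglyCvx A ψ lam') (hQ1 : 1 ≤ Q)
    (hQ : smoothness A (fun i => min (L i) M) / lam' ≤ Q) (c : ℕ) {K S ℓ : ℕ}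
    (hKd : K = ∑ i, multiplicity A (fun i => min (L i) M) lam i) (hS1 : 1 ≤ S)
    (hS : ∀ j, j < S → ε / n ^ c * (4 / 3) ^ j < 1) (hS' : 1 ≤ ε / n ^ c * (4 / 3) ^ S)
    (hS'' : (3 / 4 : ℝ) ^ S ≤ ε / n ^ c) (hℓ1 : 1 ≤ ℓ)
    (hℓ : ∀ j, j < ℓ → 2 ^ j < 4 * (K * K)) (hℓ' : 4 * (K * K) ≤ 2 ^ ℓ) :
    ∃ T : ℕ, (T ≤ 400 * (S * K * rowSparsity A) ∨
        (T ≤ 400 * (S * K * ℓ * rowSparsity A) ∧ (K : ℝ) < 36 * n ^ 2 * Q ^ 2)) ∧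
      ENNReal.ofReal (1 - 1 / (n : ℝ) ^ c) ≤
        probHaltsWith (oracle ψ) (solver c) (inputMem A M μ L lam x₀ ε) T
          fun m => gap A ψ (output d m) ≤ ε * gap A ψ x₀ := by
  set L' : Fin n → ℝ := fun i => min (L i) M with hL'
  set R := smoothness A L' with hR
  have hn' : (1 : ℝ) ≤ n := by exact_mod_cast (by omega : 1 ≤ n)
  have hL'0 : ∀ i, 0 < L' i := fun i =>
    (hμ i).trans_le (((hψ i).2.2 0).1.trans ((hψ i).2.2 0).2)
  have hR0 : 0 < R := hlam.trans_le (hs.le_smoothness hψ fun i => (hL'0 i).le)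
  have hRK : R + lam ≤ (K : ℝ) ^ 2 * lam := by
    rw [hKd]
    exact smoothness_add_le hlam (fun i => (hL'0 i).le) (by omega)
  have hnK : n ≤ K := hKd ▸ card_le_sum_multiplicity A L' lam
  have hnc : (1 : ℝ) ≤ (n : ℝ) ^ c := one_le_pow₀ hn'
  obtain ⟨G, hG, hG', hG''⟩ := exists_descent_count (show 0 < n by omega) (S * K)
  have hprep := ensures_prepareCmd (ψ := ψ) (holdsInput_inputMem (A := A) (M := M) (L := L)
    (lam := lam) (x₀ := x₀) (ε := ε) μ) hL' hKd c S G hS hS' hG hG'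
  have hptime := prepare_time_le hdn (by omega) hsp hS1 hnK hG''
  set xG := (gdStep A ψ R)^[G] x₀ with hxG
  have hgap0 := gap_nonneg (fun i => (hψ i).1) hlam hs x₀
  -- The state after preparation is deterministic, so whether the test passes is a property of the
  -- data. If it passes, the output is certified with probability one.
  by_cases ht : R / lam * (gradient A ψ xG ⬝ᵥ gradient A ψ xG)
      ≤ ε * (gradient A ψ x₀ ⬝ᵥ gradient A ψ x₀)
  · have hgood := gap_le_of_gradient_test hψ (fun i => (hL'0 i).le) hR0 hlam hs hε x₀ xG ht
    refine ⟨_, Or.inl ?_, le_trans ?_ (Ensures.probHaltsWith (hprep.seq (T₂ := 2)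
      fun m h _ => Ensures.cond (T := 1) (fun _ => Ensures.skip ?_) fun hc => ?_))⟩
    · have : 1 ≤ S * K * rowSparsity A := by
        have : 0 < K := by omega
        exact Nat.succ_le_of_lt (by positivity)
      omega
    · refine ENNReal.ofReal_le_one.mpr ?_
      have : 0 ≤ 1 / (n : ℝ) ^ c := by positivity
      linarith
    · have hout : output d m = xG := h.2.2.2.2.1
      rw [hout]
      exact hgood
    · exfalso
      obtain ⟨hT, h14, -, h6, -, h15, h16⟩ := h
      simp only [BExpr.eval, RExpr.eval, RExpr.eval_scalar, h14, h6, h15, h16, hT.lam,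
        Bool.not_eq_false', decide_eq_true_eq] at hc
      linarith
  · have hKlt : (K : ℝ) < 36 * n ^ 2 * Q ^ 2 := by
      by_contra hK
      exact ht (gradient_test_of_large hψ (fun i => (hL'0 i).le) hR0 hlam hε hlam' hs' (by omega)
        hQ1 hQ hRK hS1 (hS''.trans (div_le_self hε.le hnc)) hG' (not_lt.mp hK))
    have hgapG : gap A ψ xG ≤ gap A ψ x₀ := by
      have h1 := gap_gdStep_iterate_le hψ (fun i => (hL'0 i).le) hR0 hlam hs x₀ G
      refine h1.trans (mul_le_of_le_one_left hgap0 (pow_le_one₀ ?_ ?_))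
      · rw [sub_nonneg, div_le_one hR0]
        exact hs.le_smoothness hψ fun i => (hL'0 i).le
      · have : 0 < lam / smoothness A L' := div_pos hlam hR0
        linarith
    -- Needed to divide by the initial gap in Markov's inequality. With zero gap the gradient at
    -- `xG` vanishes and the test would have passed.
    have hpos : 0 < gap A ψ x₀ := by
      refine hgap0.lt_of_ne fun h0 => ht ?_
      have h1 := sq_gradient_le_gap hψ (fun i => (hL'0 i).le) hR0 hlam hs xG
      rw [← h0] at hgapG
      have h2 : gradient A ψ xG ⬝ᵥ gradient A ψ xG ≤ 0 :=
        h1.trans (mul_nonpos_of_nonneg_of_nonpos (by positivity) hgapG)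
      have h3 := dotProduct_self_nonneg' (gradient A ψ x₀)
      have h4 : R / lam * (gradient A ψ xG ⬝ᵥ gradient A ψ xG) ≤ 0 :=
        mul_nonpos_of_nonneg_of_nonpos (by positivity) h2
      exact h4.trans (by positivity)
    have hatime := accel_time_le hdn (by omega) hsp hS1 hnK hℓ1
    have hspec : Spec (oracle ψ) (solver c) (inputMem A M μ L lam x₀ ε)
        ((G + 2) * (n * (8 * rowSparsity A + 19) + 8 * d + 14) + 6 * K + 4 * S + 24 +
          ((S * (K * ℓ * (12 * rowSparsity A + 28) + n * (8 * rowSparsity A + 16) + 12 * d + 24)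
        + 4 * ℓ + 9) + 1) + 1) (fun _ => True)
        (fun m' => ENNReal.ofReal (gap A ψ (vec d 7 m')))
        (ENNReal.ofReal ((3 / 4) ^ S * gap A ψ xG)) := by
      refine hprep.seq_spec fun m h _ => ?_
      obtain ⟨hT, h14, h7, h6, hx, h15, h16⟩ := h
      obtain ⟨ν, hex, hI, hb⟩ := spec_accelCmd hψ (fun i => (hμ i).le) hL'0 hlam hs
        (one_le_multiplicity' A L' lam) (le_multiplicity_mul hlam fun i => (hL'0 i).le) hKd
        (by omega) hRK hℓ hℓ' hT h7
      rw [hx] at hb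
      refine ⟨ν, .cond (fun hc => ?_) (fun _ => hex), hI, hb⟩
      exfalso
      simp only [BExpr.eval, RExpr.eval, RExpr.eval_scalar, h14, h6, h15, h16, hT.lam,
        Bool.not_eq_true', decide_eq_false_iff_not, not_lt] at hc
      exact ht hc
    -- Scaling the potential by `1 / (ε gap(x₀))` makes it at least `1` on failure, while its
    -- expectation is at most `n ^ (-c)`.
    refine ⟨_, Or.inr ⟨?_, hKlt⟩, le_trans ?_ (Spec.probHaltsWith
      (Spec.const_mul hspec (ENNReal.ofReal (1 / (ε * gap A ψ x₀)))) fun m' _ hbad => ?_)⟩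
    · have h1 : S * K * rowSparsity A ≤ S * K * ℓ * rowSparsity A :=
        Nat.mul_le_mul_right _ (Nat.le_mul_of_pos_right (S * K) hℓ1)
      have h2 : 1 ≤ S * K * rowSparsity A := by
        have : 0 < K := by omega
        exact Nat.succ_le_of_lt (by positivity)
      omega
    · rw [← ENNReal.ofReal_mul (by positivity), ← ENNReal.ofReal_one,
        ← ENNReal.ofReal_sub _ (by
          have := gap_nonneg (fun i => (hψ i).1) hlam hs xG
          positivity)]
      refine ENNReal.ofReal_le_ofReal (sub_le_sub_left ?_ _)
      calc 1 / (ε * gap A ψ x₀) * ((3 / 4) ^ S * gap A ψ xG)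
          ≤ 1 / (ε * gap A ψ x₀) * (ε / n ^ c * gap A ψ x₀) :=
            mul_le_mul_of_nonneg_left (mul_le_mul hS'' hgapG
              (gap_nonneg (fun i => (hψ i).1) hlam hs xG) (by positivity)) (by positivity)
        _ = 1 / (n : ℝ) ^ c := by field_simp
    · rw [← ENNReal.ofReal_mul (by positivity), ← ENNReal.ofReal_one]
      refine ENNReal.ofReal_le_ofReal ?_
      rw [one_div, ← div_eq_inv_mul, one_le_div (by positivity)]
      exact (not_le.mp hbad).le

lemma log_sq_le {K : ℕ} {X : ℝ} (hX : 1 ≤ X) (hK1 : 1 ≤ K) (hK : (K : ℝ) ≤ 36 * X ^ 4) :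
    Real.log (4 * (K * K)) ≤ 13 + 8 * Real.log X := by
  have hK' : (1 : ℝ) ≤ K := by exact_mod_cast hK1
  have h1 : (4 : ℝ) * (K * K) ≤ 2 ^ 13 * X ^ 8 := by
    have : (K : ℝ) * K ≤ (36 * X ^ 4) * (36 * X ^ 4) := by gcongr
    have h8 : 0 ≤ X ^ 8 := by positivity
    nlinarith
  have h2 := Real.log_le_log (by positivity) h1
  rw [Real.log_mul (x := 2 ^ 13) (by positivity) (by positivity), Real.log_pow,
    Real.log_pow] at h2
  have h3 := Real.log_two_lt_d9
  push_cast at h2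
  linarith

lemma one_le_rowSparsity (h : 0 < smoothness A L) : 1 ≤ rowSparsity A := by
  rw [Nat.one_le_iff_ne_zero]
  intro h0
  refine h.ne' (Finset.sum_eq_zero fun i _ => ?_)
  have hl := length_rowSupport_le A i
  rw [h0, Nat.le_zero] at hl
  rw [← sum_valArray_sq, hl]
  simp

end correctness

end ERM

/-! ### The main theorem: the running time in terms of the data. -/

theorem theorem18 (c : ℕ) :
    ∃ (P : RealRAM.Cmd) (C : ℝ) (k : ℕ),
      ∀ (n d : ℕ) (A : Matrix (Fin n) (Fin d) ℝ) (ψ : Fin n → ℝ → ℝ) (M : ℝ)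
        (μ L : Fin n → ℝ) (lam : ℝ) (x₀ : Fin d → ℝ) (ε : ℝ),
        0 < d →
        (∀ i, ERM.SecondDerivIn (ψ i) (1 / M) M) →
        (∀ i, 0 < μ i) →
        (∀ i, ERM.SecondDerivIn (ψ i) (μ i) (L i)) →
        0 < lam →
        ERM.HessianGE (ERM.objective A ψ) lam →
        0 < ε → ε ≤ 1 / 2 →
        ∃ T : ℕ,
          (T : ℝ) ≤ C * (1 + Real.log (n * d * ERM.condNumber A * M)) ^ k *
            ((∑ i, Real.sqrt (L i / μ i) + ∑ i, ERM.rowNorm A i * Real.sqrt (L i / lam)) *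
              ERM.rowSparsity A * Real.log (1 / ε)) ∧
          ENNReal.ofReal (1 - 1 / (n : ℝ) ^ c) ≤
            RealRAM.probHaltsWith (ERM.oracle ψ) P (ERM.inputMem A M μ L lam x₀ ε) T
              (fun m =>
                ERM.objective A ψ (ERM.output d m) - ⨅ x, ERM.objective A ψ x ≤
                  ε * (ERM.objective A ψ x₀ - ⨅ x, ERM.objective A ψ x)) := by
  -- With `g = 1 + log (n d κ M)`, one factor `g` comes from `S ≤ (6 + 8 c) log (1 / ε) g` and the
  -- other from `ℓ ≤ 43 g`. The numerical constant has to exceed `400 * 2 * 43 = 34400`.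
  refine ⟨ERM.solver c, 40000 * (6 + 8 * c), 2, ?_⟩
  intro n d A ψ M μ L lam x₀ ε hd hM hμ hψ hlam hH hε hε2
  have : NeZero d := ⟨hd.ne'⟩
  have : Nonempty (Fin d) := ⟨⟨0, hd⟩⟩
  have hform := ERM.hessianForm_of_hessianGE (fun i => (hψ i).1) (fun i => (hψ i).2.1) hH
  have hlog2 : 1 / 2 ≤ Real.log (1 / ε) := by
    have h1 : (2 : ℝ) ≤ 1 / ε := by
      rw [le_div_iff₀ hε]
      linarith
    have h2 := Real.log_le_log (by norm_num) h1
    have h3 := Real.log_two_gt_d9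
    linarith
  have hn0 : 0 < n := by
    rcases Nat.eq_zero_or_pos n with rfl | h
    · exfalso
      have h1 := hform 0 (fun _ => 1)
      have h2 : (0 : ℝ) < d := by exact_mod_cast hd
      simp [dotProduct] at h1
      nlinarith
    · exact h
  have hM1 : 1 ≤ M := by
    have h1 := (hM ⟨0, hn0⟩).2.2 0
    have h2 := (hψ ⟨0, hn0⟩).2.2 0
    have h3 := hμ ⟨0, hn0⟩
    have hMpos : 0 < M := h3.trans_le (h2.1.trans h1.2)
    have h4 := h1.1.trans h1.2
    rw [div_le_iff₀ hMpos] at h4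
    nlinarith
  have hM0 : 0 < M := by linarith
  -- The Hessian is at most `M • Aᵀ A`, so `λ_min(Aᵀ A) ≥ lam / M > 0` and `κ` is a genuine
  -- quotient.
  have hgram : ∀ v : Fin d → ℝ, lam / M * (v ⬝ᵥ v) ≤ ∑ i, (A i ⬝ᵥ v) ^ 2 := fun v => by
    have h1 := hform 0 v
    have h2 : ∑ i, deriv (deriv (ψ i)) (A i ⬝ᵥ (0 : Fin d → ℝ)) * (A i ⬝ᵥ v) ^ 2
        ≤ M * ∑ i, (A i ⬝ᵥ v) ^ 2 := by
      rw [Finset.mul_sum]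
      exact Finset.sum_le_sum fun i _ => mul_le_mul_of_nonneg_right ((hM i).2.2 _).2 (sq_nonneg _)
    rw [div_mul_eq_mul_div, div_le_iff₀ hM0]
    linarith
  have hdn : d ≤ n := ERM.le_of_forall_mul_le A (by positivity) hgram
  have hmin : lam / M ≤ ⨅ j, ERM.gramEigenvalues A j := le_ciInf (ERM.le_gramEigenvalues A hgram)
  have hmin0 : 0 < ⨅ j, ERM.gramEigenvalues A j := lt_of_lt_of_le (by positivity) hmin
  have hmm : ⨅ j, ERM.gramEigenvalues A j ≤ ⨆ j, ERM.gramEigenvalues A j :=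
    (ciInf_le (Set.finite_range _).bddBelow (⟨0, hd⟩ : Fin d)).trans
      (le_ciSup (Set.finite_range _).bddAbove (⟨0, hd⟩ : Fin d))
  have hκ : 1 ≤ ERM.condNumber A := (one_le_div hmin0).mpr hmm
  have hn1 : (1 : ℝ) ≤ n := by exact_mod_cast hn0
  have hd1 : (1 : ℝ) ≤ d := by exact_mod_cast hd
  obtain ⟨X, hX⟩ : ∃ X, X = n * d * ERM.condNumber A * M := ⟨_, rfl⟩
  have hndκ : 1 ≤ (n : ℝ) * d * ERM.condNumber A :=
    one_le_mul_of_one_le_of_one_le (one_le_mul_of_one_le_of_one_le hn1 hd1) hκ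
  have hX1 : 1 ≤ X := hX ▸ one_le_mul_of_one_le_of_one_le hndκ hM1
  rw [← hX]
  have hlogX : 0 ≤ Real.log X := Real.log_nonneg hX1
  -- For `n = 1` the required probability is `0`, so time `0` will do. Otherwise `K ≥ n ≥ 2`, as the
  -- contraction requires.
  rcases Nat.lt_or_ge n 2 with hn2 | hn2
  · obtain rfl : n = 1 := by omega
    refine ⟨0, ?_, by simp⟩
    have h1 : 0 ≤ ∑ i, Real.sqrt (L i / μ i) + ∑ i, ERM.rowNorm A i * Real.sqrt (L i / lam) :=
      add_nonneg (Finset.sum_nonneg fun _ _ => Real.sqrt_nonneg _)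
        (Finset.sum_nonneg fun _ _ => mul_nonneg (norm_nonneg _) (Real.sqrt_nonneg _))
    have h2 : 0 ≤ Real.log (1 / ε) := by linarith
    push_cast
    positivity
  have hψ' : ∀ i, ERM.SecondDerivIn (ψ i) (μ i) (min (L i) M) := fun i => (hψ i).min_right (hM i)
  have hL'0 : ∀ i, 0 < min (L i) M := fun i =>
    (hμ i).trans_le (((hψ' i).2.2 0).1.trans ((hψ' i).2.2 0).2)
  have hs := hform.stronglyCvx (fun i => (hψ i).1) (fun i => (hψ i).2.1)
  -- A strong convexity constant determined by `κ` and `M` up to scaling; it occurs only in the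
  -- analysis and is never computed by the program.
  obtain ⟨lam', hlam'⟩ : ∃ l, l = (⨅ j, ERM.gramEigenvalues A j) / M := ⟨_, rfl⟩
  have hlam'0 : 0 < lam' := by rw [hlam']; positivity
  have hs' : ERM.StronglyCvx A ψ lam' := by
    refine ERM.HessianForm.stronglyCvx (fun i => (hψ i).1) (fun i => (hψ i).2.1) fun x v => ?_
    have h1 := ERM.iInf_gramEigenvalues_mul_le A v
    have h2 : 1 / M * ∑ i, (A i ⬝ᵥ v) ^ 2
        ≤ ∑ i, deriv (deriv (ψ i)) (A i ⬝ᵥ x) * (A i ⬝ᵥ v) ^ 2 := by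
      rw [Finset.mul_sum]
      exact Finset.sum_le_sum fun i _ => mul_le_mul_of_nonneg_right ((hM i).2.2 _).1 (sq_nonneg _)
    refine le_trans ?_ h2
    rw [hlam', div_mul_eq_mul_div, one_div, ← div_eq_inv_mul]
    gcongr
  obtain ⟨Q, hQ⟩ : ∃ Q, Q = d * ERM.condNumber A * M ^ 2 := ⟨_, rfl⟩
  have hQ1 : 1 ≤ Q := hQ ▸ one_le_mul_of_one_le_of_one_le
    (one_le_mul_of_one_le_of_one_le hd1 hκ) (one_le_pow₀ hM1)
  have hRQ : ERM.smoothness A (fun i => min (L i) M) / lam' ≤ Q := by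
    have h1 : ERM.smoothness A (fun i => min (L i) M) ≤ M * ∑ i, A i ⬝ᵥ A i := by
      rw [ERM.smoothness, Finset.mul_sum]
      exact Finset.sum_le_sum fun i _ =>
        mul_le_mul_of_nonneg_right (min_le_right _ _) (ERM.dotProduct_self_nonneg' _)
    have h2 := mul_le_mul_of_nonneg_left (ERM.sum_dotProduct_self_le A) hM0.le
    rw [div_le_iff₀ hlam'0]
    refine (h1.trans h2).trans_eq ?_
    rw [hQ, hlam', ERM.condNumber]
    field_simp
  -- `n Q = X M ≤ X²`, so a failed test bounds `K` by a polynomial in `X`.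
  have hnQ : (n : ℝ) ^ 2 * Q ^ 2 ≤ X ^ 4 := by
    have h1 : (n : ℝ) * Q = X * M := by rw [hQ, hX]; ring
    have h2 : M ≤ X := by
      rw [hX]
      exact le_mul_of_one_le_left hM0.le hndκ
    rw [← mul_pow, h1, show X ^ 4 = (X * X) ^ 2 by ring]
    gcongr
  obtain ⟨K, hK⟩ : ∃ K, K = ∑ i, ERM.multiplicity A (fun i => min (L i) M) lam i := ⟨_, rfl⟩
  have hnK : n ≤ K := hK ▸ ERM.card_le_sum_multiplicity A _ lam
  have hR0 : 0 < ERM.smoothness A (fun i => min (L i) M) :=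
    hlam.trans_le (hs.le_smoothness hψ' fun i => (hL'0 i).le)
  have hsp := ERM.one_le_rowSparsity hR0
  obtain ⟨S, hS1, hS, hS', hS'', hSle⟩ := ERM.exists_stage_count hε hε2 hn0 c
  obtain ⟨ℓ, hℓ1, hℓ, hℓ', hℓle⟩ := ERM.exists_doubling_count (hn0.trans_le hnK)
  obtain ⟨T, hT, hprob⟩ := ERM.solver_correct (x₀ := x₀) hψ' hμ hlam hs hε hdn hn2 hsp hlam'0 hs'
    hQ1 hRQ c hK hS1 hS hS' hS'' hℓ1 hℓ hℓ'
  refine ⟨T, ?_, hprob⟩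
  obtain ⟨N, hN⟩ : ∃ N, N = ∑ i, Real.sqrt (L i / μ i)
    + ∑ i, ERM.rowNorm A i * Real.sqrt (L i / lam) := ⟨_, rfl⟩
  have hKN : (K : ℝ) ≤ 2 * N := by
    rw [hK, hN]
    exact ERM.sum_multiplicity_le (fun i => (hL'0 i).le) (fun i => min_le_left _ _) hμ
      (fun i => ((hψ i).2.2 0).1.trans ((hψ i).2.2 0).2) hlam
  rw [← hN]
  obtain ⟨E, hE⟩ : ∃ E, E = Real.log (1 / ε) := ⟨_, rfl⟩
  obtain ⟨g, hg⟩ : ∃ g, g = 1 + Real.log X := ⟨_, rfl⟩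
  rw [← hE] at hlog2 hSle ⊢
  rw [← hg]
  have hg1 : 1 ≤ g := by linarith
  have hN0 : 0 ≤ N := by
    have : (0 : ℝ) ≤ K := Nat.cast_nonneg _
    linarith
  have hSg : (S : ℝ) ≤ (6 + 8 * c) * (E * g) := by
    have h1 : Real.log n ≤ g := by
      have : (n : ℝ) ≤ X := by
        rw [hX, mul_assoc, mul_assoc]
        exact le_mul_of_one_le_right (by positivity)
          (one_le_mul_of_one_le_of_one_le hd1 (one_le_mul_of_one_le_of_one_le hκ hM1))
      have := Real.log_le_log (by positivity) this
      linarith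
    -- Since `ε ≤ 1 / 2`, the logarithm `E` is at least `1 / 2`. Additive constants and `log n` can
    -- therefore be charged to the product `E g`.
    have hEg : 1 / 2 * g ≤ E * g := by gcongr
    have hc0 : (0 : ℝ) ≤ c := Nat.cast_nonneg _
    have h2 : (c : ℝ) * Real.log n ≤ c * (2 * (E * g)) := by
      gcongr
      linarith
    have h3 : E ≤ E * g := le_mul_of_one_le_right (by linarith) hg1
    linarith
  have hs0 : (0 : ℝ) ≤ ERM.rowSparsity A := Nat.cast_nonneg _
  have hE0 : 0 ≤ E := by linarith
  rcases hT with hT | ⟨hT, hKlt⟩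
  · have hT' : (T : ℝ) ≤ 400 * (S * K * ERM.rowSparsity A) := by exact_mod_cast hT
    calc (T : ℝ) ≤ 400 * (S * K * ERM.rowSparsity A) := hT'
      _ ≤ 400 * (((6 + 8 * c) * (E * g)) * (2 * N) * ERM.rowSparsity A) := by gcongr
      _ = 800 * (6 + 8 * c) * g * (N * ERM.rowSparsity A * E) := by ring
      _ ≤ 40000 * (6 + 8 * c) * g ^ 2 * (N * ERM.rowSparsity A * E) := by
        gcongr
        · norm_num
        · nlinarith
  · have hT' : (T : ℝ) ≤ 400 * (S * K * ℓ * ERM.rowSparsity A) := by exact_mod_cast hT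
    have hℓg : (ℓ : ℝ) ≤ 43 * g := by
      have := ERM.log_sq_le hX1 (hn0.trans_le hnK) (by linarith : (K : ℝ) ≤ 36 * X ^ 4)
      linarith
    calc (T : ℝ) ≤ 400 * (S * K * ℓ * ERM.rowSparsity A) := hT'
      _ ≤ 400 * (((6 + 8 * c) * (E * g)) * (2 * N) * (43 * g) * ERM.rowSparsity A) := by gcongr
      _ = 34400 * (6 + 8 * c) * g ^ 2 * (N * ERM.rowSparsity A * E) := by ring
      _ ≤ 40000 * (6 + 8 * c) * g ^ 2 * (N * ERM.rowSparsity A * E) := by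
        gcongr
        norm_num
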